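/- \textbf{Definitions.} For $d\ge 1$ let $\Delta_d=\{0,\dots,d\}$, and let $\mathbb G_d$ be the set of finite loopless multigraphs $\Gamma$ with a proper edge-coloring by colors in $\Delta_d$ such that every vertex lies on exactly one edge of each color $c<d$ and on at most one edge of color $d$. A vertex without (with) a $d$-colored edge is a boundary (internal) vertex; let $2\overline p$ and $2\dot p$ be the numbers of boundary and internal vertices. The boundary graph $\partial\Gamma$ has the boundary vertices as its vertices, two of them being joined by a $j$-colored edge ($j<d$) iff they are the ends of a path of $\Gamma$ whose edges have colors $j$ and $d$ alternately. Let $\mathcal K(\Gamma)$ be the simplicial cell complex made of one $d$-simplex with vertices labeled by $\Delta_d$ for each vertex of $\Gamma$, where for each $j$-colored edge $uv$ the facets opposite to the vertices labeled $j$ of the simplices of $u$ and $v$ are identified, preserving labels. $\Gamma$ represents a compact PL $d$-manifold $M$ if $|\mathcal K(\Gamma)|$ is PL homeomorphic to $M$. A crystallization of a connected compact PL $d$-manifold $M$ with $h$ boundary components is a connected graph $\Gamma\in\mathbb G_d$ that represents $M$ and such that, if $h\ge1$, $\mathcal K(\Gamma)$ has exactly $dh+1$ vertices and, if $h=0$,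 $\Gamma$ is contracted, i.e. it remains connected when all edges of any one color are deleted. For an ordering $\varepsilon=(\varepsilon_0,\dots,\varepsilon_d)$ of $\Delta_d$ with $\varepsilon_d=d$ let $$\rho_\varepsilon(\Gamma)=1-\tfrac12\Big(\sum_{i\in\mathbb Z_{d+1}}\dot g_{\varepsilon_i\varepsilon_{i+1}}+(1-d)\dot p+(2-d)\overline p\Big)-\tfrac12\,\partial g_{\varepsilon_0\varepsilon_{d-1}},$$ where $\dot g_{ij}$ and $\partial g_{ij}$ are the numbers of $\{i,j\}$-colored cycles of $\Gamma$ and of $\partial\Gamma$. Put $\rho(\Gamma)=\min_\varepsilon\rho_\varepsilon(\Gamma)$. The regular genus $\mathcal G(M)$ of a connected compact PL $d$-manifold $M$ is the minimum of $\rho(\Gamma)$ over all crystallizations $\Gamma$ of $M$. If $M$ is a compact PL $4$-manifold with boundary components $\partial^1M,\dots,\partial^hM$, then $\mathcal G(\partial M)=\sum_{i=1}^h\mathcal G(\partial^iM)$. The rank of a group is the least number of its generators. \textbf{Theorem.} Let $M$ be a connected compact PL $4$-manifold with $h\ge 1$ boundary components. Let $2M$ be the double of $M$, obtained by gluing two copies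 of $M$ along $\partial M$ by the identity, let $\chi(M)$ be the Euler characteristic of $M$, and let $m$ and $\overline m$ be the ranks of the fundamental groups of $M$ and $2M$. Then \begin{enumerate} \item[(i)] $\mathcal G(M)\ge 2\chi(M)+2\overline m-2$, \item[(ii)] $\mathcal G(M)\ge 2\chi(M)+3m+2h-4$, \item[(iii)] $\mathcal G(M)\ge \mathcal G(\partial M)+2\chi(M)+2m+2h-4$. \end{enumerate} -/

import Mathlib

open scoped Topology

noncomputable section

/-! ## Piecewise linear topology of compact polyhedra -/

section PL

variable {E F : Type*} [AddCommGroup E] [Module ℝ E] [AddCommGroup F] [Module ℝ F]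

/-- A map `f : P → F` on a compact polyhedron `P` (a finite union of convex hulls of finite sets)
is piecewise linear: `P` is a finite union of convex polytopes on each of which `f` is affine. -/
def IsPL (P : Set E) (f : P → F) : Prop :=
  ∃ 𝒞 : Finset (Finset E),
    P = ⋃ C ∈ 𝒞, convexHull ℝ (C : Set E) ∧
    ∀ C ∈ 𝒞, ∃ A : E →ᵃ[ℝ] F, ∀ x : P, (x : E) ∈ convexHull ℝ (C : Set E) → f x = A x

variable [TopologicalSpace E] [TopologicalSpace F]

/-- A homeomorphism between compact polyhedra is a PL homeomorphism if it is piecewise linear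
(its inverse is then piecewise linear as well). -/
def IsPLHomeo {P : Set E} {Q : Set F} (f : P ≃ₜ Q) : Prop :=
  IsPL P (fun x => (f x : F))

/-- The cube `[-1, 1]^d`. -/
def cube (d : ℕ) : Set (Fin d → ℝ) := {x | ∀ i, -1 ≤ x i ∧ x i ≤ 1}

/-- The half cube `[0, 1] × [-1, 1]^(d-1)`. -/
def halfCube (d : ℕ) : Set (Fin d → ℝ) := {x ∈ cube d | ∀ i : Fin d, (i : ℕ) = 0 → 0 ≤ x i}

/-- `x` has a neighbourhood in `P` that is PL homeomorphic to `Q`, with `x` sent to the origin. -/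
def HasPLChart {d : ℕ} (Q : Set (Fin d → ℝ)) (P : Set E) (x : E) : Prop :=
  ∃ N : Set E, N ⊆ P ∧ N ∈ 𝓝[P] x ∧
    ∃ (f : N ≃ₜ Q) (hx : x ∈ N), IsPLHomeo f ∧ (f ⟨x, hx⟩ : Fin d → ℝ) = 0

/-- A polyhedron is a PL `d`-manifold (possibly with boundary) if each of its points has a
neighbourhood PL homeomorphic to a neighbourhood of the origin in `ℝ^d` or in the half space. -/
def IsPLManifold (d : ℕ) (P : Set E) : Prop :=
  ∀ x ∈ P, HasPLChart (cube d) P x ∨ HasPLChart (halfCube d) P x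

/-- The boundary of a PL `d`-manifold. -/
def plBoundary (d : ℕ) (P : Set E) : Set E := {x ∈ P | HasPLChart (halfCube d) P x}

/-- The connected components of the boundary of `P`. -/
abbrev BoundaryComponent (d : ℕ) (P : Set E) : Type _ := ConnectedComponents (plBoundary d P)

/-- A connected component of the boundary, as a subset of the ambient space. -/
def BoundaryComponent.carrier {d : ℕ} {P : Set E} (C : BoundaryComponent d P) : Set E :=
  {x | ∃ hx : x ∈ plBoundary d P, ConnectedComponents.mk (⟨x, hx⟩ : plBoundary d P) = C}

/-- The number of boundary components. -/
def numBoundaryComponents (d : ℕ) (P : Set E) : ℕ := Nat.card (BoundaryComponent d P)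

/-- The double of `P`: two copies of `P`, glued by the identity along the boundary. -/
def Double (d : ℕ) (P : Set E) : Type _ :=
  Quot (fun a b : (Σ _ : Bool, P) => a.2 = b.2 ∧ (a.2 : E) ∈ plBoundary d P)

instance (d : ℕ) (P : Set E) : TopologicalSpace (Double d P) :=
  inferInstanceAs (TopologicalSpace (Quot _))

end PL

/-- The Euler characteristic of a finite simplicial complex: the alternating sum of the numbers
of its simplices. -/
def Geometry.SimplicialComplex.eulerCharacteristic {E : Type*} [AddCommGroup E] [Module ℝ E]
    (K : Geometry.SimplicialComplex ℝ E) : ℤ :=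
  ∑ᶠ s ∈ K.faces, (-1 : ℤ) ^ (s.card - 1)

/-- The rank of a group: the least cardinality of a generating set, `⊤` if the group is not
finitely generated. -/
def groupRank (G : Type*) [Group G] : EReal :=
  sInf {r | ∃ S : Finset G, Subgroup.closure (S : Set G) = ⊤ ∧ r = (S.card : EReal)}

/-! ## Edge-coloured graphs -/

/-- A properly edge-coloured multigraph without loops on the vertex set `V`, with colours
`0, …, d`, that is regular with respect to the colour `d`: every vertex lies on exactly one edge of
each colour `c ≠ d` and on at most one edge of colour `d`. The vertex `nbr c v` is the other end of
the `c`-coloured edge at `v`, and `nbr c v = v` means that there is no such edge. -/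
structure ColoredGraph (d : ℕ) (V : Type) where
  nbr : Fin (d + 1) → V → V
  nbr_nbr : ∀ c v, nbr c (nbr c v) = v
  nbr_ne : ∀ c v, c ≠ Fin.last d → nbr c v ≠ v

namespace ColoredGraph

variable {d : ℕ} {V : Type} (Γ : ColoredGraph d V)

/-- The connected components of the subgraph formed by all vertices and the edges with colour
in `B`. -/
def Component (B : Set (Fin (d + 1))) : Type :=
  Quot (fun u v : V => ∃ c ∈ B, Γ.nbr c u = v)

/-- The component of a vertex. -/
def comp (B : Set (Fin (d + 1))) (v : V) : Γ.Component B := Quot.mk _ v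

/-- A component is regular if each of its vertices lies on an edge of each colour in `B`. -/
def IsRegularComponent (B : Set (Fin (d + 1))) (C : Γ.Component B) : Prop :=
  ∀ v, Γ.comp B v = C → ∀ c ∈ B, Γ.nbr c v ≠ v

/-- The number of `{i, j}`-coloured cycles of the graph. -/
def numCycles (i j : Fin (d + 1)) : ℕ :=
  Nat.card {C : Γ.Component {i, j} // Γ.IsRegularComponent {i, j} C}

/-- The boundary vertices: those without an edge of colour `d`. -/
def BoundaryVertex : Type := {v : V // Γ.nbr (Fin.last d) v = v}

/-- The internal vertices. -/
def InternalVertex : Type := {v : V // Γ.nbr (Fin.last d) v ≠ v}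

/-- Adjacency by a `j`-coloured edge in the boundary graph: two different boundary vertices are
joined if they are joined in the graph by a path of edges of the colours `j` and `d`. -/
def BoundaryAdj (j : Fin (d + 1)) (u v : Γ.BoundaryVertex) : Prop :=
  u ≠ v ∧ Γ.comp {j, Fin.last d} u.1 = Γ.comp {j, Fin.last d} v.1

/-- The number of `{i, j}`-coloured cycles of the boundary graph, which is the number of its
`{i, j}`-coloured components. -/
def numBoundaryCycles (i j : Fin (d + 1)) : ℕ :=
  Nat.card (Quot (fun u v : Γ.BoundaryVertex => ∃ c ∈ ({i, j} : Set (Fin (d + 1))),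
    Γ.BoundaryAdj c u v))

/-- The graph is connected. -/
def IsConnected : Prop := Nonempty V ∧ ∀ u v, Γ.comp Set.univ u = Γ.comp Set.univ v

/-- The graph is contracted: it stays connected when all edges of any one colour are removed. -/
def IsContracted : Prop := Nonempty V ∧ ∀ c, ∀ u v, Γ.comp {c}ᶜ u = Γ.comp {c}ᶜ v

/-- The geometric carrier of the simplicial cell complex of the graph: a `d`-simplex with vertices
labelled `0, …, d` for each vertex of the graph, and for each `j`-coloured edge the identification
of the two faces opposite to the vertices labelled `j`, preserving labels. -/
def Carrier : Type :=
  Quot (fun a b : (Σ _ : V, stdSimplex ℝ (Fin (d + 1))) =>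
    ∃ j, Γ.nbr j a.1 = b.1 ∧ a.2 = b.2 ∧ (a.2 : Fin (d + 1) → ℝ) j = 0)

instance : TopologicalSpace Γ.Carrier := inferInstanceAs (TopologicalSpace (Quot _))

/-- The characteristic map of the simplex of the graph vertex `u`. -/
def charMap (u : V) (x : stdSimplex ℝ (Fin (d + 1))) : Γ.Carrier := Quot.mk _ ⟨u, x⟩

/-- The vertices of the simplicial cell complex. -/
def cellVertices : Set Γ.Carrier :=
  {q | ∃ (u : V) (x : stdSimplex ℝ (Fin (d + 1))) (i : Fin (d + 1)),
    (x : Fin (d + 1) → ℝ) = Pi.single i 1 ∧ q = Γ.charMap u x}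

/-- The graph represents the polyhedron `P`: there is a homeomorphism from the geometric carrier
onto `P` that is piecewise linear on each simplex. -/
def Represents {E : Type*} [AddCommGroup E] [Module ℝ E] [TopologicalSpace E] (P : Set E) : Prop :=
  ∃ f : Γ.Carrier ≃ₜ P,
    ∀ u, IsPL (stdSimplex ℝ (Fin (d + 1))) (fun x => (f (Γ.charMap u x) : E))

/-- A crystallization of the connected compact PL `d`-manifold `P`. If `P` is closed this is a
contracted graph that represents `P`; if `P` has `h ≥ 1` boundary components it is a connected
graph that represents `P` and whose simplicial cell complex has exactly `d * h + 1` vertices. -/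
def IsCrystallization {E : Type*} [AddCommGroup E] [Module ℝ E] [TopologicalSpace E]
    (P : Set E) : Prop :=
  Γ.Represents P ∧
    ((plBoundary d P = ∅ ∧ Γ.IsContracted) ∨
      ((plBoundary d P).Nonempty ∧ Γ.IsConnected ∧
        Γ.cellVertices.ncard = d * numBoundaryComponents d P + 1))

/-- The cyclic orders `(ε 0, …, ε d)` of the colours, normalized by `ε d = d`. -/
def CyclicOrder (d : ℕ) : Type := {ε : Equiv.Perm (Fin (d + 1)) // ε (Fin.last d) = Fin.last d}

/-- The Euler characteristic of the surface into which the graph embeds regularly with respect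
to `ε` (half the number of internal vertices is `p'`, half the number of boundary vertices `p''`):
`∑ i, g (ε i) (ε (i + 1)) + (1 - d) p' + (2 - d) p''`, with cyclic indices. -/
def surfaceChi (ε : CyclicOrder d) : ℝ :=
  (∑ i : Fin (d + 1), (Γ.numCycles (ε.1 i) (ε.1 (i + 1)) : ℝ))
    + (1 - d) * ((Nat.card Γ.InternalVertex : ℝ) / 2)
    + (2 - d) * ((Nat.card Γ.BoundaryVertex : ℝ) / 2)

/-- The number of holes of that surface: the number of cycles of the boundary graph with the
colours `ε 0` and `ε (d - 1)`. -/
def numHoles (ε : CyclicOrder d) : ℕ :=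
  Γ.numBoundaryCycles (ε.1 0) (ε.1 (Fin.last d - 1))

/-- The genus with respect to `ε`. -/
def rho (ε : CyclicOrder d) : ℝ :=
  1 - Γ.surfaceChi ε / 2 - (Γ.numHoles ε : ℝ) / 2

/-- The regular genus of the graph: the minimum over the (finitely many) cyclic orders. -/
def regularGenus : ℝ := ⨅ ε : CyclicOrder d, Γ.rho ε

end ColoredGraph

section Genus

variable {E : Type*} [AddCommGroup E] [Module ℝ E] [TopologicalSpace E]

/-- The regular genus of the connected compact PL `d`-manifold `P`: the minimum of the regular
genera of its crystallizations (with the convention that the minimum of the empty set is `⊤`). -/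
def regularGenus (d : ℕ) (P : Set E) : EReal :=
  sInf {r | ∃ (V : Type) (_ : Finite V) (Γ : ColoredGraph d V),
    Γ.IsCrystallization P ∧ r = (Γ.regularGenus : EReal)}

/-- The regular genus of the boundary of a PL `(d + 1)`-manifold: the sum of the regular genera of
the boundary components. -/
def boundaryRegularGenus (d : ℕ) (P : Set E) : EReal :=
  ∑ᶠ C : BoundaryComponent (d + 1) P, regularGenus d C.carrier

end Genus

end

/-! Fix a crystallization `Γ` of `M` and an order `ε` of the colours at which its genus is attained.
The cells with label set S are the components of the subgraph with the colours outside S; let F(S)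
be their number and N(S) the number of those in the boundary. The genus `rho` is a linear expression
in such numbers.

Because `M` is a manifold, these numbers satisfy relations of Dehn-Sommerville type
(`sum_numCells`). Moreover d h + 1 is the least possible number of vertices, so every boundary
component has exactly one vertex of each label below 4, and exactly one vertex has the label 4
(`isMinimal`). Writing ij for the labels `ε i`, `ε j` and χ for the Euler characteristic, linear
algebra then gives N(13) = N(02) and rho = 2χ + F(02) + F(13) + F(03) + F(24) + F(14) - 1 - 4h -
N(02) - N(03) (`rho_eq`), so that only edges of the complex have to be counted.

Edges are estimated in three ways. The graph formed by the edges with two given labels carries the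
fundamental group, so its rank is at most F(ij) - F(i) - F(j) + 1 (`exists_generators`); the same
holds for the double, whose complex has 2F(S) - N(S) cells with labels S. The edges with two labels
below 4 that are not in the boundary join the h boundary components together, so F(ij) - N(ij) ≥ h -
1. Finally, the boundary graph of each boundary component is a crystallization of that component,
whose genus for a suitable order is the number of edges with two given labels minus one; hence the
genus of the boundary is at most N(02) - h. The three inequalities are sums of these estimates
(`IsCrystallization.bounds`).

The topological input is an elementary theory of the Euler characteristic as a valuation on integral
combinations of indicators of compact convex sets, with a local version at a point x: a convex set
with exposed point x has local value 1 if it is {x} and 0 otherwise, which is one minus the Euler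
characteristic of its small link. Both are well defined and invariant under injective piecewise
affine maps. The local value of a d-manifold is (-1)^d at interior points and 0 at boundary points.
This recognizes the boundary as a subcomplex and yields the Dehn-Sommerville relations. To identify
the cells of the boundary graph with the boundary cells, links in the boundary must be connected in
codimension one; this follows by general position, since removing affine subspaces of codimension
two does not disconnect a ball. -/

noncomputable section

/-! ## The Euler characteristic as a valuation -/

section Euler

variable {E : Type*} [NormedAddCommGroup E] [NormedSpace ℝ E]

/-- The integer valued indicator function of a set. -/
def ind {α : Type*} (C : Set α) : α → ℤ := C.indicator 1

open Classical in
theorem ind_apply {α : Type*} (C : Set α) (y : α) : ind C y = if y ∈ C then 1 else 0 := by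
  simp [ind, Set.indicator_apply]

theorem ind_congr {α β : Type*} {A : Set α} {B : Set β} {y : α} {z : β} (h : y ∈ A ↔ z ∈ B) :
    ind A y = ind B z := by
  classical
  rw [ind_apply, ind_apply, if_congr h rfl rfl]

theorem ind_of_mem {α : Type*} {A : Set α} {y : α} (h : y ∈ A) : ind A y = 1 := by
  simp [ind, h]

theorem ind_of_notMem {α : Type*} {A : Set α} {y : α} (h : y ∉ A) : ind A y = 0 := by
  simp [ind, h]

theorem ind_inter {α : Type*} (A B : Set α) : ind (A ∩ B) = ind A * ind B := by
  classical
  ext y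
  by_cases hA : y ∈ A <;> by_cases hB : y ∈ B <;> simp [ind_apply, hA, hB]

theorem ind_iUnion {α κ : Type*} (s : Finset κ) (A : κ → Set α) :
    ind (⋃ k ∈ s, A k) = ∑ t ∈ s.powerset with t.Nonempty,
      (-1 : ℤ) ^ (t.card + 1) • ind (⋂ k ∈ t, A k) := by
  ext y
  rw [ind, Finset.indicator_biUnion_eq_sum_powerset]
  simp [ind]

/-- A relation between indicator functions of compact intervals is a relation between their
Euler characteristics. -/
theorem sum_eq_zero_of_interval_relation {ι : Type*} [Fintype ι] (a : ι → ℤ) (C : ι → Set ℝ)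
    (hc : ∀ i, IsCompact (C i)) (hcv : ∀ i, Convex ℝ (C i))
    (h : ∀ t, ∑ i, a i * ind (C i) t = 0) :
    ∑ i, a i * ind {i | (C i).Nonempty} i = 0 := by
  classical
  have hI : ∀ i, ∃ l r : ℝ, (C i).Nonempty → l ≤ r ∧ C i = Set.Icc l r := by
    intro i
    by_cases hi : (C i).Nonempty
    · have := eq_Icc_of_connected_compact ((hcv i).isConnected hi) (hc i)
      refine ⟨_, _, fun _ => ⟨?_, this⟩⟩
      rw [this] at hi
      exact Set.nonempty_Icc.1 hi
    · exact ⟨0, 0, fun h => absurd h hi⟩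
  choose l r hlr using hI
  -- Subtracting from the relation at `t` the relation at a point slightly to the right of `t`
  -- leaves exactly the intervals that end at `t`. Every nonempty interval is counted once in this
  -- way, at its right end.
  have key : ∀ t, ∑ i, a i * (if (C i).Nonempty ∧ r i = t then 1 else 0) = 0 := by
    intro t
    have h1 : ∀ i, ∀ᶠ s in 𝓝[>] t, ind (C i) s =
        if (C i).Nonempty ∧ l i ≤ t ∧ t < r i then 1 else 0 := by
      intro i
      by_cases hi : (C i).Nonempty
      · obtain ⟨_, hC⟩ := hlr i hi
        have hs : ∀ᶠ s in 𝓝[>] t, t < s := self_mem_nhdsWithin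
        rcases lt_or_ge t (l i) with h1 | h1
        · filter_upwards [nhdsWithin_le_nhds (Iio_mem_nhds h1)] with s hs
          rw [ind_apply, hC]
          simp [not_le.2 h1, not_le.2 (Set.mem_Iio.1 hs)]
        rcases lt_or_ge t (r i) with h2 | h2
        · filter_upwards [nhdsWithin_le_nhds (Iio_mem_nhds h2), hs] with s hs hs'
          have hm : s ∈ C i := by
            rw [hC]
            exact ⟨h1.trans hs'.le, le_of_lt hs⟩
          rw [ind_apply, if_pos hm, if_pos (And.intro hi ⟨h1, h2⟩)]
        · filter_upwards [hs] with s hs'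
          rw [ind_apply, if_neg fun h : _ ∧ _ ∧ _ => absurd h.2.2 (not_lt.2 h2), if_neg]
          rw [hC]
          exact fun h => absurd h.2 (not_le.2 (lt_of_le_of_lt h2 hs'))
      · rw [Set.not_nonempty_iff_eq_empty] at hi
        simp [hi, ind]
    obtain ⟨s, hs⟩ := (Filter.eventually_all.2 h1).exists
    have h2 := h s
    have h3 := h t
    refine Eq.trans (Finset.sum_congr rfl fun i _ => ?_)
      ((Finset.sum_sub_distrib _ _).trans (sub_eq_zero.2 (h3.trans h2.symm)))
    rw [hs i, ind_apply]
    by_cases hi : (C i).Nonempty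
    · obtain ⟨h4, hC⟩ := hlr i hi
      have hm : t ∈ C i ↔ l i ≤ t ∧ t ≤ r i := by rw [hC]; rfl
      simp only [hi, true_and, hm]
      rcases lt_trichotomy t (r i) with h5 | h5 | h5
      · simp [h5, h5.le, h5.ne']
      · simp [h5, h4]
      · simp [not_le.2 h5, not_lt.2 h5.le, h5.ne]
    · rw [Set.not_nonempty_iff_eq_empty] at hi
      simp [hi]
  have h4 : ∑ t ∈ Finset.univ.image r, ∑ i, a i * (if (C i).Nonempty ∧ r i = t then 1 else 0) = 0 :=
    Finset.sum_eq_zero fun t _ => key t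
  rw [Finset.sum_comm] at h4
  rw [← h4]
  refine Finset.sum_congr rfl fun i _ => ?_
  rw [← Finset.mul_sum, ind_apply]
  by_cases hi : (C i).Nonempty <;> simp [hi]

/-- A linear relation between the indicator functions of compact convex sets is a relation between
their Euler characteristics. -/
theorem sum_eq_zero_of_convex_relation [FiniteDimensional ℝ E] {ι : Type*} [Fintype ι] (a : ι → ℤ)
    (C : ι → Set E) (hc : ∀ i, IsCompact (C i)) (hcv : ∀ i, Convex ℝ (C i))
    (h : ∀ y, ∑ i, a i * ind (C i) y = 0) :
    ∑ i, a i * ind {i | (C i).Nonempty} i = 0 := by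
  classical
  let b := Module.finBasis ℝ E
  have hcont : ∀ k, Continuous (b.coord k) := fun k =>
    LinearMap.continuous_of_finiteDimensional (b.coord k)
  let D : Finset (Fin (Module.finrank ℝ E)) → (Fin (Module.finrank ℝ E) → ℝ) → ι → Set E :=
    fun s t i => C i ∩ {y | ∀ k ∈ s, b.coord k y = t k}
  have hclosed : ∀ (s : Finset (Fin (Module.finrank ℝ E))) (t : Fin (Module.finrank ℝ E) → ℝ),
      IsClosed {y : E | ∀ k ∈ s, b.coord k y = t k} := by
    intro s t
    simp only [Set.ofPred_forall]
    exact isClosed_iInter fun k => isClosed_iInter fun _ => isClosed_eq (hcont k) continuous_const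
  have hconv : ∀ (s : Finset (Fin (Module.finrank ℝ E)))
      (t : Fin (Module.finrank ℝ E) → ℝ),
      Convex ℝ {y : E | ∀ k ∈ s, b.coord k y = t k} := by
    intro s t y hy z hz p q hp hq hpq k hk
    rw [map_add, map_smul, map_smul, hy k hk, hz k hk, ← add_smul, hpq, one_smul]
  -- Induction on the set `s` of free coordinates. If none is free, a slice is at most a point and
  -- the relation is the given one. To free `k`, project the slices to this coordinate: the images
  -- are compact intervals, and a value `τ` lies in an image iff the slice with the coordinate `k`
  -- fixed at `τ` is nonempty.
  have hD : ∀ s : Finset (Fin (Module.finrank ℝ E)), ∀ t,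
      ∑ i, a i * ind {i | (D sᶜ t i).Nonempty} i = 0 := by
    intro s
    induction s using Finset.induction with
    | empty =>
      intro t
      rw [← h (b.equivFun.symm t)]
      refine Finset.sum_congr rfl fun i _ => ?_
      congr 1
      rw [ind_apply, ind_apply]
      refine if_congr ?_ rfl rfl
      have : ∀ y : E, (∀ k ∈ (∅ : Finset (Fin (Module.finrank ℝ E)))ᶜ, b.coord k y = t k) ↔
          y = b.equivFun.symm t := by
        intro y
        rw [LinearEquiv.eq_symm_apply, funext_iff]
        simp
      constructor
      · rintro ⟨y, hy, hy'⟩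
        rwa [← (this y).1 hy']
      · intro hy
        exact ⟨_, hy, (this _).2 rfl⟩
    | insert k s hk ih =>
      intro t
      have h1 := sum_eq_zero_of_interval_relation a
        (fun i => b.coord k '' D (insert k s)ᶜ t i)
        (fun i => ((hc i).inter_right (hclosed _ _)).image (hcont k))
        (fun i => ((hcv i).inter (hconv _ _)).linear_image (b.coord k)) ?_
      · simpa using h1
      · intro τ
        rw [← ih (Function.update t k τ)]
        refine Finset.sum_congr rfl fun i _ => ?_
        congr 1
        rw [ind_apply, ind_apply]
        refine if_congr ?_ rfl rfl
        constructor
        · rintro ⟨y, ⟨hy, hy'⟩, hyk⟩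
          refine ⟨y, hy, fun j hj => ?_⟩
          by_cases hjk : j = k
          · subst hjk; simpa using hyk
          · rw [Function.update_of_ne hjk]
            exact hy' j (by simp_all)
        · rintro ⟨y, hy, hy'⟩
          refine ⟨y, ⟨hy, fun j hj => ?_⟩, ?_⟩
          · have hjk : j ≠ k := by rintro rfl; simp at hj
            have := hy' j (by simp_all)
            rwa [Function.update_of_ne hjk] at this
          · simpa using hy' k (by simpa using hk)
  simpa [D] using hD Finset.univ 0

variable (E) in
/-- The pairs of a constructible function and its Euler characteristic. -/
def eulerPairs : Submodule ℤ ((E → ℤ) × ℤ) :=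
  Submodule.span ℤ {p | ∃ C : Set E, IsCompact C ∧ Convex ℝ C ∧ C.Nonempty ∧ p = (ind C, 1)}

/-- The function `f` is an integral combination of indicator functions of compact convex sets, and
`n` is its integral with respect to the Euler characteristic. -/
def HasEuler (f : E → ℤ) (n : ℤ) : Prop := (f, n) ∈ eulerPairs E

theorem HasEuler.of_convex {C : Set E} (hc : IsCompact C) (hcv : Convex ℝ C) (hn : C.Nonempty) :
    HasEuler (ind C) 1 :=
  Submodule.subset_span ⟨C, hc, hcv, hn, rfl⟩

theorem HasEuler.zero : HasEuler (0 : E → ℤ) 0 := (eulerPairs E).zero_mem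

/-- Intersections of convex pieces may be empty. Writing the value as an indicator of nonemptiness
treats all pieces uniformly. -/
theorem HasEuler.ind_inter_nonempty {C : Set E} (hc : IsCompact C) (hcv : Convex ℝ C) :
    HasEuler (ind C) (ind {C : Set E | C.Nonempty} C) := by
  by_cases h : C.Nonempty
  · simpa [ind, h] using HasEuler.of_convex hc hcv h
  · rw [Set.not_nonempty_iff_eq_empty] at h
    subst h
    have h0 : ind (∅ : Set E) = 0 := by ext; simp [ind]
    have h1 : ind {C : Set E | C.Nonempty} ∅ = 0 := by simp [ind]
    rw [h0, h1]
    exact HasEuler.zero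

theorem HasEuler.smul {f : E → ℤ} {n : ℤ} (h : HasEuler f n) (a : ℤ) :
    HasEuler (a • f) (a • n) :=
  (eulerPairs E).smul_mem a h

theorem HasEuler.sum {ι : Type*} (s : Finset ι) {f : ι → E → ℤ} {n : ι → ℤ}
    (h : ∀ i ∈ s, HasEuler (f i) (n i)) : HasEuler (∑ i ∈ s, f i) (∑ i ∈ s, n i) := by
  have := (eulerPairs E).sum_mem h
  have h2 : ∑ i ∈ s, (f i, n i) = (∑ i ∈ s, f i, ∑ i ∈ s, n i) :=
    Prod.ext Prod.fst_sum Prod.snd_sum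
  rwa [h2] at this

/-- The span of the pairs is the graph of a homomorphism: by `sum_eq_zero_of_convex_relation`, a
vanishing combination of indicators of nonempty compact convex sets has coefficient sum zero. -/
theorem HasEuler.unique [FiniteDimensional ℝ E] {f : E → ℤ} {m n : ℤ} (hm : HasEuler f m)
    (hn : HasEuler f n) : m = n := by
  classical
  have h : (0, m - n) ∈ eulerPairs E := by
    have := (eulerPairs E).sub_mem hm hn
    simpa using this
  obtain ⟨k, a, g, hg⟩ := Submodule.mem_span_set'.1 h
  choose C hc hcv hne hC using fun i => (g i).2
  simp only [hC] at hg
  have h1 := congrArg Prod.fst hg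
  have h2 := congrArg Prod.snd hg
  rw [Prod.fst_sum] at h1
  rw [Prod.snd_sum] at h2
  have := sum_eq_zero_of_convex_relation a C hc hcv (fun y => by
    have := congrFun h1 y
    simpa using this)
  simp only [ind_apply, Set.mem_ofPred_eq, hne, if_true, mul_one] at this
  simp only [Prod.smul_mk, smul_eq_mul, mul_one] at h2
  omega

end Euler
end

noncomputable section

/-! ## Local Euler characteristics -/

section LocalEuler

variable {E : Type*} [NormedAddCommGroup E] [NormedSpace ℝ E]

/-- The function `g` respects convex combinations of points of `C`. -/
def AffineOn (g : E → ℝ) (C : Set E) : Prop :=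
  ∀ y ∈ C, ∀ z ∈ C, ∀ p q : ℝ, 0 ≤ p → 0 ≤ q → p + q = 1 → g (p • y + q • z) = p * g y + q * g z

theorem AffineOn.mono {g : E → ℝ} {C D : Set E} (h : AffineOn g C) (hDC : D ⊆ C) : AffineOn g D :=
  fun y hy z hz => h y (hDC hy) z (hDC hz)

theorem AffineOn.convex_level {g : E → ℝ} {C : Set E} (h : AffineOn g C) (hC : Convex ℝ C) (δ : ℝ) :
    Convex ℝ (C ∩ {y | g y = δ}) := by
  rintro y ⟨hy, hy'⟩ z ⟨hz, hz'⟩ p q hp hq hpq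
  refine ⟨hC hy hz hp hq hpq, ?_⟩
  simp only [Set.mem_ofPred_eq] at *
  rw [h y hy z hz p q hp hq hpq, hy', hz', ← add_mul, hpq, one_mul]

theorem AffineOn.exists_level {g : E → ℝ} {C : Set E} (h : AffineOn g C) (hC : Convex ℝ C) {x y : E}
    (hx : x ∈ C) (hy : y ∈ C) (hgx : g x = 0) {δ : ℝ} (hδ : 0 < δ) (hδy : δ ≤ g y) :
    (C ∩ {y | g y = δ}).Nonempty := by
  have h1 : 0 < g y := hδ.trans_le hδy
  have h2 : δ / g y ≤ 1 := (div_le_one h1).2 hδy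
  have h3 : 0 ≤ δ / g y := (div_pos hδ h1).le
  refine ⟨(1 - δ / g y) • x + (δ / g y) • y, hC hx hy (by linarith) h3 (by ring), ?_⟩
  simp only [Set.mem_ofPred_eq]
  rw [h x hx y hy _ _ (by linarith) h3 (by ring), hgx]
  field_simp
  ring

/-- The compact convex set `C` has `x` as an exposed point. -/
structure ExposedAt (x : E) (C : Set E) : Prop where
  mem : x ∈ C
  compact : IsCompact C
  convex : Convex ℝ C
  exists_fun : ∃ g : E → ℝ, g x = 0 ∧ (∀ y ∈ C, y ≠ x → 0 < g y) ∧ AffineOn g C ∧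
    ∀ δ, IsCompact (C ∩ {y | g y = δ})

/-- The closed half lines and the origin in `ℝ`. -/
def signSet : SignType → Set ℝ
  | 1 => Set.Ici 0
  | 0 => {0}
  | -1 => Set.Iic 0

/-- The coefficients with which the indicator functions of the sets `signSet` sum up to `1`. -/
def signCoef : SignType → ℤ
  | 1 => 1
  | 0 => -1
  | -1 => 1

theorem SignType.sum_eq {M : Type*} [AddCommMonoid M] (f : SignType → M) :
    ∑ σ, f σ = f 0 + f (-1) + f 1 := by
  have : (Finset.univ : Finset SignType) = {0, -1, 1} := by decide
  rw [this]
  simp [add_assoc]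

theorem sum_signCoef (t : ℝ) : ∑ σ, signCoef σ * ind (signSet σ) t = 1 := by
  classical
  rw [SignType.sum_eq]
  simp only [signCoef, signSet, ind_apply, Set.mem_singleton_iff, Set.mem_Iic, Set.mem_Ici]
  rcases lt_trichotomy t 0 with h | h | h
  · simp [h.ne, h.le, not_le.2 h]
  · simp [h]
  · simp [h.ne', h.le, not_le.2 h]

theorem isClosed_signSet (σ : SignType) : IsClosed (signSet σ) := by
  cases σ
  · exact isClosed_singleton
  · exact isClosed_Iic
  · exact isClosed_Ici

theorem zero_mem_signSet (σ : SignType) : (0 : ℝ) ∈ signSet σ := by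
  cases σ <;> simp [signSet]

theorem convex_signSet (σ : SignType) : Convex ℝ (signSet σ) := by
  cases σ
  · exact convex_singleton 0
  · exact convex_Iic 0
  · exact convex_Ici 0

theorem abs_add_of_mem_signSet {σ : SignType} {s t p q : ℝ} (hs : s ∈ signSet σ)
    (ht : t ∈ signSet σ) (hp : 0 ≤ p) (hq : 0 ≤ q) : |p * s + q * t| = p * |s| + q * |t| := by
  cases σ
  · have h1 : s = 0 := hs
    have h2 : t = 0 := ht
    simp [h1, h2]
  · have h1 : s ≤ 0 := hs
    have h2 : t ≤ 0 := ht
    rw [abs_of_nonpos h1, abs_of_nonpos h2, abs_of_nonpos]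
    · ring
    · nlinarith
  · have h1 : 0 ≤ s := hs
    have h2 : 0 ≤ t := ht
    rw [abs_of_nonneg h1, abs_of_nonneg h2, abs_of_nonneg]
    nlinarith

section Orthant

set_option linter.unusedSectionVars false

variable {κ : Type*} [Fintype κ] (φ : κ → E →L[ℝ] ℝ) (x : E)

/-- The closed orthants with apex `x` with respect to the coordinates `φ`. -/
def orthant (s : κ → SignType) : Set E := {y | ∀ k, φ k (y - x) ∈ signSet (s k)}

/-- The coefficients with which the indicator functions of the orthants sum up to `1`. -/
def orthantCoef (s : κ → SignType) : ℤ := ∏ k, signCoef (s k)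

/-- The `ℓ¹` distance from `x` with respect to the coordinates `φ`. -/
def coordDist (y : E) : ℝ := ∑ k, |φ k (y - x)|

theorem sum_orthantCoef_mul [DecidableEq κ] (y : E) :
    ∑ s : κ → SignType, orthantCoef s * ind (orthant φ x s) y = 1 := by
  classical
  have h : ∀ s : κ → SignType, ind (orthant φ x s) y = ∏ k, ind (signSet (s k)) (φ k (y - x)) := by
    intro s
    rw [ind_apply]
    simp only [ind_apply, Finset.prod_ite_zero, orthant, Set.mem_ofPred_eq]
    simp
  simp only [h, orthantCoef, ← Finset.prod_mul_distrib]
  have h2 := Finset.prod_univ_sum (fun _ : κ => (Finset.univ : Finset SignType))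
    (fun k σ => signCoef σ * ind (signSet σ) (φ k (y - x)))
  rw [Fintype.piFinset_univ] at h2
  rw [← h2]
  simp [sum_signCoef]

/-- This cuts `C` into convex pieces on each of which the `ℓ¹` distance from `x` is affine, so that
small spheres around `x` meet every piece in a convex set. -/
theorem ind_eq_sum_orthant [DecidableEq κ] (C : Set E) :
    ind C = ∑ s : κ → SignType, orthantCoef s • ind (C ∩ orthant φ x s) := by
  ext y
  rw [Finset.sum_apply]
  simp only [ind_inter, Pi.smul_apply, Pi.mul_apply, smul_eq_mul]
  simp_rw [mul_left_comm _ (ind C y) _]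
  rw [← Finset.mul_sum, sum_orthantCoef_mul, mul_one]

theorem isClosed_orthant (s : κ → SignType) : IsClosed (orthant φ x s) := by
  have : orthant φ x s = ⋂ k, (fun y => φ k (y - x)) ⁻¹' signSet (s k) := by
    ext y; simp [orthant]
  rw [this]
  exact isClosed_iInter fun k => (isClosed_signSet _).preimage (by fun_prop)

theorem convex_orthant (s : κ → SignType) : Convex ℝ (orthant φ x s) := by
  intro y hy z hz p q hp hq hpq k
  have : p • y + q • z - x = p • (y - x) + q • (z - x) := by
    rw [smul_sub, smul_sub, sub_add_sub_comm, ← add_smul, hpq, one_smul]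
  rw [this, map_add, map_smul, map_smul]
  exact convex_signSet _ (hy k) (hz k) hp hq hpq

theorem mem_orthant (s : κ → SignType) : x ∈ orthant φ x s := by
  intro k
  simpa using zero_mem_signSet (s k)

theorem continuous_coordDist : Continuous (coordDist φ x) := by
  unfold coordDist
  fun_prop

@[simp] theorem coordDist_self : coordDist φ x x = 0 := by simp [coordDist]

theorem coordDist_pos (hφ : ∀ y, (∀ k, φ k y = 0) → y = 0) {y : E} (hy : y ≠ x) :
    0 < coordDist φ x y := by
  refine lt_of_le_of_ne (Finset.sum_nonneg fun k _ => abs_nonneg _) fun h => hy ?_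
  rw [← sub_eq_zero]
  refine hφ _ fun k => ?_
  have := (Finset.sum_eq_zero_iff_of_nonneg fun k _ => abs_nonneg (φ k (y - x))).1 h.symm k
  simpa using this

theorem affineOn_coordDist (s : κ → SignType) : AffineOn (coordDist φ x) (orthant φ x s) := by
  intro y hy z hz p q hp hq hpq
  unfold coordDist
  rw [Finset.mul_sum, Finset.mul_sum, ← Finset.sum_add_distrib]
  refine Finset.sum_congr rfl fun k _ => ?_
  have : p • y + q • z - x = p • (y - x) + q • (z - x) := by
    rw [smul_sub, smul_sub, sub_add_sub_comm, ← add_smul, hpq, one_smul]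
  rw [this, map_add, map_smul, map_smul]
  exact abs_add_of_mem_signSet (hy k) (hz k) hp hq

theorem exposedAt_inter_orthant (hφ : ∀ y, (∀ k, φ k y = 0) → y = 0) {C : Set E} (hx : x ∈ C)
    (hc : IsCompact C) (hcv : Convex ℝ C) (s : κ → SignType) : ExposedAt x (C ∩ orthant φ x s) where
  mem := ⟨hx, mem_orthant φ x s⟩
  compact := hc.inter_right (isClosed_orthant φ x s)
  convex := hcv.inter (convex_orthant φ x s)
  exists_fun := ⟨coordDist φ x, coordDist_self φ x, fun _ _ h => coordDist_pos φ x hφ h,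
    (affineOn_coordDist φ x s).mono Set.inter_subset_right,
    fun _ => (hc.inter_right (isClosed_orthant φ x s)).inter_right
      (isClosed_eq (continuous_coordDist φ x) continuous_const)⟩

/-- If `g` exposes `x`, a convex subset `D` of `C` containing `x` meets the level `g = δ`, for small
`δ > 0`, exactly when `D ≠ {x}`. Both sides are therefore the Euler characteristic of that level set
of `C`, computed orthant by orthant and as a whole. -/
theorem ExposedAt.sum_orthant [FiniteDimensional ℝ E] [DecidableEq κ] {x} {C : Set E}
    (h : ExposedAt x C) :
    ∑ s : κ → SignType, orthantCoef s * ind {D : Set E | D ≠ {x}} (C ∩ orthant φ x s) =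
      ind {D : Set E | D ≠ {x}} C := by
  classical
  obtain ⟨g, hgx, hg, hga, hgc⟩ := h.exists_fun
  have hlevel : ∀ D : Set E, D ⊆ C → Convex ℝ D → x ∈ D → ∀ᶠ δ in 𝓝[>] (0 : ℝ),
      ((D ∩ {y | g y = δ}).Nonempty ↔ D ≠ {x}) := by
    intro D hDC hD hxD
    have hpos : ∀ᶠ δ in 𝓝[>] (0 : ℝ), 0 < δ := self_mem_nhdsWithin
    by_cases hDx : D = {x}
    · filter_upwards [hpos] with δ hδ
      simp only [hDx, ne_eq, not_true_eq_false, iff_false]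
      rintro ⟨y, hy, hy'⟩
      rw [Set.mem_singleton_iff.1 hy] at hy'
      simp only [Set.mem_ofPred_eq, hgx] at hy'
      exact hδ.ne hy'
    · obtain ⟨y, hy, hyx⟩ : ∃ y ∈ D, y ≠ x := by
        by_contra! hcon
        exact hDx (Set.eq_singleton_iff_unique_mem.2 ⟨hxD, hcon⟩)
      filter_upwards [hpos, nhdsWithin_le_nhds (Iio_mem_nhds (hg y (hDC hy) hyx))] with δ hδ hδ'
      exact ⟨fun _ => hDx, fun _ => (hga.mono hDC).exists_level hD hxD hy hgx hδ (le_of_lt hδ')⟩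
  have h1 : ∀ s : κ → SignType, ∀ᶠ δ in 𝓝[>] (0 : ℝ),
      (((C ∩ orthant φ x s) ∩ {y | g y = δ}).Nonempty ↔ (C ∩ orthant φ x s) ≠ {x}) := fun s =>
    hlevel _ Set.inter_subset_left (h.convex.inter (convex_orthant φ x s)) ⟨h.mem, mem_orthant φ x s⟩
  obtain ⟨δ, h2, h3⟩ :=
    ((Filter.eventually_all.2 h1).and (hlevel C subset_rfl h.convex h.mem)).exists
  have h4 := HasEuler.ind_inter_nonempty (hgc δ) (hga.convex_level h.convex δ)
  rw [ind_eq_sum_orthant φ x (C ∩ {y | g y = δ})] at h4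
  have h5 := HasEuler.sum Finset.univ (fun s _ => (HasEuler.ind_inter_nonempty
    ((hgc δ).inter_right (isClosed_orthant φ x s))
    ((hga.convex_level h.convex δ).inter (convex_orthant φ x s))).smul (orthantCoef s))
  have h6 := h5.unique h4
  refine Eq.trans (Finset.sum_congr rfl fun s _ => ?_) (h6.trans (ind_congr h3))
  rw [Set.inter_right_comm, smul_eq_mul]
  congr 1
  exact ind_congr (h2 s).symm

end Orthant

theorem exists_coords [FiniteDimensional ℝ E] :
    ∃ φ : Fin (Module.finrank ℝ E) → E →L[ℝ] ℝ, ∀ y, (∀ k, φ k y = 0) → y = 0 := by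
  refine ⟨fun k => LinearMap.toContinuousLinearMap ((Module.finBasis ℝ E).coord k), fun y hy => ?_⟩
  exact (Module.finBasis ℝ E).forall_coord_eq_zero_iff.1 hy

/-- A linear relation that holds near `x` between indicator functions of compact convex sets with
the exposed point `x` gives a relation between the multiplicities of the trivial ones. -/
theorem sum_eq_zero_of_exposed_relation [FiniteDimensional ℝ E] {ι : Type*} [Fintype ι] {x : E}
    (a : ι → ℤ) (C : ι → Set E) (hC : ∀ i, ExposedAt x (C i))
    (h : ∀ᶠ y in 𝓝 x, ∑ i, a i * ind (C i) y = 0) :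
    ∑ i, a i * ind {D : Set E | D = {x}} (C i) = 0 := by
  classical
  obtain ⟨φ, hφ⟩ := exists_coords (E := E)
  obtain ⟨U, hU, hUo, hxU⟩ := eventually_nhds_iff.1 h
  have hpos : ∀ᶠ ε in 𝓝[>] (0 : ℝ), 0 < ε := self_mem_nhdsWithin
  -- The compact set `C i \ U` has a positive distance from `x`, so spheres of smaller radius meet
  -- `C i` only inside `U`, where the relation is known to hold.
  have h1 : ∀ i, ∀ᶠ ε in 𝓝[>] (0 : ℝ), ∀ y ∈ C i, coordDist φ x y = ε → y ∈ U := by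
    intro i
    by_cases hne : (C i \ U).Nonempty
    · obtain ⟨z, hz, hz'⟩ := ((hC i).compact.diff hUo).exists_isMinOn hne
        (continuous_coordDist φ x).continuousOn
      have hzx : z ≠ x := by rintro rfl; exact hz.2 hxU
      filter_upwards [nhdsWithin_le_nhds (Iio_mem_nhds (coordDist_pos φ x hφ hzx))] with ε hε y hy hye
      by_contra hyU
      have := hz' (a := y) ⟨hy, hyU⟩
      simp only [Set.mem_ofPred_eq, hye] at this
      exact absurd hε (not_lt.2 this)
    · refine Filter.Eventually.of_forall fun ε y hy _ => ?_
      by_contra hyU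
      exact hne ⟨y, hy, hyU⟩
  have h2 : ∀ i, ∀ s : Fin (Module.finrank ℝ E) → SignType, ∀ᶠ ε in 𝓝[>] (0 : ℝ),
      (((C i ∩ orthant φ x s) ∩ {y | coordDist φ x y = ε}).Nonempty ↔
        (C i ∩ orthant φ x s) ≠ {x}) := by
    intro i s
    by_cases hDx : C i ∩ orthant φ x s = {x}
    · filter_upwards [hpos] with δ hδ
      simp only [hDx, ne_eq, not_true_eq_false, iff_false]
      rintro ⟨y, hy, hy'⟩
      rw [Set.mem_singleton_iff.1 hy] at hy'
      simp only [Set.mem_ofPred_eq, coordDist_self] at hy'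
      exact hδ.ne hy'
    · obtain ⟨y, hy, hyx⟩ : ∃ y ∈ C i ∩ orthant φ x s, y ≠ x := by
        by_contra! hcon
        exact hDx (Set.eq_singleton_iff_unique_mem.2 ⟨⟨(hC i).mem, mem_orthant φ x s⟩, hcon⟩)
      filter_upwards [hpos, nhdsWithin_le_nhds (Iio_mem_nhds (coordDist_pos φ x hφ hyx))]
        with δ hδ hδ'
      exact ⟨fun _ => hDx, fun _ => ((affineOn_coordDist φ x s).mono
        Set.inter_subset_right).exists_level ((hC i).convex.inter (convex_orthant φ x s))
        ⟨(hC i).mem, mem_orthant φ x s⟩ hy (coordDist_self φ x) hδ (le_of_lt hδ')⟩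
  obtain ⟨ε, h3, h4⟩ := ((Filter.eventually_all.2 h1).and
    (Filter.eventually_all.2 fun i => Filter.eventually_all.2 (h2 i))).exists
  have hcl : IsClosed {y | coordDist φ x y = ε} :=
    isClosed_eq (continuous_coordDist φ x) continuous_const
  -- The relation is restricted to a small sphere, where all pieces are compact and convex. The
  -- pieces of `C i` contribute the Euler characteristic of the link, which is 0 or 1 according to
  -- whether `C i` is trivial.
  have h5 := sum_eq_zero_of_convex_relation
    (fun p : ι × (Fin (Module.finrank ℝ E) → SignType) => a p.1 * orthantCoef p.2)
    (fun p => (C p.1 ∩ orthant φ x p.2) ∩ {y | coordDist φ x y = ε})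
    (fun p => ((hC p.1).compact.inter_right (isClosed_orthant φ x p.2)).inter_right hcl)
    (fun p => ((affineOn_coordDist φ x p.2).mono Set.inter_subset_right).convex_level
      ((hC p.1).convex.inter (convex_orthant φ x p.2)) ε) ?_
  · rw [Fintype.sum_prod_type] at h5
    have h6 : ∑ i, a i * ind {D : Set E | D ≠ {x}} (C i) = 0 := by
      rw [← h5]
      refine Finset.sum_congr rfl fun i _ => ?_
      rw [← (hC i).sum_orthant φ, Finset.mul_sum]
      refine Finset.sum_congr rfl fun s _ => ?_
      rw [mul_assoc]
      congr 2
      exact ind_congr (h4 i s).symm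
    -- At `x` itself the relation says that all multiplicities add up to zero. Subtracting the
    -- multiplicities of the nontrivial sets leaves those of the trivial ones.
    have h7 := hU x hxU
    rw [← sub_eq_zero.2 (h7.trans h6.symm), ← Finset.sum_sub_distrib]
    refine Finset.sum_congr rfl fun i _ => ?_
    rw [← mul_sub]
    congr 1
    by_cases hx : C i = {x} <;> simp [ind_apply, hx, (hC i).mem]
  · intro y
    rw [Fintype.sum_prod_type]
    have h6 : ∀ i, ∑ s, a i * orthantCoef s *
        ind (C i ∩ orthant φ x s ∩ {y | coordDist φ x y = ε}) y =
        a i * ind (C i) y * ind {y | coordDist φ x y = ε} y := by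
      intro i
      have := congrFun (ind_eq_sum_orthant φ x (C i)) y
      rw [this, Finset.sum_apply, Finset.mul_sum, Finset.sum_mul]
      refine Finset.sum_congr rfl fun s _ => ?_
      simp only [ind_inter, Pi.smul_apply, Pi.mul_apply, smul_eq_mul]
      ring
    simp only [h6]
    rw [← Finset.sum_mul]
    by_cases hy : coordDist φ x y = ε
    · by_cases hyU : y ∈ U
      · rw [hU y hyU, zero_mul]
      · have : ∀ i, ind (C i) y = 0 := by
          intro i
          rw [ind_apply, if_neg]
          exact fun hyi => hyU (h3 i y hyi hy)
        simp [this]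
    · rw [ind_apply, if_neg (by exact hy), mul_zero]

/-- The pairs of a constructible function germ at `x` and its local Euler characteristic. -/
def localEulerPairs (x : E) : Submodule ℤ ((E → ℤ) × ℤ) :=
  Submodule.span ℤ ({p | ∃ C : Set E, ExposedAt x C ∧ p = (ind C, ind {D : Set E | D = {x}} C)} ∪
    {p | (∀ᶠ y in 𝓝 x, p.1 y = 0) ∧ p.2 = 0})

/-- Near `x` the function `f` is an integral combination of indicator functions of compact convex
sets with exposed point `x`, and `n` is its local Euler characteristic at `x`: the multiplicity of
`{x}` in this combination. -/
def HasLocalEuler (x : E) (f : E → ℤ) (n : ℤ) : Prop := (f, n) ∈ localEulerPairs x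

theorem HasLocalEuler.of_exposed {x : E} {C : Set E} (h : ExposedAt x C) :
    HasLocalEuler x (ind C) (ind {D : Set E | D = {x}} C) :=
  Submodule.subset_span (Or.inl ⟨C, h, rfl⟩)

theorem HasLocalEuler.of_eventually_zero {x : E} {f : E → ℤ} (h : ∀ᶠ y in 𝓝 x, f y = 0) :
    HasLocalEuler x f 0 :=
  Submodule.subset_span (Or.inr ⟨h, rfl⟩)

theorem HasLocalEuler.of_notMem {x : E} {C : Set E} (hC : IsClosed C) (hx : x ∉ C) :
    HasLocalEuler x (ind C) 0 := by
  classical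
  refine .of_eventually_zero ?_
  filter_upwards [hC.isOpen_compl.mem_nhds hx] with y hy
  rw [ind_apply, if_neg hy]

theorem HasLocalEuler.add {x : E} {f g : E → ℤ} {m n : ℤ} (h : HasLocalEuler x f m)
    (h' : HasLocalEuler x g n) : HasLocalEuler x (f + g) (m + n) :=
  (localEulerPairs x).add_mem h h'

theorem HasLocalEuler.smul {x : E} {f : E → ℤ} {n : ℤ} (h : HasLocalEuler x f n) (a : ℤ) :
    HasLocalEuler x (a • f) (a • n) :=
  (localEulerPairs x).smul_mem a h

theorem HasLocalEuler.sum {ι : Type*} (s : Finset ι) {x : E} {f : ι → E → ℤ} {n : ι → ℤ}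
    (h : ∀ i ∈ s, HasLocalEuler x (f i) (n i)) :
    HasLocalEuler x (∑ i ∈ s, f i) (∑ i ∈ s, n i) := by
  have := (localEulerPairs x).sum_mem h
  have h2 : ∑ i ∈ s, (f i, n i) = (∑ i ∈ s, f i, ∑ i ∈ s, n i) :=
    Prod.ext Prod.fst_sum Prod.snd_sum
  rwa [h2] at this

theorem HasLocalEuler.congr {x : E} {f g : E → ℤ} {n : ℤ} (h : HasLocalEuler x f n)
    (hfg : ∀ᶠ y in 𝓝 x, g y = f y) : HasLocalEuler x g n := by
  have h1 : HasLocalEuler x (g - f) 0 := .of_eventually_zero (by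
    filter_upwards [hfg] with y hy
    simp [hy])
  simpa using h1.add h

/-- A relation splits into a combination of exposed sets and a function that vanishes near `x` and
has value 0. Near `x` it is thus a relation between exposed sets, for which the multiplicities of
`{x}` cancel. -/
theorem HasLocalEuler.unique [FiniteDimensional ℝ E] {x : E} {f : E → ℤ} {m n : ℤ}
    (hm : HasLocalEuler x f m) (hn : HasLocalEuler x f n) : m = n := by
  classical
  have h : (0, m - n) ∈ localEulerPairs x := by
    have := (localEulerPairs x).sub_mem hm hn
    simpa using this
  rw [localEulerPairs, Submodule.span_union, Submodule.mem_sup] at h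
  obtain ⟨p, hp, q, hq, hpq⟩ := h
  have hq' : (∀ᶠ y in 𝓝 x, q.1 y = 0) ∧ q.2 = 0 := by
    clear hpq
    induction hq using Submodule.span_induction with
    | mem q hq => exact hq
    | zero => simp
    | add q r _ _ hq hr =>
      refine ⟨?_, by simp [hq.2, hr.2]⟩
      filter_upwards [hq.1, hr.1] with y h1 h2
      simp [h1, h2]
    | smul a q _ hq =>
      refine ⟨?_, by simp [hq.2]⟩
      filter_upwards [hq.1] with y h1
      simp [h1]
  obtain ⟨k, a, g, hg⟩ := Submodule.mem_span_set'.1 hp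
  choose C hC hCg using fun i => (g i).2
  simp only [hCg] at hg
  have h1 := congrArg Prod.fst hg
  have h2 := congrArg Prod.snd hg
  rw [Prod.fst_sum] at h1
  rw [Prod.snd_sum] at h2
  have h3 := sum_eq_zero_of_exposed_relation a C hC (by
    filter_upwards [hq'.1] with y hy
    have h4 := congrFun (congrArg Prod.fst hpq) y
    rw [Prod.fst_add, Pi.add_apply, ← h1] at h4
    simpa [hy] using h4)
  have h4 := congrArg Prod.snd hpq
  simp only [Prod.snd_add, hq'.2, ← h2, Prod.smul_mk, smul_eq_mul, h3] at h4
  omega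

end LocalEuler
end

noncomputable section

/-! ## Piecewise affine maps -/

section PiecewiseAffine

set_option linter.unusedSectionVars false

variable {E : Type*} [NormedAddCommGroup E] [NormedSpace ℝ E]
variable {E' : Type*} [NormedAddCommGroup E'] [NormedSpace ℝ E']
variable {E'' : Type*} [NormedAddCommGroup E''] [NormedSpace ℝ E'']

/-- The function `F` coincides on `C` with an affine map. -/
def IsAffineOn (F : E → E') (C : Set E) : Prop := ∃ φ : E →ᵃ[ℝ] E', Set.EqOn F φ C

theorem IsAffineOn.mono {F : E → E'} {C D : Set E} (h : IsAffineOn F C) (hDC : D ⊆ C) :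
    IsAffineOn F D := by
  obtain ⟨φ, hφ⟩ := h
  exact ⟨φ, hφ.mono hDC⟩

theorem IsAffineOn.map_combo {F : E → E'} {C : Set E} (h : IsAffineOn F C) (hC : Convex ℝ C)
    {y z : E} (hy : y ∈ C) (hz : z ∈ C) {p q : ℝ} (hp : 0 ≤ p) (hq : 0 ≤ q) (hpq : p + q = 1) :
    F (p • y + q • z) = p • F y + q • F z := by
  obtain ⟨φ, hφ⟩ := h
  rw [hφ (hC hy hz hp hq hpq), hφ hy, hφ hz, Convex.combo_affine_apply hpq]

theorem IsAffineOn.convex_image {F : E → E'} {C : Set E} (h : IsAffineOn F C) (hC : Convex ℝ C) :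
    Convex ℝ (F '' C) := by
  rintro _ ⟨y, hy, rfl⟩ _ ⟨z, hz, rfl⟩ p q hp hq hpq
  exact ⟨_, hC hy hz hp hq hpq, h.map_combo hC hy hz hp hq hpq⟩

theorem IsAffineOn.convex_preimage {F : E → E'} {C : Set E} (h : IsAffineOn F C)
    (hC : Convex ℝ C) {D : Set E'} (hD : Convex ℝ D) : Convex ℝ (C ∩ F ⁻¹' D) := by
  rintro y ⟨hy, hy'⟩ z ⟨hz, hz'⟩ p q hp hq hpq
  refine ⟨hC hy hz hp hq hpq, ?_⟩
  rw [Set.mem_preimage, h.map_combo hC hy hz hp hq hpq]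
  exact hD hy' hz' hp hq hpq

theorem IsAffineOn.comp {F : E → E'} {G : E' → E''} {C : Set E} {D : Set E'}
    (hF : IsAffineOn F C) (hG : IsAffineOn G D) : IsAffineOn (G ∘ F) (C ∩ F ⁻¹' D) := by
  obtain ⟨φ, hφ⟩ := hF
  obtain ⟨ψ, hψ⟩ := hG
  refine ⟨ψ.comp φ, fun y hy => ?_⟩
  rw [Function.comp_apply, hψ hy.2, hφ hy.1]
  rfl

section

variable [FiniteDimensional ℝ E]

theorem IsAffineOn.continuousOn {F : E → E'} {C : Set E} (h : IsAffineOn F C) :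
    ContinuousOn F C := by
  obtain ⟨φ, hφ⟩ := h
  exact φ.continuous_of_finiteDimensional.continuousOn.congr hφ

theorem IsAffineOn.isCompact_preimage {F : E → E'} {C : Set E} (h : IsAffineOn F C)
    (hC : IsCompact C) {D : Set E'} (hD : IsClosed D) : IsCompact (C ∩ F ⁻¹' D) :=
  hC.of_isClosed_subset (h.continuousOn.preimage_isClosed_of_isClosed hC.isClosed hD)
    Set.inter_subset_left

theorem ExposedAt.inter {x : E} {C D : Set E} (h : ExposedAt x C) (hD : IsCompact D)
    (hDc : Convex ℝ D) (hx : x ∈ D) : ExposedAt x (D ∩ C) := by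
  obtain ⟨g, hgx, hg, hga, hgc⟩ := h.exists_fun
  refine ⟨⟨hx, h.mem⟩, hD.inter h.compact, hDc.inter h.convex, g, hgx, fun y hy => hg y hy.2,
    hga.mono Set.inter_subset_right, fun δ => ?_⟩
  rw [Set.inter_assoc]
  exact hD.inter (hgc δ)

/-- The image is exposed by `g` composed with the inverse of `F` on `C`. Since `ExposedAt` asks only
for a function that is affine on the set and has compact level sets, no extension of this composite
to a linear functional is needed. -/
theorem ExposedAt.image {x : E} {C : Set E} (h : ExposedAt x C) {F : E → E'} (hF : IsAffineOn F C)
    (hinj : Set.InjOn F C) : ExposedAt (F x) (F '' C) := by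
  obtain ⟨g, hgx, hg, hga, hgc⟩ := h.exists_fun
  have hinv : ∀ y ∈ C, Function.invFunOn F C (F y) = y := fun y hy =>
    hinj.leftInvOn_invFunOn hy
  refine ⟨⟨x, h.mem, rfl⟩, h.compact.image_of_continuousOn hF.continuousOn,
    hF.convex_image h.convex, g ∘ Function.invFunOn F C, ?_, ?_, ?_, fun δ => ?_⟩
  · rw [Function.comp_apply, hinv x h.mem, hgx]
  · rintro _ ⟨y, hy, rfl⟩ hyx
    rw [Function.comp_apply, hinv y hy]
    exact hg y hy fun h => hyx (by rw [h])
  · rintro _ ⟨y, hy, rfl⟩ _ ⟨z, hz, rfl⟩ p q hp hq hpq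
    rw [← hF.map_combo h.convex hy hz hp hq hpq]
    simp only [Function.comp_apply]
    rw [hinv _ (h.convex hy hz hp hq hpq), hinv y hy, hinv z hz, hga y hy z hz p q hp hq hpq]
  · have : F '' C ∩ {y | (g ∘ Function.invFunOn F C) y = δ} = F '' (C ∩ {y | g y = δ}) := by
      ext y
      constructor
      · rintro ⟨⟨z, hz, rfl⟩, hz'⟩
        refine ⟨z, ⟨hz, ?_⟩, rfl⟩
        simp only [Set.mem_ofPred_eq, Function.comp_apply, hinv z hz] at hz' ⊢
        exact hz'
      · rintro ⟨z, ⟨hz, hz'⟩, rfl⟩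
        refine ⟨⟨z, hz, rfl⟩, ?_⟩
        simp only [Set.mem_ofPred_eq, Function.comp_apply, hinv z hz] at hz' ⊢
        exact hz'
    rw [this]
    exact (hgc δ).image_of_continuousOn (hF.continuousOn.mono Set.inter_subset_left)

theorem ExposedAt.preimage {x : E} {C : Set E} {F : E → E'} (hF : IsAffineOn F C)
    (hc : IsCompact C) (hcv : Convex ℝ C) (hx : x ∈ C) (hinj : Set.InjOn F C) {D : Set E'}
    (h : ExposedAt (F x) D) : ExposedAt x (C ∩ F ⁻¹' D) := by
  obtain ⟨g, hgx, hg, hga, hgc⟩ := h.exists_fun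
  refine ⟨⟨hx, h.mem⟩, hF.isCompact_preimage hc h.compact.isClosed, hF.convex_preimage hcv h.convex,
    g ∘ F, hgx, fun y hy hyx => hg _ hy.2 fun h => hyx (hinj hy.1 hx h), ?_, fun δ => ?_⟩
  · rintro y hy z hz p q hp hq hpq
    simp only [Function.comp_apply]
    rw [hF.map_combo hcv hy.1 hz.1 hp hq hpq, hga _ hy.2 _ hz.2 p q hp hq hpq]
  · exact (hF.isCompact_preimage hc (hgc δ).isClosed).of_isClosed_subset
      (by
        have := (hF.isCompact_preimage hc (hgc δ).isClosed).isClosed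
        convert this using 1
        ext y
        simp [and_assoc]) (fun y hy => ⟨hy.1.1, hy.1.2, hy.2⟩)

end

/-- The set `A` is a finite union of compact convex sets on each of which `F` is affine. -/
def PiecewiseAffineOn (F : E → E') (A : Set E) : Prop :=
  ∃ 𝒞 : Finset (Set E), A = ⋃ C ∈ 𝒞, C ∧ ∀ C ∈ 𝒞, IsCompact C ∧ Convex ℝ C ∧ IsAffineOn F C

/-- Inclusion-exclusion over the pieces: `F` is affine on each of their intersections. In this way
statements about affine maps on convex sets pass to piecewise affine maps. -/
theorem PiecewiseAffineOn.exists_sum {F : E → E'} {A : Set E} (h : PiecewiseAffineOn F A) :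
    ∃ (T : Finset (Finset (Set E))) (c : Finset (Set E) → ℤ) (D : Finset (Set E) → Set E),
      (∀ t ∈ T, D t ⊆ A ∧ IsCompact (D t) ∧ Convex ℝ (D t) ∧ IsAffineOn F (D t)) ∧
      ∀ y, ind A y = ∑ t ∈ T, c t * ind (D t) y := by
  classical
  obtain ⟨𝒞, hA, h𝒞⟩ := h
  refine ⟨𝒞.powerset.filter Finset.Nonempty, fun t => (-1) ^ (t.card + 1), fun t => ⋂ C ∈ t, C,
    fun t ht => ?_, fun y => ?_⟩
  · rw [Finset.mem_filter, Finset.mem_powerset] at ht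
    obtain ⟨ht, C, hC⟩ := ht
    have hsub : ⋂ C ∈ t, C ⊆ C := Set.biInter_subset_of_mem (s := (t : Set (Set E))) (t := id) hC
    have hc := h𝒞 C (ht hC)
    refine ⟨?_, ?_, ?_, hc.2.2.mono hsub⟩
    · rw [hA]
      exact hsub.trans (Set.subset_biUnion_of_mem (u := id) (Finset.mem_coe.2 (ht hC)))
    · exact hc.1.of_isClosed_subset
        (isClosed_biInter fun D hD => (h𝒞 D (ht hD)).1.isClosed) hsub
    · exact convex_iInter₂ fun D hD => (h𝒞 D (ht hD)).2.1
  · rw [hA, ind_iUnion]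
    simp

theorem PiecewiseAffineOn.inter {F : E → E'} {A : Set E} (h : PiecewiseAffineOn F A) {C : Set E}
    (hc : IsClosed C) (hcv : Convex ℝ C) : PiecewiseAffineOn F (A ∩ C) := by
  classical
  obtain ⟨𝒞, rfl, h𝒞⟩ := h
  refine ⟨𝒞.image fun D => D ∩ C, ?_, fun D' hD' => ?_⟩
  · ext y
    simp only [Set.mem_inter_iff, Set.mem_iUnion, Finset.mem_image]
    constructor
    · rintro ⟨⟨D, hD, hy⟩, hyC⟩
      exact ⟨_, ⟨D, hD, rfl⟩, hy, hyC⟩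
    · rintro ⟨_, ⟨D, hD, rfl⟩, hy, hyC⟩
      exact ⟨⟨D, hD, hy⟩, hyC⟩
  · obtain ⟨D, hD, rfl⟩ := Finset.mem_image.1 hD'
    exact ⟨(h𝒞 D hD).1.inter_right hc, (h𝒞 D hD).2.1.inter hcv,
      (h𝒞 D hD).2.2.mono Set.inter_subset_left⟩

variable [FiniteDimensional ℝ E]

theorem PiecewiseAffineOn.comp {F : E → E'} {A : Set E} (h : PiecewiseAffineOn F A) {G : E' → E''}
    {B : Set E'} (hG : PiecewiseAffineOn G B) : PiecewiseAffineOn (G ∘ F) (A ∩ F ⁻¹' B) := by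
  classical
  obtain ⟨𝒞, rfl, h𝒞⟩ := h
  obtain ⟨𝒟, rfl, h𝒟⟩ := hG
  refine ⟨(𝒞 ×ˢ 𝒟).image fun p => p.1 ∩ F ⁻¹' p.2, ?_, fun D hD => ?_⟩
  · ext y
    simp only [Set.mem_inter_iff, Set.mem_iUnion, Finset.mem_image, Finset.mem_product,
      Set.mem_preimage]
    constructor
    · rintro ⟨⟨C, hC, hy⟩, D, hD, hy'⟩
      exact ⟨_, ⟨(C, D), ⟨hC, hD⟩, rfl⟩, hy, hy'⟩
    · rintro ⟨_, ⟨⟨C, D⟩, ⟨hC, hD⟩, rfl⟩, hy, hy'⟩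
      exact ⟨⟨C, hC, hy⟩, D, hD, hy'⟩
  · obtain ⟨⟨C, D⟩, hCD, rfl⟩ := Finset.mem_image.1 hD
    obtain ⟨hC, hD⟩ := Finset.mem_product.1 hCD
    exact ⟨(h𝒞 C hC).2.2.isCompact_preimage (h𝒞 C hC).1 (h𝒟 D hD).1.isClosed,
      (h𝒞 C hC).2.2.convex_preimage (h𝒞 C hC).2.1 (h𝒟 D hD).2.1,
      (h𝒞 C hC).2.2.comp (h𝒟 D hD).2.2⟩

theorem PiecewiseAffineOn.inter_preimage {F : E → E'} {A : Set E} (h : PiecewiseAffineOn F A)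
    {D : Set E'} (hc : IsClosed D) (hcv : Convex ℝ D) : PiecewiseAffineOn F (A ∩ F ⁻¹' D) := by
  classical
  obtain ⟨𝒞, rfl, h𝒞⟩ := h
  refine ⟨𝒞.image fun C => C ∩ F ⁻¹' D, ?_, fun D' hD' => ?_⟩
  · ext y
    simp only [Set.mem_inter_iff, Set.mem_iUnion, Finset.mem_image]
    constructor
    · rintro ⟨⟨C, hC, hy⟩, hyD⟩
      exact ⟨_, ⟨C, hC, rfl⟩, hy, hyD⟩
    · rintro ⟨_, ⟨C, hC, rfl⟩, hy, hyD⟩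
      exact ⟨⟨C, hC, hy⟩, hyD⟩
  · obtain ⟨C, hC, rfl⟩ := Finset.mem_image.1 hD'
    exact ⟨(h𝒞 C hC).2.2.isCompact_preimage (h𝒞 C hC).1 hc,
      (h𝒞 C hC).2.2.convex_preimage (h𝒞 C hC).2.1 hcv,
      (h𝒞 C hC).2.2.mono Set.inter_subset_left⟩

theorem PiecewiseAffineOn.affine_comp {F : E → E'} {A : Set E} (h : PiecewiseAffineOn F A)
    (φ : E' →ᵃ[ℝ] E'') : PiecewiseAffineOn (φ ∘ F) A := by
  obtain ⟨𝒞, hA, h𝒞⟩ := h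
  refine ⟨𝒞, hA, fun C hC => ⟨(h𝒞 C hC).1, (h𝒞 C hC).2.1, ?_⟩⟩
  obtain ⟨ψ, hψ⟩ := (h𝒞 C hC).2.2
  exact ⟨φ.comp ψ, fun y hy => by rw [Function.comp_apply, hψ hy]; rfl⟩

theorem PiecewiseAffineOn.continuousOn {F : E → E'} {A : Set E} (h : PiecewiseAffineOn F A) :
    ContinuousOn F A := by
  obtain ⟨𝒞, rfl, h𝒞⟩ := h
  have : ContinuousOn F (⋃ C : 𝒞, (C : Set E)) :=
    (locallyFinite_of_finite _).continuousOn_iUnion (fun C => (h𝒞 C C.2).1.isClosed)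
      (fun C => (h𝒞 C C.2).2.2.continuousOn)
  convert this using 1
  ext y
  simp

/-- The image of a subset of an affine subspace of dimension at most `k` under a piecewise affine
map is contained in a finite union of such affine subspaces. -/
theorem PiecewiseAffineOn.exists_affineSubspaces {F : E → E'} {A : Set E}
    (h : PiecewiseAffineOn F A) (L : AffineSubspace ℝ E) (hAL : A ⊆ L) :
    ∃ 𝓛 : Finset (AffineSubspace ℝ E'),
      (∀ L' ∈ 𝓛, Module.finrank ℝ L'.direction ≤ Module.finrank ℝ L.direction) ∧
      ∀ y ∈ A, ∃ L' ∈ 𝓛, F y ∈ L' := by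
  classical
  obtain ⟨𝒞, rfl, h𝒞⟩ := h
  choose! φ hφ using fun C hC => (h𝒞 C hC).2.2
  refine ⟨𝒞.image fun C => L.map (φ C), fun L' hL' => ?_, fun y hy => ?_⟩
  · obtain ⟨C, -, rfl⟩ := Finset.mem_image.1 hL'
    rw [AffineSubspace.map_direction]
    exact Submodule.finrank_map_le _ _
  · obtain ⟨C, hC, hyC⟩ := Set.mem_iUnion₂.1 hy
    refine ⟨_, Finset.mem_image_of_mem _ hC, ?_⟩
    rw [hφ C hC hyC]
    exact AffineSubspace.mem_map_of_mem _ (hAL hy)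

/-- An injective map transports linear relations between indicators of subsets of its domain. -/
theorem ind_image_eq_sum {α β ι : Type*} {F : α → β} {A : Set α} (hinj : Set.InjOn F A)
    {T : Finset ι} {c : ι → ℤ} {D : ι → Set α} (hD : ∀ t ∈ T, D t ⊆ A) {C : Set α} (hC : C ⊆ A)
    (h : ∀ y ∈ A, ind C y = ∑ t ∈ T, c t * ind (D t) y) :
    ind (F '' C) = ∑ t ∈ T, c t • ind (F '' D t) := by
  ext y
  simp only [Finset.sum_apply, Pi.smul_apply, smul_eq_mul]
  by_cases hy : y ∈ F '' A
  · obtain ⟨z, hz, rfl⟩ := hy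
    have h1 : ∀ B ⊆ A, ind (F '' B) (F z) = ind B z := by
      intro B hB
      refine ind_congr ⟨?_, fun h => ⟨z, h, rfl⟩⟩
      rintro ⟨w, hw, hwz⟩
      rwa [← hinj (hB hw) hz hwz]
    rw [h1 C hC, h z hz]
    exact Finset.sum_congr rfl fun t ht => by rw [h1 _ (hD t ht)]
  · have h1 : ∀ B ⊆ A, ind (F '' B) y = 0 := fun B hB =>
      ind_of_notMem fun h => hy (Set.image_mono hB h)
    rw [h1 C hC]
    exact (Finset.sum_eq_zero fun t ht => by rw [h1 _ (hD t ht), mul_zero]).symm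

/-- Injective piecewise affine maps preserve the Euler characteristic. -/
theorem PiecewiseAffineOn.hasEuler_image {F : E → E'} {A C : Set E}
    (h : PiecewiseAffineOn F A) (hinj : Set.InjOn F A) (hCA : C ⊆ A) (hc : IsCompact C)
    (hcv : Convex ℝ C) (hne : C.Nonempty) : HasEuler (ind (F '' C)) 1 := by
  obtain ⟨T, c, D, hD, hsum⟩ := h.exists_sum
  have h1 : ind C = ∑ t ∈ T, c t • ind (D t ∩ C) := by
    ext y
    simp only [ind_inter, Finset.sum_apply, Pi.smul_apply, Pi.mul_apply, smul_eq_mul, ← mul_assoc]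
    rw [← Finset.sum_mul, ← hsum y]
    by_cases hy : y ∈ C
    · rw [ind_of_mem hy, ind_of_mem (hCA hy), one_mul]
    · rw [ind_of_notMem hy, mul_zero]
  have h2 := ind_image_eq_sum (C := C) (c := c) (T := T) (D := fun t => D t ∩ C) hinj
    (fun t ht => Set.inter_subset_left.trans (hD t ht).1) hCA (fun y hy => by
      rw [h1]; simp)
  rw [h2]
  have h3 : ∀ t ∈ T, HasEuler (ind (F '' (D t ∩ C)))
      (ind {C : Set E | C.Nonempty} (D t ∩ C)) := by
    intro t ht
    obtain ⟨-, h4, h5, h6⟩ := hD t ht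
    have h7 := h6.mono (Set.inter_subset_left (t := C))
    have := HasEuler.ind_inter_nonempty
      ((h4.inter hc).image_of_continuousOn h7.continuousOn) (h7.convex_image (h5.inter hcv))
    convert this using 1
    exact ind_congr Set.image_nonempty.symm
  -- A piece and its image are both empty or both nonempty, and both are compact and convex. The
  -- expansions of the image and of `C` thus have equal values, and the value for `C` is 1.
  have h4 := HasEuler.sum T (fun t ht => (h3 t ht).smul (c t))
  have h5 := HasEuler.sum T (fun t ht => (HasEuler.ind_inter_nonempty
    ((hD t ht).2.1.inter hc) ((hD t ht).2.2.1.inter hcv)).smul (c t))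
  rw [← h1] at h5
  rwa [← h5.unique (HasEuler.of_convex hc hcv hne)]

theorem ExposedAt.hasLocalEuler_image {F : E → E'} {x : E} {C : Set E} (h : ExposedAt x C)
    (hF : IsAffineOn F C) (hinj : Set.InjOn F C) :
    HasLocalEuler (F x) (ind (F '' C)) (ind {D : Set E | D = {x}} C) := by
  have := HasLocalEuler.of_exposed (h.image hF hinj)
  convert this using 1
  refine ind_congr ⟨fun hx => ?_, fun hx => ?_⟩
  · simp only [Set.mem_ofPred_eq] at *
    rw [hx, Set.image_singleton]
  · simp only [Set.mem_ofPred_eq] at *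
    refine Set.eq_singleton_iff_unique_mem.2 ⟨h.mem, fun y hy => hinj hy h.mem ?_⟩
    have : F y ∈ F '' C := ⟨y, hy, rfl⟩
    rwa [hx] at this

/-- Injective piecewise affine maps preserve local Euler characteristics. -/
theorem PiecewiseAffineOn.hasLocalEuler_image {F : E → E'} {A C : Set E}
    (h : PiecewiseAffineOn F A) (hinj : Set.InjOn F A) (hCA : C ⊆ A) {x : E}
    (hC : ExposedAt x C) :
    HasLocalEuler (F x) (ind (F '' C)) (ind {D : Set E | D = {x}} C) := by
  classical
  obtain ⟨T, c, D, hD, hsum⟩ := h.exists_sum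
  have h1 : ind C = ∑ t ∈ T, c t • ind (D t ∩ C) := by
    ext y
    simp only [ind_inter, Finset.sum_apply, Pi.smul_apply, Pi.mul_apply, smul_eq_mul, ← mul_assoc]
    rw [← Finset.sum_mul, ← hsum y]
    by_cases hy : y ∈ C
    · rw [ind_of_mem hy, ind_of_mem (hCA hy), one_mul]
    · rw [ind_of_notMem hy, mul_zero]
  have h2 := ind_image_eq_sum (C := C) (c := c) (T := T) (D := fun t => D t ∩ C) hinj
    (fun t ht => Set.inter_subset_left.trans (hD t ht).1) hCA (fun y hy => by
      rw [h1]; simp)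
  have h3 : ∀ t ∈ T, ∃ n, HasLocalEuler x (ind (D t ∩ C)) n ∧
      HasLocalEuler (F x) (ind (F '' (D t ∩ C))) n := by
    intro t ht
    obtain ⟨h4, h5, h6, h7⟩ := hD t ht
    by_cases hx : x ∈ D t
    · have h8 := hC.inter h5 h6 hx
      exact ⟨_, HasLocalEuler.of_exposed h8, h8.hasLocalEuler_image (h7.mono Set.inter_subset_left)
        (hinj.mono (Set.inter_subset_left.trans h4))⟩
    -- A piece that misses `x` is closed, and by injectivity its closed image misses `F x`. Both
    -- local values vanish.
    · refine ⟨0, .of_notMem (h5.inter hC.compact).isClosed fun h => hx h.1, .of_notMem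
        ((h5.inter hC.compact).image_of_continuousOn
          (h7.mono Set.inter_subset_left).continuousOn).isClosed ?_⟩
      rintro ⟨y, hy, hyx⟩
      rw [hinj (h4 hy.1) (hCA hC.mem) hyx] at hy
      exact hx hy.1
  choose! n hn hn' using h3
  have h4 := HasLocalEuler.sum T (fun t ht => (hn t ht).smul (c t))
  have h5 := HasLocalEuler.sum T (fun t ht => (hn' t ht).smul (c t))
  rw [← h1] at h4
  rw [← h2] at h5
  rwa [← h4.unique (HasLocalEuler.of_exposed hC)]

/-- Instead of inverting `F`, one shows for every germ at `F x` that its restriction to the image of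
`A` and its pullback to `A` have a common local value. This is checked on generators: an exposed set
pulls back, piece by piece, to exposed sets, and a germ that vanishes near `F x` pulls back to one
that vanishes near `x` by continuity on `A`. -/
theorem PiecewiseAffineOn.hasLocalEuler_preimage [FiniteDimensional ℝ E'] {F : E → E'} {A : Set E}
    (h : PiecewiseAffineOn F A) (hinj : Set.InjOn F A) {x : E} (hx : x ∈ A) {n : ℤ}
    (hn : HasLocalEuler (F x) (ind (F '' A)) n) : HasLocalEuler x (ind A) n := by
  classical
  suffices H : ∀ p ∈ localEulerPairs (F x), ∃ m, HasLocalEuler x (fun y => ind A y * p.1 (F y)) m ∧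
      HasLocalEuler (F x) (fun y => ind (F '' A) y * p.1 y) m by
    obtain ⟨m, h1, h2⟩ := H _ hn
    have h3 := (h2.congr (g := ind (F '' A)) (.of_forall fun y => by
      by_cases hy : y ∈ F '' A
      · simp [ind_of_mem hy]
      · simp [ind_of_notMem hy])).unique hn
    rw [← h3]
    refine h1.congr (.of_forall fun y => ?_)
    by_cases hy : y ∈ A
    · simp [ind_of_mem hy, ind_of_mem (Set.mem_image_of_mem F hy)]
    · simp [ind_of_notMem hy]
  intro p hp
  induction hp using Submodule.span_induction with
  | zero => exact ⟨0, .of_eventually_zero (by simp), .of_eventually_zero (by simp)⟩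
  | add p q _ _ hp hq =>
    obtain ⟨m, hm, hm'⟩ := hp
    obtain ⟨k, hk, hk'⟩ := hq
    exact ⟨m + k, (hm.add hk).congr (.of_forall fun y => by simp [mul_add]),
      (hm'.add hk').congr (.of_forall fun y => by simp [mul_add])⟩
  | smul a p _ hp =>
    obtain ⟨m, hm, hm'⟩ := hp
    exact ⟨a • m, (hm.smul a).congr (.of_forall fun y => by simp [mul_left_comm]),
      (hm'.smul a).congr (.of_forall fun y => by simp [mul_left_comm])⟩
  | mem p hp =>
    rcases hp with ⟨C, hC, rfl⟩ | ⟨hp, -⟩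
    · obtain ⟨T, c, D, hD, hsum⟩ := h.exists_sum
      have h1 : (fun y => ind A y * ind C (F y)) = ∑ t ∈ T, c t • ind (D t ∩ F ⁻¹' C) := by
        ext y
        simp only [ind_inter, Finset.sum_apply, Pi.smul_apply, Pi.mul_apply, smul_eq_mul,
          ← mul_assoc]
        rw [← Finset.sum_mul, ← hsum y]
        rfl
      have h2 : (fun y => ind (F '' A) y * ind C y) =
          ∑ t ∈ T, c t • ind (F '' (D t ∩ F ⁻¹' C)) := by
        rw [← ind_image_eq_sum (C := A ∩ F ⁻¹' C) hinj
          (fun t ht => Set.inter_subset_left.trans (hD t ht).1) Set.inter_subset_left,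
          Set.image_inter_preimage, ind_inter]
        · rfl
        · intro y _
          have := congrFun h1 y
          simp only [Finset.sum_apply, Pi.smul_apply, smul_eq_mul] at this
          rw [← this, ind_inter]
          rfl
      have h3 : ∀ t ∈ T, ∃ n, HasLocalEuler x (ind (D t ∩ F ⁻¹' C)) n ∧
          HasLocalEuler (F x) (ind (F '' (D t ∩ F ⁻¹' C))) n := by
        intro t ht
        obtain ⟨h4, h5, h6, h7⟩ := hD t ht
        by_cases hx' : x ∈ D t
        · have h8 := ExposedAt.preimage h7 h5 h6 hx' (hinj.mono h4) hC
          exact ⟨_, HasLocalEuler.of_exposed h8, h8.hasLocalEuler_image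
            (h7.mono Set.inter_subset_left) (hinj.mono (Set.inter_subset_left.trans h4))⟩
        · have h8 := h7.isCompact_preimage h5 hC.compact.isClosed
          refine ⟨0, .of_notMem h8.isClosed fun h => hx' h.1, .of_notMem
            (h8.image_of_continuousOn (h7.mono Set.inter_subset_left).continuousOn).isClosed ?_⟩
          rintro ⟨y, hy, hyx⟩
          rw [hinj (h4 hy.1) hx hyx] at hy
          exact hx' hy.1
      choose! n hn hn' using h3
      refine ⟨∑ t ∈ T, c t • n t, ?_, ?_⟩
      · simp only [h1]
        exact HasLocalEuler.sum T (fun t ht => (hn t ht).smul (c t))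
      · simp only [h2]
        exact HasLocalEuler.sum T (fun t ht => (hn' t ht).smul (c t))
    · refine ⟨0, .of_eventually_zero ?_, .of_eventually_zero ?_⟩
      · have h1 : ∀ᶠ y in 𝓝[A] x, p.1 (F y) = 0 := (h.continuousOn x hx).eventually hp
        filter_upwards [eventually_nhdsWithin_iff.1 h1] with y hy
        by_cases hyA : y ∈ A
        · rw [hy hyA, mul_zero]
        · rw [ind_of_notMem hyA, zero_mul]
      · filter_upwards [hp] with y hy
        rw [hy, mul_zero]

end PiecewiseAffine
end

noncomputable section

/-! ## Local Euler characteristics of boxes and simplices -/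

section Box

theorem ind_eq_prod {α κ : Type*} [Fintype κ] {β : κ → Type*} {A : Set α} {y : α}
    {B : ∀ k, Set (β k)} {z : ∀ k, β k} (h : y ∈ A ↔ ∀ k, z k ∈ B k) :
    ind A y = ∏ k, ind (B k) (z k) := by
  by_cases hy : y ∈ A
  · rw [ind_of_mem hy, Finset.prod_eq_one fun k _ => ind_of_mem (h.1 hy k)]
  · obtain ⟨k, hk⟩ := not_forall.1 (mt h.2 hy)
    rw [ind_of_notMem hy]
    exact (Finset.prod_eq_zero (Finset.mem_univ k) (by exact ind_of_notMem hk)).symm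

/-- The local Euler characteristic of a box: the product of the local Euler characteristics
of its edges. -/
theorem hasLocalEuler_box {d : ℕ} (l r q : Fin d → ℝ) (w : Fin d → ℤ)
    (h : ∀ k, (l k < q k ∧ q k < r k ∧ w k = -1) ∨ (l k = q k ∧ q k < r k ∧ w k = 0) ∨
      (l k = q k ∧ q k = r k ∧ w k = 1)) :
    HasLocalEuler q (ind (Set.Icc l r)) (∏ k, w k) := by
  classical
  have hq : q ∈ Set.Icc l r := by
    constructor <;> intro k <;> rcases h k with h | h | h <;> linarith
  let φ : Fin d → (Fin d → ℝ) →L[ℝ] ℝ := fun k => ContinuousLinearMap.proj k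
  have hφ : ∀ y, (∀ k, φ k y = 0) → y = 0 := fun y hy => funext hy
  have h1 : HasLocalEuler q (ind (Set.Icc l r)) (∑ s : Fin d → SignType, orthantCoef s •
      ind {D : Set (Fin d → ℝ) | D = {q}} (Set.Icc l r ∩ orthant φ q s)) := by
    rw [ind_eq_sum_orthant φ q (Set.Icc l r)]
    exact HasLocalEuler.sum Finset.univ (fun s _ => (HasLocalEuler.of_exposed
      (exposedAt_inter_orthant φ q hφ hq isCompact_Icc (convex_Icc l r) s)).smul (orthantCoef s))
  have h2 : ∀ s : Fin d → SignType, ind {D : Set (Fin d → ℝ) | D = {q}} (Set.Icc l r ∩ orthant φ q s)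
      = ∏ k, ind {σ : SignType | Set.Icc (l k) (r k) ∩ {t | t - q k ∈ signSet σ} = {q k}} (s k) := by
    intro s
    have h3 : Set.Icc l r ∩ orthant φ q s = Set.univ.pi
        fun k => Set.Icc (l k) (r k) ∩ {t | t - q k ∈ signSet (s k)} := by
      ext y
      simp only [Set.mem_inter_iff, Set.mem_Icc, orthant, Set.mem_ofPred_eq, Set.mem_pi,
        Set.mem_univ, true_imp_iff, Pi.le_def]
      constructor
      · rintro ⟨⟨h1, h2⟩, h3⟩ k
        exact ⟨⟨h1 k, h2 k⟩, h3 k⟩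
      · intro h
        exact ⟨⟨fun k => (h k).1.1, fun k => (h k).1.2⟩, fun k => (h k).2⟩
    have h4 : ({q} : Set (Fin d → ℝ)) = Set.univ.pi fun k => {q k} := by
      rw [Set.univ_pi_singleton]
    refine ind_eq_prod ?_
    simp only [Set.mem_ofPred_eq]
    rw [h3, h4]
    constructor
    · intro h5 k
      have hqs : ∀ j, q j ∈ Set.Icc (l j) (r j) ∩ {t | t - q j ∈ signSet (s j)} := fun j =>
        ⟨⟨hq.1 j, hq.2 j⟩, by simpa using zero_mem_signSet (s j)⟩
      refine Set.eq_singleton_iff_unique_mem.2 ⟨hqs k, fun t ht => ?_⟩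
      have h6 : Function.update q k t ∈ Set.univ.pi
          fun k => Set.Icc (l k) (r k) ∩ {t | t - q k ∈ signSet (s k)} := by
        intro j _
        by_cases hj : j = k
        · subst hj; simpa using ht
        · rw [Function.update_of_ne hj]; exact hqs j
      rw [h5] at h6
      simpa using h6 k (Set.mem_univ k)
    · intro h5
      simp only [h5]
  have h3 := Finset.prod_univ_sum (fun _ : Fin d => (Finset.univ : Finset SignType))
    (fun k σ => signCoef σ *
      ind {σ : SignType | Set.Icc (l k) (r k) ∩ {t | t - q k ∈ signSet σ} = {q k}} σ)
  rw [Fintype.piFinset_univ] at h3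
  -- In one dimension the sign set `{0}` always cuts out the point `q k` and counts `-1`. A half
  -- line counts `1` precisely if the interval ends at `q k` on its side. The totals are `-1`, `0`
  -- and `1` in the three cases of the hypothesis.
  have h4 : ∀ k, ∑ σ, signCoef σ *
      ind {σ : SignType | Set.Icc (l k) (r k) ∩ {t | t - q k ∈ signSet σ} = {q k}} σ = w k := by
    intro k
    have hk : l k ≤ q k ∧ q k ≤ r k := ⟨hq.1 k, hq.2 k⟩
    have e0 : Set.Icc (l k) (r k) ∩ {t | t - q k ∈ signSet 0} = {q k} := by
      ext t
      simp only [signSet, Set.mem_inter_iff, Set.mem_Icc, Set.mem_ofPred_eq, Set.mem_singleton_iff,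
        sub_eq_zero]
      exact ⟨fun h => h.2, fun h => by rw [h]; exact ⟨hk, rfl⟩⟩
    have e1 : Set.Icc (l k) (r k) ∩ {t | t - q k ∈ signSet 1} = {q k} ↔ q k = r k := by
      constructor
      · intro h
        have : r k ∈ Set.Icc (l k) (r k) ∩ {t | t - q k ∈ signSet 1} :=
          ⟨⟨hk.1.trans hk.2, le_rfl⟩, by simpa [signSet] using hk.2⟩
        rw [h] at this
        exact this.symm
      · intro h
        ext t
        simp only [signSet, Set.mem_inter_iff, Set.mem_Icc, Set.mem_ofPred_eq,
          Set.mem_singleton_iff, Set.mem_Ici, sub_nonneg]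
        exact ⟨fun h' => le_antisymm (h ▸ h'.1.2) h'.2, fun h' => by rw [h']; exact ⟨hk, le_rfl⟩⟩
    have e2 : Set.Icc (l k) (r k) ∩ {t | t - q k ∈ signSet (-1)} = {q k} ↔ l k = q k := by
      constructor
      · intro h
        have : l k ∈ Set.Icc (l k) (r k) ∩ {t | t - q k ∈ signSet (-1)} :=
          ⟨⟨le_rfl, hk.1.trans hk.2⟩, by simpa [signSet] using hk.1⟩
        rw [h] at this
        exact this
      · intro h
        ext t
        simp only [signSet, Set.mem_inter_iff, Set.mem_Icc, Set.mem_ofPred_eq,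
          Set.mem_singleton_iff, Set.mem_Iic, sub_nonpos]
        exact ⟨fun h' => le_antisymm h'.2 (h ▸ h'.1.1), fun h' => by rw [h']; exact ⟨hk, le_rfl⟩⟩
    rw [SignType.sum_eq]
    simp only [ind_apply, Set.mem_ofPred_eq, e0, e1, e2, if_true]
    simp only [signCoef]
    rcases h k with ⟨h1, h2, h3⟩ | ⟨h1, h2, h3⟩ | ⟨h1, h2, h3⟩
    · simp [h1.ne, h2.ne, h3]
    · simp [h1, h2.ne, h3]
    · simp [h1, h2, h3]
  simp only [h4, Finset.prod_mul_distrib, ← h2] at h3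
  rw [h3]
  exact h1

end Box

section Simplex

set_option linter.unusedSectionVars false

variable {κ : Type*} [Fintype κ] [DecidableEq κ]

/-- The face of the standard simplex with the vertices in `S`. -/
def simplexFace (S : Finset κ) : Set (κ → ℝ) := {x ∈ stdSimplex ℝ κ | ∀ i ∉ S, x i = 0}

theorem isCompact_simplexFace (S : Finset κ) : IsCompact (simplexFace S) := by
  refine (isCompact_stdSimplex ℝ κ).of_isClosed_subset ?_ fun x hx => hx.1
  have : simplexFace S = stdSimplex ℝ κ ∩ ⋂ i ∉ S, {x | x i = 0} := by
    ext x; simp [simplexFace]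
  rw [this]
  exact (isClosed_stdSimplex ℝ κ).inter (isClosed_biInter fun i _ =>
    isClosed_eq (continuous_apply i) continuous_const)

theorem convex_simplexFace (S : Finset κ) : Convex ℝ (simplexFace S) := by
  rintro x ⟨hx, hx'⟩ y ⟨hy, hy'⟩ p q hp hq hpq
  exact ⟨convex_stdSimplex ℝ κ hx hy hp hq hpq, fun i hi => by simp [hx' i hi, hy' i hi]⟩

theorem single_mem_simplexFace {S : Finset κ} {i : κ} (hi : i ∈ S) :
    Pi.single i 1 ∈ simplexFace S :=
  ⟨single_mem_stdSimplex ℝ i, fun j hj => by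
    rw [Pi.single_apply, if_neg]; rintro rfl; exact hj hi⟩

/-- The hypotheses force `x k ≤ y k` for all `k`, while both points have coordinate sum one. -/
theorem eq_of_ratio_le {x y : κ → ℝ} (hx : x ∈ stdSimplex ℝ κ) (hy : y ∈ stdSimplex ℝ κ) {j : κ}
    (hj : 0 < x j) (h : ∀ k, y j * x k ≤ y k * x j) (hxy : x j ≤ y j) : y = x := by
  have h1 : ∀ k ∈ Finset.univ, x k ≤ y k := by
    intro k _
    have h2 := h k
    have h3 := hx.1 k
    have : x k * x j ≤ y k * x j := by nlinarith
    exact le_of_mul_le_mul_right this hj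
  have h2 := (Finset.sum_eq_sum_iff_of_le h1).1 (hx.2.trans hy.2.symm)
  exact funext fun k => (h2 k (Finset.mem_univ k)).symm

/-- The local Euler characteristic of a face of the standard simplex at a point in the interior
of the face with the vertices in `S₀`. -/
theorem exists_exposed_simplexFace {x : κ → ℝ} {S S₀ : Finset κ} (hx : x ∈ simplexFace S)
    (hS₀ : ∀ i, i ∈ S₀ ↔ x i ≠ 0) :
    ∃ M : Finset κ → Set (κ → ℝ),
      (∀ J ∈ S₀.powerset.filter Finset.Nonempty, M J ⊆ simplexFace S ∧ ExposedAt x (M J)) ∧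
      ind (simplexFace S) = ∑ J ∈ S₀.powerset with J.Nonempty, (-1 : ℤ) ^ (J.card + 1) • ind (M J) ∧
      ∑ J ∈ S₀.powerset with J.Nonempty,
        (-1 : ℤ) ^ (J.card + 1) * ind {D : Set (κ → ℝ) | D = {x}} (M J) =
        if S = S₀ then (-1) ^ (S₀.card + 1) else 0 := by
  classical
  -- For `j ∈ S₀` this is the cone with apex `x` over the part of the face where coordinate `j`
  -- vanishes: the ratio of `y` to `x` is smallest at `j`. Choosing `j` as a minimizer of the ratio
  -- shows that these cones cover the face, and `x j - y j` exposes `x` in each of them.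
  let N : κ → Set (κ → ℝ) := fun j => {y ∈ simplexFace S | ∀ k, y j * x k ≤ y k * x j}
  have hxpos : ∀ i, i ∈ S₀ ↔ 0 < x i := fun i =>
    (hS₀ i).trans ⟨fun h => lt_of_le_of_ne (hx.1.1 i) h.symm, fun h => h.ne'⟩
  have hS₀S : S₀ ⊆ S := by
    intro i hi
    by_contra h
    exact (hS₀ i).1 hi (hx.2 i h)
  have hne : S₀.Nonempty := by
    by_contra h
    rw [Finset.not_nonempty_iff_eq_empty] at h
    have : ∑ i, x i = 0 := Finset.sum_eq_zero fun i _ => by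
      by_contra hi
      have := (hS₀ i).2 hi
      simp [h] at this
    rw [hx.1.2] at this
    exact one_ne_zero this
  have hsub : ∀ J : Finset κ, J.Nonempty → ⋂ j ∈ J, N j ⊆ simplexFace S := by
    rintro J ⟨j, hj⟩ y hy
    exact (Set.mem_iInter₂.1 hy j hj).1
  have hNclosed : ∀ j, IsClosed (N j) := by
    intro j
    have : N j = simplexFace S ∩ ⋂ k, {y | y j * x k ≤ y k * x j} := by
      ext y; simp [N]
    rw [this]
    exact (isCompact_simplexFace S).isClosed.inter (isClosed_iInter fun k =>
      isClosed_le (by fun_prop) (by fun_prop))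
  have hNconvex : ∀ j, Convex ℝ (N j) := by
    rintro j y ⟨hy, hy'⟩ z ⟨hz, hz'⟩ p q hp hq hpq
    refine ⟨convex_simplexFace S hy hz hp hq hpq, fun k => ?_⟩
    simp only [Pi.add_apply, Pi.smul_apply, smul_eq_mul]
    nlinarith [mul_le_mul_of_nonneg_left (hy' k) hp, mul_le_mul_of_nonneg_left (hz' k) hq]
  have hxN : ∀ j, x ∈ N j := fun j => ⟨hx, fun k => by rw [mul_comm]⟩
  have key : ∀ J ∈ S₀.powerset.filter Finset.Nonempty, ∀ y ∈ ⋂ j ∈ J, N j, ∀ j ∈ J, y ≠ x → y j < x j := by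
    intro J hJ y hy j hj hyx
    rw [Finset.mem_filter, Finset.mem_powerset] at hJ
    by_contra! hcon
    have := Set.mem_iInter₂.1 hy j hj
    exact hyx (eq_of_ratio_le hx.1 this.1.1 ((hxpos j).1 (hJ.1 hj)) this.2 hcon)
  refine ⟨fun J => ⋂ j ∈ J, N j, fun J hJ => ?_, ?_, ?_⟩
  · have hJ' := hJ
    rw [Finset.mem_filter, Finset.mem_powerset] at hJ'
    have hcl : IsClosed (⋂ j ∈ J, N j) := isClosed_biInter fun j _ => hNclosed j
    have hcomp : IsCompact (⋂ j ∈ J, N j) :=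
      (isCompact_simplexFace S).of_isClosed_subset hcl (hsub J hJ'.2)
    obtain ⟨j, hj⟩ := hJ'.2
    refine ⟨hsub J ⟨j, hj⟩, Set.mem_iInter₂.2 fun j _ => hxN j, hcomp,
      convex_iInter₂ fun j _ => hNconvex j, fun y => x j - y j, sub_self _,
      fun y hy hyx => sub_pos.2 (key J hJ y hy j hj hyx), ?_, fun δ => ?_⟩
    · intro y _ z _ p q _ _ hpq
      simp only [Pi.add_apply, Pi.smul_apply, smul_eq_mul]
      linear_combination (-x j) * hpq
    · exact hcomp.inter_right (isClosed_eq (by fun_prop) continuous_const)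
  · rw [← ind_iUnion]
    congr 1
    ext y
    simp only [Set.mem_iUnion, exists_prop]
    constructor
    · intro hy
      obtain ⟨j, hj, hmin⟩ := S₀.exists_min_image (fun j => y j / x j) hne
      refine ⟨j, hj, hy, fun k => ?_⟩
      by_cases hk : k ∈ S₀
      · have := hmin k hk
        rwa [div_le_div_iff₀ ((hxpos j).1 hj) ((hxpos k).1 hk)] at this
      · have h0 : x k = 0 := by
          by_contra h; exact hk ((hS₀ k).2 h)
        rw [h0, mul_zero]
        exact mul_nonneg (hy.1.1 k) ((hxpos j).1 hj).le
    · rintro ⟨j, hj, hy⟩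
      exact hy.1
  -- A vertex of the face whose label is not in `J` lies in all cones over `J`. So an intersection
  -- of cones is trivial only if `J` contains all of `S`, that is if `J = S₀ = S`, and a single term
  -- of the inclusion-exclusion survives.
  · have htriv : ∀ J ∈ S₀.powerset.filter Finset.Nonempty,
        ((⋂ j ∈ J, N j) = {x} ↔ J = S₀ ∧ S = S₀) := by
      intro J hJ
      have hJ' := hJ
      rw [Finset.mem_filter, Finset.mem_powerset] at hJ'
      have hsingle : ∀ k ∈ S, k ∉ J → (⋂ j ∈ J, N j) ≠ {x} := by
        intro k hk hkJ hcon
        have h1 : (Pi.single k 1 : κ → ℝ) ∈ ⋂ j ∈ J, N j := by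
          refine Set.mem_iInter₂.2 fun j hj => ⟨single_mem_simplexFace hk, fun i => ?_⟩
          have hjk : j ≠ k := by rintro rfl; exact hkJ hj
          rw [Pi.single_eq_of_ne hjk, zero_mul]
          exact mul_nonneg ((single_mem_stdSimplex ℝ k).1 i) (hx.1.1 j)
        rw [hcon, Set.mem_singleton_iff] at h1
        obtain ⟨j, hj⟩ := hJ'.2
        have hjk : j ≠ k := by rintro rfl; exact hkJ hj
        have h2 := (hxpos j).1 (hJ'.1 hj)
        rw [← h1, Pi.single_eq_of_ne hjk] at h2
        exact lt_irrefl _ h2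
      constructor
      · intro h
        have h1 : S ⊆ J := by
          intro k hk
          by_contra hkJ
          exact hsingle k hk hkJ h
        have h2 : J = S₀ := Finset.Subset.antisymm hJ'.1 (hS₀S.trans h1)
        exact ⟨h2, Finset.Subset.antisymm (h1.trans hJ'.1) hS₀S⟩
      · rintro ⟨rfl, rfl⟩
        refine Set.eq_singleton_iff_unique_mem.2 ⟨Set.mem_iInter₂.2 fun j _ => hxN j, fun y hy => ?_⟩
        by_contra hyx
        have h1 : ∀ j ∈ S, y j < x j := fun j hj => key S hJ y hy j hj hyx
        have h2 : ∑ j ∈ S, y j < ∑ j ∈ S, x j := Finset.sum_lt_sum_of_nonempty hne h1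
        have h3 : ∀ z ∈ simplexFace S, ∑ j ∈ S, z j = 1 := by
          intro z hz
          rw [← hz.1.2]
          exact Finset.sum_subset (Finset.subset_univ S) fun i _ hi => hz.2 i hi
        rw [h3 y (hsub S hne hy), h3 x hx] at h2
        exact lt_irrefl _ h2
    by_cases hS : S = S₀
    · rw [if_pos hS, Finset.sum_eq_single_of_mem S₀ (by simp [hne])]
      · rw [ind_of_mem (by exact (htriv S₀ (by simp [hne])).2 ⟨rfl, hS⟩), mul_one]
      · intro J hJ hJS
        rw [ind_of_notMem (by exact fun h => hJS ((htriv J hJ).1 h).1), mul_zero]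
    · rw [if_neg hS]
      exact Finset.sum_eq_zero fun J hJ => by
        rw [ind_of_notMem (by exact fun h => hS ((htriv J hJ).1 h).2), mul_zero]

/-- The local Euler characteristic of the image of a face of the standard simplex under an
injective piecewise affine map. -/
theorem PiecewiseAffineOn.hasLocalEuler_simplexFace {E' : Type*} [NormedAddCommGroup E']
    [NormedSpace ℝ E'] {F : (κ → ℝ) → E'} (hF : PiecewiseAffineOn F (stdSimplex ℝ κ))
    (hinj : Set.InjOn F (stdSimplex ℝ κ)) {x : κ → ℝ} {S S₀ : Finset κ} (hx : x ∈ simplexFace S)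
    (hS₀ : ∀ i, i ∈ S₀ ↔ x i ≠ 0) :
    HasLocalEuler (F x) (ind (F '' simplexFace S)) (if S = S₀ then (-1) ^ (S₀.card + 1) else 0) := by
  obtain ⟨M, hM, hsum, hval⟩ := exists_exposed_simplexFace hx hS₀
  have hsub : simplexFace S ⊆ stdSimplex ℝ κ := fun y hy => hy.1
  rw [← hval, ind_image_eq_sum (C := simplexFace S) hinj (fun J hJ => (hM J hJ).1.trans hsub) hsub
    (c := fun J => (-1 : ℤ) ^ (J.card + 1)) (fun y _ => by rw [hsum]; simp)]
  exact HasLocalEuler.sum _ fun J hJ =>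
    (hF.hasLocalEuler_image hinj ((hM J hJ).1.trans hsub) (hM J hJ).2).smul _

end Simplex
end

noncomputable section

/-! ## Points in general position -/

section GeneralPosition

open MeasureTheory in
-- Proper affine subspaces are null sets, while a nonempty open set has positive measure.
theorem exists_mem_forall_notMem_affineSubspace {n : ℕ} {W : Set (Fin n → ℝ)} (hW : IsOpen W)
    (hne : W.Nonempty) (𝓛 : Finset (AffineSubspace ℝ (Fin n → ℝ)))
    (h𝓛 : ∀ L ∈ 𝓛, Module.finrank ℝ L.direction < n) : ∃ w ∈ W, ∀ L ∈ 𝓛, w ∉ L := by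
  by_contra! hcon
  have h1 : W ⊆ ⋃ L ∈ 𝓛, (L : Set (Fin n → ℝ)) := fun w hw => by
    obtain ⟨L, hL, hwL⟩ := hcon w hw
    exact Set.mem_biUnion hL hwL
  have h2 : volume (⋃ L ∈ 𝓛, (L : Set (Fin n → ℝ))) = 0 := by
    refine (measure_biUnion_null_iff 𝓛.countable_toSet).2 fun L hL => ?_
    refine Measure.addHaar_affineSubspace volume L ?_
    rintro rfl
    have := h𝓛 _ hL
    rw [AffineSubspace.direction_top, finrank_top, Module.finrank_fin_fun] at this
    exact lt_irrefl _ this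
  exact (hW.measure_pos volume hne).ne' (measure_mono_null h1 h2)

/-- The complement of finitely many affine subspaces of codimension at least two in a convex open
set is connected. -/
theorem isPreconnected_diff_affineSubspaces {n : ℕ} {W : Set (Fin n → ℝ)} (hW : IsOpen W)
    (hWc : Convex ℝ W) (𝓛 : Finset (AffineSubspace ℝ (Fin n → ℝ)))
    (h𝓛 : ∀ L ∈ 𝓛, Module.finrank ℝ L.direction + 1 < n) :
    IsPreconnected {w ∈ W | ∀ L ∈ 𝓛, w ∉ L} := by
  classical
  refine isPreconnected_of_forall_pair fun y hy z hz => ?_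
  -- A segment that starts at `y` outside `L` can meet `L` only if its end lies in the span of `y`
  -- and `L`, which is still a proper subspace. Two points are joined through a third one `w`
  -- outside all these spans.
  let c : (Fin n → ℝ) → Finset (AffineSubspace ℝ (Fin n → ℝ)) := fun y =>
    𝓛.image fun L : AffineSubspace ℝ (Fin n → ℝ) => affineSpan ℝ (insert y (L : Set (Fin n → ℝ)))
  have hc : ∀ y, ∀ L ∈ c y, Module.finrank ℝ L.direction < n := by
    intro y L' hL'
    obtain ⟨L, hL, rfl⟩ := Finset.mem_image.1 hL'
    have h1 := finrank_vectorSpan_insert_le L y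
    have h2 := h𝓛 L hL
    rw [direction_affineSpan]
    omega
  obtain ⟨w, hw, hwL⟩ := exists_mem_forall_notMem_affineSubspace hW ⟨y, hy.1⟩ (c y ∪ c z)
    (fun L hL => by
      rcases Finset.mem_union.1 hL with h | h
      · exact hc y L h
      · exact hc z L h)
  have hseg : ∀ y ∈ {w ∈ W | ∀ L ∈ 𝓛, w ∉ L}, (∀ L ∈ c y, w ∉ L) →
      segment ℝ y w ⊆ {w ∈ W | ∀ L ∈ 𝓛, w ∉ L} := by
    intro y hy hwy p hp
    refine ⟨hWc.segment_subset hy.1 hw hp, fun L hL hpL => ?_⟩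
    obtain ⟨a, b, ha, hb, hab, rfl⟩ := hp
    rcases hb.eq_or_lt with rfl | hb
    · rw [zero_smul, add_zero, show a = 1 by linarith, one_smul] at hpL
      exact hy.2 L hL hpL
    · refine hwy _ (Finset.mem_image_of_mem _ hL) ?_
      have h1 : w = AffineMap.lineMap y (a • y + b • w) (1 / b) := by
        rw [AffineMap.lineMap_apply, vsub_eq_sub, vadd_eq_add,
          show a = 1 - b by linarith, sub_smul, one_smul]
        rw [show y - b • y + b • w - y = b • (w - y) by rw [smul_sub]; abel, smul_smul,
          one_div, inv_mul_cancel₀ hb.ne', one_smul]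
        abel
      rw [h1]
      exact AffineMap.lineMap_mem _ (subset_affineSpan ℝ _ (Set.mem_insert _ _))
        (subset_affineSpan ℝ _ (Set.mem_insert_of_mem _ hpL))
  refine ⟨segment ℝ y w ∪ segment ℝ z w, Set.union_subset
    (hseg y hy fun L hL => hwL L (Finset.mem_union_left _ hL))
    (hseg z hz fun L hL => hwL L (Finset.mem_union_right _ hL)),
    Or.inl (left_mem_segment ℝ y w), Or.inr (left_mem_segment ℝ z w), ?_⟩
  exact IsPreconnected.union w (right_mem_segment ℝ y w) (right_mem_segment ℝ z w)
    (convex_segment y w).isPreconnected (convex_segment z w).isPreconnected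

end GeneralPosition

/-! ## The Euler characteristic of a simplicial complex -/

section SimplicialComplex

/-- Möbius inversion in the Boolean lattice: the sets between `A` and `S` cancel unless `A = S`. It
expresses open faces through closed ones. -/
theorem sum_powerset_filter_subset {α : Type*} [DecidableEq α] (A S : Finset α) :
    ∑ T ∈ S.powerset with A ⊆ T, (-1 : ℤ) ^ (S.card + T.card) = if A = S then 1 else 0 := by
  by_cases hAS : A ⊆ S
  · have h1 : (S.powerset.filter fun T => A ⊆ T) = (S \ A).powerset.image (A ∪ ·) := by
      ext T
      simp only [Finset.mem_filter, Finset.mem_powerset, Finset.mem_image]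
      constructor
      · rintro ⟨h1, h2⟩
        exact ⟨T \ A, Finset.sdiff_subset_sdiff h1 le_rfl, Finset.union_sdiff_of_subset h2⟩
      · rintro ⟨U, hU, rfl⟩
        exact ⟨Finset.union_subset hAS (hU.trans Finset.sdiff_subset), Finset.subset_union_left⟩
    have hdisj : ∀ U ∈ (S \ A).powerset, Disjoint A U := fun U hU =>
      Finset.disjoint_of_subset_right (Finset.mem_powerset.1 hU) Finset.disjoint_sdiff
    rw [h1, Finset.sum_image]
    · have h2 : ∀ U ∈ (S \ A).powerset, (-1 : ℤ) ^ (S.card + (A ∪ U).card) =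
          (-1) ^ (S.card + A.card) * (-1) ^ U.card := by
        intro U hU
        rw [Finset.card_union_of_disjoint (hdisj U hU), ← pow_add, add_assoc]
      rw [Finset.sum_congr rfl h2, ← Finset.mul_sum, Finset.sum_powerset_neg_one_pow_card]
      by_cases h : A = S
      · subst h
        simp [← two_mul]
      · have : S \ A ≠ ∅ := fun h' => h (Finset.Subset.antisymm hAS (Finset.sdiff_eq_empty_iff_subset.1 h'))
        rw [if_neg this, if_neg h, mul_zero]
    · intro U hU U' hU' h
      have h3 := congrArg (· \ A) h
      simpa only [Finset.union_sdiff_cancel_left (hdisj U hU),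
        Finset.union_sdiff_cancel_left (hdisj U' hU')] using h3
  · rw [if_neg (by rintro rfl; exact hAS subset_rfl), Finset.sum_eq_zero]
    intro T hT
    rw [Finset.mem_filter, Finset.mem_powerset] at hT
    exact absurd (hT.2.trans hT.1) hAS

theorem sum_powerset_nonempty {α : Type*} [DecidableEq α] {S : Finset α} (hS : S.Nonempty) :
    ∑ T ∈ S.powerset with T.Nonempty, (-1 : ℤ) ^ (S.card + T.card) = (-1) ^ (S.card + 1) := by
  have h1 := sum_powerset_filter_subset ∅ S
  rw [if_neg hS.ne_empty.symm] at h1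
  have h2 : (S.powerset.filter fun T => ∅ ⊆ T) =
      insert ∅ (S.powerset.filter Finset.Nonempty) := by
    ext T
    simp only [Finset.empty_subset, Finset.filter_true, Finset.mem_insert, Finset.mem_filter,
      Finset.nonempty_iff_ne_empty, Finset.mem_powerset]
    by_cases hT : T = ∅ <;> simp [hT]
  rw [h2, Finset.sum_insert (by simp)] at h1
  rw [pow_succ]
  simp only [Finset.card_empty, add_zero] at h1
  linarith

variable {E : Type*} [NormedAddCommGroup E] [NormedSpace ℝ E]

/-- The open faces partition the space, and each of them is an alternating sum of closed faces. With
`HasEuler.unique` this allows the Euler characteristic to be recomputed from the cells of any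
crystallization. -/
theorem Geometry.SimplicialComplex.hasEuler_space (K : Geometry.SimplicialComplex ℝ E)
    (hK : K.faces.Finite) : HasEuler (ind K.space) K.eulerCharacteristic := by
  classical
  have hind : ind K.space = ∑ s ∈ hK.toFinset, ∑ t ∈ s.powerset with t.Nonempty,
      (-1 : ℤ) ^ (s.card + t.card) • ind (convexHull ℝ (t : Set E)) := by
    ext y
    simp only [Finset.sum_apply, Pi.smul_apply, smul_eq_mul]
    by_cases hy : y ∈ K.space
    · rw [ind_of_mem hy]
      obtain ⟨s₀, hs₀, hys₀⟩ := Geometry.SimplicialComplex.mem_space_iff.1 hy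
      obtain ⟨m, hm, hmin⟩ := (hK.toFinset.filter fun s : Finset E => y ∈ convexHull ℝ (s : Set E)).exists_min_image
        Finset.card ⟨s₀, by simp [hs₀, hys₀]⟩
      simp only [Finset.mem_filter, Set.Finite.mem_toFinset] at hm hmin
      -- Since two faces meet in the hull of their common vertices, the smallest face containing `y`
      -- is contained in every face containing `y`.
      have hm' : ∀ s ∈ K.faces, (y ∈ convexHull ℝ (s : Set E) ↔ m ⊆ s) := by
        intro s hs
        refine ⟨fun hys => ?_, fun h => convexHull_mono (by exact_mod_cast h) hm.2⟩
        have h1 := K.inter_subset_convexHull hm.1 hs ⟨hm.2, hys⟩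
        rw [← Finset.coe_inter] at h1
        have h2 : (m ∩ s).Nonempty := by
          have := convexHull_nonempty_iff.1 ⟨y, h1⟩
          exact_mod_cast this
        have h3 := hmin _ ⟨K.down_closed hm.1 Finset.inter_subset_left h2, h1⟩
        rw [← Finset.eq_of_subset_of_card_le Finset.inter_subset_left h3]
        exact Finset.inter_subset_right
      have h1 : ∀ s ∈ hK.toFinset, ∑ t ∈ s.powerset with t.Nonempty,
          (-1 : ℤ) ^ (s.card + t.card) * ind (convexHull ℝ (t : Set E)) y =
          if m = s then 1 else 0 := by
        intro s hs
        rw [Set.Finite.mem_toFinset] at hs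
        rw [← sum_powerset_filter_subset m s, Finset.sum_filter, Finset.sum_filter]
        refine Finset.sum_congr rfl fun t ht => ?_
        rw [Finset.mem_powerset] at ht
        by_cases htn : t.Nonempty
        · have h2 := hm' t (K.down_closed hs ht htn)
          rw [if_pos htn, ind_apply, if_congr h2 rfl rfl]
          by_cases hmt : m ⊆ t <;> simp [hmt]
        · rw [if_neg htn, if_neg]
          intro h
          exact htn ((Geometry.SimplicialComplex.nonempty_of_mem_faces hm.1).mono h)
      rw [Finset.sum_congr rfl h1]
      simp [hm.1]
    · rw [ind_of_notMem hy]
      refine (Finset.sum_eq_zero fun s hs => Finset.sum_eq_zero fun t ht => ?_).symm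
      rw [Set.Finite.mem_toFinset] at hs
      rw [Finset.mem_filter, Finset.mem_powerset] at ht
      beta_reduce
      rw [ind_of_notMem, mul_zero]
      exact fun h => hy (Geometry.SimplicialComplex.convexHull_subset_space
        (K.down_closed hs ht.1 ht.2) h)
  have hval : K.eulerCharacteristic = ∑ s ∈ hK.toFinset, ∑ t ∈ s.powerset with t.Nonempty,
      (-1 : ℤ) ^ (s.card + t.card) • (1 : ℤ) := by
    rw [Geometry.SimplicialComplex.eulerCharacteristic, finsum_mem_eq_finite_toFinset_sum _ hK]
    refine Finset.sum_congr rfl fun s hs => ?_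
    rw [Set.Finite.mem_toFinset] at hs
    have hne := Geometry.SimplicialComplex.nonempty_of_mem_faces hs
    simp only [smul_eq_mul, mul_one]
    rw [sum_powerset_nonempty hne]
    obtain ⟨k, hk⟩ := Nat.exists_eq_succ_of_ne_zero hne.card_pos.ne'
    rw [hk, Nat.succ_sub_one, pow_add, Nat.succ_eq_add_one, pow_succ]
    simp
  rw [hind, hval]
  refine HasEuler.sum _ fun s hs => HasEuler.sum _ fun t ht => HasEuler.smul ?_ _
  rw [Finset.mem_filter] at ht
  exact HasEuler.of_convex (t.finite_toSet.isCompact_convexHull ℝ) (convex_convexHull ℝ _)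
    (convexHull_nonempty_iff.2 (by exact_mod_cast ht.2))

end SimplicialComplex
end

noncomputable section

/-! ## Charts of piecewise linear manifolds -/

section Charts

variable {E : Type*} [NormedAddCommGroup E] [NormedSpace ℝ E]
variable {E' : Type*} [NormedAddCommGroup E'] [NormedSpace ℝ E']

theorem IsPL.piecewiseAffineOn {P : Set E} {f : P → E'} (h : IsPL P f) {F : E → E'}
    (hF : ∀ y : P, F y = f y) : PiecewiseAffineOn F P := by
  classical
  obtain ⟨𝒞, hP, h𝒞⟩ := h
  refine ⟨𝒞.image fun C : Finset E => convexHull ℝ (C : Set E), ?_, fun D hD => ?_⟩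
  · conv_lhs => rw [hP]
    ext y
    simp
  · obtain ⟨C, hC, rfl⟩ := Finset.mem_image.1 hD
    obtain ⟨A, hA⟩ := h𝒞 C hC
    refine ⟨C.finite_toSet.isCompact_convexHull ℝ, convex_convexHull ℝ _, A, fun y hy => ?_⟩
    have hyP : y ∈ P := by
      rw [hP]
      exact Set.mem_biUnion (x := C) hC hy
    rw [hF ⟨y, hyP⟩, hA ⟨y, hyP⟩ hy]

/-- A neighbourhood of `x` in `P` is identified with `Q` by an injective piecewise affine
map that sends `x` to the origin. -/
def HasChart (Q : Set E') (P : Set E) (x : E) : Prop :=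
  ∃ (N : Set E) (F : E → E') (G : E' → E), N ⊆ P ∧ N ∈ 𝓝[P] x ∧ x ∈ N ∧ PiecewiseAffineOn F N ∧
    F '' N = Q ∧ F x = 0 ∧ ContinuousOn G Q ∧ ∀ y ∈ N, G (F y) = y

theorem HasPLChart.hasChart {d : ℕ} {Q : Set (Fin d → ℝ)} {P : Set E} {x : E}
    (h : HasPLChart Q P x) : HasChart Q P x := by
  classical
  obtain ⟨N, hNP, hN, f, hx, hf, hfx⟩ := h
  let F : E → Fin d → ℝ := fun y => if hy : y ∈ N then f ⟨y, hy⟩ else 0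
  let G : (Fin d → ℝ) → E := fun q => if hq : q ∈ Q then f.symm ⟨q, hq⟩ else 0
  have hF : ∀ y : N, F y = f y := fun y => by simp [F]
  have hG : ∀ q : Q, G q = f.symm q := fun q => by simp [G]
  refine ⟨N, F, G, hNP, hN, hx, IsPL.piecewiseAffineOn hf hF, ?_, ?_, ?_, ?_⟩
  · ext q
    constructor
    · rintro ⟨y, hy, rfl⟩
      rw [hF ⟨y, hy⟩]
      exact (f ⟨y, hy⟩).2
    · intro hq
      refine ⟨f.symm ⟨q, hq⟩, (f.symm ⟨q, hq⟩).2, ?_⟩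
      rw [hF, Homeomorph.apply_symm_apply]
  · rw [hF ⟨x, hx⟩, hfx]
  · rw [continuousOn_iff_continuous_domRestrict]
    have : Q.domRestrict G = fun q => (f.symm q : E) := by
      ext1 q
      exact hG q
    rw [this]
    exact continuous_subtype_val.comp f.symm.continuous
  · intro y hy
    rw [hF ⟨y, hy⟩, hG (f ⟨y, hy⟩), Homeomorph.symm_apply_apply]

variable [FiniteDimensional ℝ E]

theorem hasLocalEuler_of_chart [FiniteDimensional ℝ E'] {N P : Set E} {F : E → E'} {G : E' → E}
    (hNP : N ⊆ P) (hF : PiecewiseAffineOn F N) (hG : ∀ y ∈ N, G (F y) = y) {y : E} (hy : y ∈ N)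
    (hyN : N ∈ 𝓝[P] y) {n : ℤ} (hn : HasLocalEuler (F y) (ind (F '' N)) n) :
    HasLocalEuler y (ind P) n := by
  have hinj : Set.InjOn F N := fun a ha b hb hab => by rw [← hG a ha, ← hG b hb, hab]
  refine (hF.hasLocalEuler_preimage hinj hy hn).congr ?_
  filter_upwards [mem_nhdsWithin_iff_eventually.1 hyN] with z hz
  exact ind_congr ⟨hz, fun h => hNP h⟩

theorem hasLocalEuler_Icc_interior {d : ℕ} {l r q : Fin d → ℝ} (h : ∀ k, l k < q k ∧ q k < r k) :
    HasLocalEuler q (ind (Set.Icc l r)) ((-1) ^ d) := by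
  have := hasLocalEuler_box l r q (fun _ => -1) fun k => Or.inl ⟨(h k).1, (h k).2, rfl⟩
  simpa using this

theorem cube_eq_Icc (d : ℕ) : cube d = Set.Icc (fun _ => -1) (fun _ => 1) := by
  ext x
  simp only [cube, Set.mem_ofPred_eq, Set.mem_Icc, Pi.le_def]
  exact forall_and

theorem halfCube_eq_Icc (n : ℕ) :
    halfCube (n + 1) = Set.Icc (Fin.cons 0 fun _ => -1) (fun _ => 1) := by
  ext x
  simp only [halfCube, cube, Set.mem_ofPred_eq, Set.mem_Icc, Pi.le_def, Fin.forall_fin_succ,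
    Fin.cons_zero, Fin.cons_succ, Fin.val_zero, Fin.val_succ]
  constructor
  · rintro ⟨⟨h1, h2⟩, h3, -⟩
    exact ⟨⟨h3 trivial, fun i => (h2 i).1⟩, h1.2, fun i => (h2 i).2⟩
  · rintro ⟨⟨h1, h2⟩, h3, h4⟩
    exact ⟨⟨⟨by linarith, h3⟩, fun i => ⟨h2 i, h4 i⟩⟩, fun _ => h1,
      fun i hi => absurd hi (by omega)⟩

theorem eventually_abs_lt_of_chart {d : ℕ} {N P : Set E} {F : E → Fin d → ℝ} {x : E} (hx : x ∈ N)
    (hN : N ∈ 𝓝[P] x) (hF : PiecewiseAffineOn F N) (hFx : F x = 0) {r : ℝ} (hr : 0 < r) :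
    ∀ᶠ y in 𝓝[P] x, ∀ k, |F y k| < r := by
  have h1 : Filter.Tendsto F (𝓝[P] x) (𝓝 0) := by
    have := hF.continuousOn x hx
    rw [ContinuousWithinAt, hFx] at this
    exact this.mono_left (nhdsWithin_le_of_mem hN)
  refine Filter.eventually_all.2 fun k => ?_
  have h2 : Filter.Tendsto (fun y => |F y k|) (𝓝[P] x) (𝓝 0) := by
    have := ((continuous_apply k).tendsto _).comp h1
    simpa using this.abs
  exact h2.eventually (gt_mem_nhds hr)

/-- Near a point with a chart to the cube all local Euler characteristics are `(-1) ^ d`. -/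
theorem HasChart.eventually_hasLocalEuler_cube {d : ℕ} {P : Set E} {x : E}
    (h : HasChart (cube d) P x) : ∀ᶠ y in 𝓝[P] x, HasLocalEuler y (ind P) ((-1) ^ d) := by
  obtain ⟨N, F, G, hNP, hN, hx, hF, hQ, hFx, -, hG⟩ := h
  filter_upwards [hN, eventually_eventually_nhdsWithin.2 (Filter.eventually_mem_set.2 hN),
    eventually_abs_lt_of_chart hx hN hF hFx one_pos] with y hy hyN hy1
  refine hasLocalEuler_of_chart hNP hF hG hy hyN ?_
  rw [hQ, cube_eq_Icc]
  exact hasLocalEuler_Icc_interior fun k => abs_lt.1 (hy1 k)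

/-- On the face `q 0 = 0` the point is the left end of the first edge of the box, which contributes
the factor 0; every other edge contributes `-1`. -/
theorem hasLocalEuler_halfCube {n : ℕ} {q : Fin (n + 1) → ℝ} (h0 : 0 ≤ q 0) (h1 : ∀ k, |q k| < 1) :
    HasLocalEuler q (ind (halfCube (n + 1))) (if q 0 = 0 then 0 else (-1) ^ (n + 1)) := by
  classical
  rw [halfCube_eq_Icc]
  by_cases hq : q 0 = 0
  · rw [if_pos hq]
    have := hasLocalEuler_box (Fin.cons 0 fun _ => -1) (fun _ => 1) q (Fin.cons 0 fun _ => -1)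
      (fun k => by
        refine Fin.cases ?_ (fun i => ?_) k
        · right; left
          simp [hq]
        · left
          have := abs_lt.1 (h1 i.succ)
          simpa using this)
    simpa [Fin.prod_univ_succ] using this
  · rw [if_neg hq]
    refine hasLocalEuler_Icc_interior fun k => ⟨?_, (abs_lt.1 (h1 k)).2⟩
    refine Fin.cases ?_ (fun i => ?_) k
    · simpa using lt_of_le_of_ne h0 (Ne.symm hq)
    · simpa using (abs_lt.1 (h1 i.succ)).1

theorem HasPLChart.hasLocalEuler_halfCube {n : ℕ} {P : Set E} {x : E}
    (h : HasPLChart (halfCube (n + 1)) P x) : HasLocalEuler x (ind P) 0 := by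
  obtain ⟨N, F, G, hNP, hN, hx, hF, hQ, hFx, -, hG⟩ := h.hasChart
  refine hasLocalEuler_of_chart hNP hF hG hx hN ?_
  rw [hQ, hFx]
  simpa using _root_.hasLocalEuler_halfCube (n := n) (q := 0) le_rfl (by simp)

theorem HasPLChart.hasLocalEuler_cube {d : ℕ} {P : Set E} {x : E} (hx : x ∈ P)
    (h : HasPLChart (cube d) P x) : HasLocalEuler x (ind P) ((-1) ^ d) :=
  h.hasChart.eventually_hasLocalEuler_cube.self_of_nhdsWithin hx

/-- Invariance of the boundary without homology: a chart to the half cube forces the local value 0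
and a chart to the cube forces a sign, so a point cannot have both. -/
theorem IsPLManifold.mem_plBoundary_iff {n : ℕ} {P : Set E} (hP : IsPLManifold (n + 1) P) {x : E}
    (hx : x ∈ P) : x ∈ plBoundary (n + 1) P ↔ HasLocalEuler x (ind P) 0 := by
  constructor
  · rintro ⟨-, h⟩
    exact h.hasLocalEuler_halfCube
  · intro h
    rcases hP x hx with h1 | h1
    · have := (h1.hasLocalEuler_cube hx).unique h
      exact absurd this (pow_ne_zero _ (by norm_num))
    · exact ⟨hx, h1⟩

theorem IsPLManifold.notMem_plBoundary_iff {n : ℕ} {P : Set E} (hP : IsPLManifold (n + 1) P) {x : E}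
    (hx : x ∈ P) : x ∉ plBoundary (n + 1) P ↔ HasLocalEuler x (ind P) ((-1) ^ (n + 1)) := by
  rw [hP.mem_plBoundary_iff hx]
  constructor
  · intro h
    rcases hP x hx with h1 | h1
    · exact h1.hasLocalEuler_cube hx
    · exact absurd h1.hasLocalEuler_halfCube h
  · intro h h'
    exact absurd (h.unique h') (pow_ne_zero _ (by norm_num))

/-- The boundary is closed. -/
theorem IsPLManifold.mem_plBoundary_of_frequently {n : ℕ} {P : Set E}
    (hP : IsPLManifold (n + 1) P) {x : E} (hx : x ∈ P)
    (h : ∃ᶠ y in 𝓝[P] x, y ∈ plBoundary (n + 1) P) : x ∈ plBoundary (n + 1) P := by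
  rcases hP x hx with h1 | h1
  · obtain ⟨y, ⟨hy, hyP⟩, hy'⟩ := (h.and_eventually
      (h1.hasChart.eventually_hasLocalEuler_cube)).exists
    exact absurd (hy'.unique hyP.hasLocalEuler_halfCube) (pow_ne_zero _ (by norm_num))
  · exact ⟨hx, h1⟩

/-- The boundary of a manifold is a manifold without boundary. -/
theorem IsPLManifold.hasChart_plBoundary {n : ℕ} {P : Set E} (hP : IsPLManifold (n + 1) P) {x : E}
    (hx : x ∈ plBoundary (n + 1) P) : HasChart (cube n) (plBoundary (n + 1) P) x := by
  obtain ⟨N, F, G, hNP, hN, hxN, hF, hQ, hFx, hGc, hG⟩ := hx.2.hasChart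
  have hinj : Set.InjOn F N := fun a ha b hb hab => by rw [← hG a ha, ← hG b hb, hab]
  have h0Q : (0 : Fin (n + 1) → ℝ) ∈ halfCube (n + 1) := by
    rw [← hQ, ← hFx]; exact ⟨x, hxN, rfl⟩
  have hG0 : G 0 = x := by rw [← hFx, hG x hxN]
  -- The chart domain `N` is a neighbourhood of `x`, but local values at other points `y` can be
  -- read off only where `N` is a neighbourhood of `y` in `P` as well. A small box around the origin
  -- has this property.
  obtain ⟨r, hr, hr1, hrN⟩ : ∃ r > 0, r < 1 ∧ ∀ q ∈ halfCube (n + 1), (∀ k, |q k| ≤ r) →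
      N ∈ 𝓝[P] (G q) := by
    have h1 : ∀ᶠ q in 𝓝[halfCube (n + 1)] 0, N ∈ 𝓝[P] (G q) := by
      have h2 : Filter.Tendsto G (𝓝[halfCube (n + 1)] 0) (𝓝[P] x) := by
        refine tendsto_nhdsWithin_iff.2 ⟨?_, ?_⟩
        · have := hGc 0 h0Q
          rwa [ContinuousWithinAt, hG0] at this
        · filter_upwards [self_mem_nhdsWithin] with q hq
          rw [← hQ] at hq
          obtain ⟨y, hy, rfl⟩ := hq
          rw [hG y hy]
          exact hNP hy
      exact h2.eventually (eventually_eventually_nhdsWithin.2 (Filter.eventually_mem_set.2 hN))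
    obtain ⟨ε, hε, hε'⟩ := Metric.mem_nhdsWithin_iff.1 h1
    refine ⟨min (ε / 2) (1 / 2), by positivity, lt_of_le_of_lt (min_le_right _ _) (by norm_num),
      fun q hq hqr => hε' ⟨?_, hq⟩⟩
    rw [Metric.mem_ball, dist_zero_right]
    refine lt_of_le_of_lt ((pi_norm_le_iff_of_nonneg (r := ε / 2) (by positivity)).2 fun k => ?_)
      (by linarith)
    exact (hqr k).trans (min_le_left _ _)
  let D : Set (Fin (n + 1) → ℝ) := Set.Icc (Fin.cons 0 fun _ => -r) (Fin.cons 0 fun _ => r)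
  have hD : ∀ q, q ∈ D ↔ q 0 = 0 ∧ ∀ i : Fin n, |q i.succ| ≤ r := by
    intro q
    simp only [D, Set.mem_Icc, Pi.le_def, Fin.forall_fin_succ, Fin.cons_zero, Fin.cons_succ]
    constructor
    · rintro ⟨⟨h1, h2⟩, h3, h4⟩
      exact ⟨le_antisymm h3 h1, fun i => abs_le.2 ⟨h2 i, h4 i⟩⟩
    · rintro ⟨h1, h2⟩
      exact ⟨⟨h1.ge, fun i => (abs_le.1 (h2 i)).1⟩, h1.le, fun i => (abs_le.1 (h2 i)).2⟩
  have hDr : ∀ q ∈ D, ∀ k, |q k| ≤ r := by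
    intro q hq k
    refine Fin.cases ?_ (fun i => ((hD q).1 hq).2 i) k
    rw [((hD q).1 hq).1, abs_zero]; exact hr.le
  have hDQ : D ⊆ halfCube (n + 1) := by
    intro q hq
    rw [halfCube_eq_Icc]
    have h1 := hDr q hq
    refine ⟨fun k => ?_, fun k => (abs_le.1 (h1 k)).2.trans hr1.le⟩
    refine Fin.cases ?_ (fun i => ?_) k
    · simp [((hD q).1 hq).1]
    · have := (abs_le.1 (h1 i.succ)).1
      simp only [Fin.cons_succ]; linarith
  -- The local value vanishes exactly where the first chart coordinate does, so near `x` the chart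
  -- identifies the boundary with that face of the half cube.
  have hloc : ∀ y ∈ N, N ∈ 𝓝[P] y → (∀ k, |F y k| < 1) →
      HasLocalEuler y (ind P) (if F y 0 = 0 then 0 else (-1) ^ (n + 1)) := by
    intro y hy hyN hy1
    refine hasLocalEuler_of_chart hNP hF hG hy hyN ?_
    rw [hQ]
    refine hasLocalEuler_halfCube ?_ hy1
    have : F y ∈ halfCube (n + 1) := by rw [← hQ]; exact ⟨y, hy, rfl⟩
    exact this.2 0 rfl
  -- The new chart forgets the first coordinate and rescales the box of radius `r` to the standard
  -- cube.
  let T : (Fin (n + 1) → ℝ) →ᵃ[ℝ] (Fin n → ℝ) :=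
    ((1 / r) • LinearMap.funLeft ℝ ℝ Fin.succ).toAffineMap
  have hT : ∀ q i, T q i = (1 / r) * q (Fin.succ i) := fun q i => rfl
  let G' : (Fin n → ℝ) → E := fun q => G (Fin.cons 0 (r • q))
  have hcons : ∀ q ∈ D, (Fin.cons 0 (r • T q) : Fin (n + 1) → ℝ) = q := by
    intro q hq
    ext k
    refine Fin.cases ?_ (fun i => ?_) k
    · simp [((hD q).1 hq).1]
    · simp only [Fin.cons_succ, Pi.smul_apply, hT, smul_eq_mul]
      field_simp
  have hconsD : ∀ q ∈ cube n, (Fin.cons 0 (r • q) : Fin (n + 1) → ℝ) ∈ D := by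
    intro q hq
    refine (hD _).2 ⟨rfl, fun i => ?_⟩
    have := abs_le.2 (hq i)
    simp only [Fin.cons_succ, Pi.smul_apply, smul_eq_mul, abs_mul, abs_of_pos hr]
    nlinarith
  refine ⟨N ∩ F ⁻¹' D, T ∘ F, G', ?_, ?_, ⟨hxN, ?_⟩, ?_, ?_, ?_, ?_, ?_⟩
  · rintro y ⟨hy, hyD⟩
    rw [hP.mem_plBoundary_iff (hNP hy)]
    have h1 : N ∈ 𝓝[P] y := by
      rw [← hG y hy]
      exact hrN _ (hDQ hyD) (hDr _ hyD)
    have := hloc y hy h1 fun k => (hDr _ hyD k).trans_lt hr1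
    rwa [if_pos ((hD _).1 hyD).1] at this
  · have hBP : plBoundary (n + 1) P ⊆ P := fun y hy => hy.1
    filter_upwards [nhdsWithin_mono x hBP hN, nhdsWithin_mono x hBP
      (eventually_eventually_nhdsWithin.2 (Filter.eventually_mem_set.2 hN)), nhdsWithin_mono x hBP
      (eventually_abs_lt_of_chart hxN hN hF hFx hr), self_mem_nhdsWithin] with y hy hyN hyr hyB
    refine ⟨hy, (hD _).2 ⟨?_, fun i => (hyr i.succ).le⟩⟩
    have h1 := hloc y hy hyN fun k => (hyr k).trans hr1
    by_contra h2
    rw [if_neg h2] at h1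
    exact absurd (h1.unique ((hP.mem_plBoundary_iff hyB.1).1 hyB)) (pow_ne_zero _ (by norm_num))
  · rw [Set.mem_preimage, hFx]
    exact (hD 0).2 ⟨rfl, fun i => by simpa using hr.le⟩
  · exact (hF.inter_preimage isClosed_Icc (convex_Icc _ _)).affine_comp T
  · ext q
    constructor
    · rintro ⟨y, ⟨hy, hyD⟩, rfl⟩ i
      have := ((hD _).1 hyD).2 i
      rw [Function.comp_apply, hT, ← abs_le, abs_mul, abs_of_pos (by positivity)]
      rw [one_div, inv_mul_le_iff₀ hr, mul_one]
      exact this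
    · intro hq
      have h1 : (Fin.cons 0 (r • q) : Fin (n + 1) → ℝ) ∈ F '' N := by
        rw [hQ]; exact hDQ (hconsD q hq)
      obtain ⟨y, hy, hyq⟩ := h1
      refine ⟨y, ⟨hy, ?_⟩, ?_⟩
      · rw [Set.mem_preimage, hyq]; exact hconsD q hq
      · ext i
        rw [Function.comp_apply, hyq, hT]
        simp only [Fin.cons_succ, Pi.smul_apply, smul_eq_mul]
        field_simp
  · rw [Function.comp_apply, hFx]
    ext i
    simp [hT]
  · refine hGc.comp (f := fun q : Fin n → ℝ => (Fin.cons 0 (r • q) : Fin (n + 1) → ℝ)) ?_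
      fun q hq => hDQ (hconsD q hq)
    refine Continuous.continuousOn (continuous_pi fun k => ?_)
    refine Fin.cases ?_ (fun i => ?_) k
    · exact continuous_const
    · simp only [Fin.cons_succ]
      fun_prop
  · rintro y ⟨hy, hyD⟩
    simp only [G', Function.comp_apply]
    rw [hcons _ hyD, hG y hy]

end Charts
end

noncomputable section
set_option linter.unusedSectionVars false

/-! ## The cells of the complex of an edge-coloured graph -/

section Support

variable {κ : Type*} [Fintype κ]

open Classical in
/-- The support of a point of the standard simplex. -/
def supp (x : κ → ℝ) : Finset κ := Finset.univ.filter fun i => x i ≠ 0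

@[simp] theorem mem_supp {x : κ → ℝ} {i : κ} : i ∈ supp x ↔ x i ≠ 0 := by simp [supp]

theorem supp_nonempty {x : κ → ℝ} (hx : x ∈ stdSimplex ℝ κ) : (supp x).Nonempty := by
  by_contra h
  rw [Finset.not_nonempty_iff_eq_empty] at h
  have : ∑ i, x i = 0 := Finset.sum_eq_zero fun i _ => by
    by_contra hi
    have := mem_supp.2 hi
    simp [h] at this
  rw [hx.2] at this
  exact one_ne_zero this

theorem mem_simplexFace_iff {x : κ → ℝ} (hx : x ∈ stdSimplex ℝ κ) {S : Finset κ} :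
    x ∈ simplexFace S ↔ supp x ⊆ S := by
  constructor
  · intro h i hi
    by_contra hiS
    exact mem_supp.1 hi (h.2 i hiS)
  · intro h
    refine ⟨hx, fun i hi => ?_⟩
    by_contra hi'
    exact hi (h (mem_supp.2 hi'))

/-- The interior of the face of the standard simplex with the vertices in `S`. -/
def openSimplex (S : Finset κ) : Set (κ → ℝ) := {x ∈ stdSimplex ℝ κ | supp x = S}

theorem openSimplex_nonempty {S : Finset κ} (hS : S.Nonempty) : (openSimplex S).Nonempty := by
  classical
  have hc : (0 : ℝ) < S.card := by exact_mod_cast hS.card_pos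
  refine ⟨fun i => if i ∈ S then 1 / S.card else 0, ⟨fun i => ?_, ?_⟩, ?_⟩
  · dsimp only
    split_ifs <;> positivity
  · rw [Finset.sum_ite_mem, Finset.univ_inter, Finset.sum_const, nsmul_eq_mul]
    field_simp
  · ext i
    rw [mem_supp]
    by_cases hi : i ∈ S <;> simp [hi, hc.ne']

variable [DecidableEq κ] {E : Type*} [NormedAddCommGroup E] [NormedSpace ℝ E]
  {F : (κ → ℝ) → E} (hF : PiecewiseAffineOn F (stdSimplex ℝ κ))
  (hinj : Set.InjOn F (stdSimplex ℝ κ))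

include hinj in
theorem ind_image_openSimplex (S : Finset κ) :
    ind (F '' openSimplex S) = ∑ T ∈ S.powerset with T.Nonempty,
      (-1 : ℤ) ^ (S.card + T.card) • ind (F '' simplexFace T) := by
  refine ind_image_eq_sum hinj (fun T _ x hx => hx.1) (fun x hx => hx.1) fun x hx => ?_
  have h1 : ind (openSimplex S) x = if supp x = S then 1 else 0 := by
    by_cases h : supp x = S
    · rw [if_pos h, ind_of_mem (show x ∈ openSimplex S from ⟨hx, h⟩)]
    · rw [if_neg h, ind_of_notMem fun h' => h h'.2]
  rw [h1, ← sum_powerset_filter_subset, Finset.sum_filter, Finset.sum_filter]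
  refine Finset.sum_congr rfl fun T _ => ?_
  by_cases hT : supp x ⊆ T
  · rw [if_pos hT, if_pos ((supp_nonempty hx).mono hT), ind_of_mem ((mem_simplexFace_iff hx).2 hT),
      mul_one]
  · rw [if_neg hT, ind_of_notMem (mt (mem_simplexFace_iff hx).1 hT), mul_zero, ite_self]

include hF hinj in
theorem hasEuler_image_openSimplex {S : Finset κ} (hS : S.Nonempty) :
    HasEuler (ind (F '' openSimplex S)) ((-1) ^ (S.card + 1)) := by
  rw [ind_image_openSimplex hinj, ← sum_powerset_nonempty hS]
  refine HasEuler.sum _ fun T hT => ?_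
  rw [Finset.mem_filter] at hT
  obtain ⟨i, hi⟩ := hT.2
  simpa using (hF.hasEuler_image hinj (fun x hx => hx.1) (isCompact_simplexFace T)
    (convex_simplexFace T) ⟨_, single_mem_simplexFace hi⟩).smul ((-1) ^ (S.card + T.card))

-- Of all closed faces only the one with `x` in its interior has a nonzero local value at `F x`. In
-- the alternating sum for the open face only the term `T = supp x` survives.
include hF hinj in
theorem hasLocalEuler_image_openSimplex (S : Finset κ) {x : κ → ℝ} (hx : x ∈ stdSimplex ℝ κ) :
    HasLocalEuler (F x) (ind (F '' openSimplex S))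
      (if supp x ⊆ S then (-1) ^ (S.card + 1) else 0) := by
  rw [ind_image_openSimplex hinj]
  have h1 : ∀ T, HasLocalEuler (F x) (ind (F '' simplexFace T))
      (if T = supp x then (-1) ^ ((supp x).card + 1) else 0) := by
    intro T
    by_cases hT : x ∈ simplexFace T
    · exact hF.hasLocalEuler_simplexFace hinj hT fun i => mem_supp
    · rw [if_neg]
      · refine .of_notMem ((isCompact_simplexFace T).image_of_continuousOn
          (hF.continuousOn.mono fun x hx => hx.1)).isClosed ?_
        rintro ⟨y, hy, hyx⟩
        rw [hinj hy.1 hx hyx] at hy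
        exact hT hy
      · rintro rfl
        exact hT ((mem_simplexFace_iff hx).2 subset_rfl)
  have h2 := HasLocalEuler.sum (S.powerset.filter Finset.Nonempty) (fun T _ =>
    (h1 T).smul ((-1) ^ (S.card + T.card)))
  convert h2 using 1
  by_cases hS : supp x ⊆ S
  · rw [if_pos hS, Finset.sum_eq_single_of_mem (supp x)
      (by simp [hS, supp_nonempty hx])]
    · rw [if_pos rfl, smul_eq_mul, ← pow_add, show S.card + (supp x).card + ((supp x).card + 1) =
        S.card + 1 + 2 * (supp x).card by ring, pow_add _ _ (2 * _), pow_mul]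
      simp
    · intro T _ hT
      rw [if_neg hT, smul_zero]
  · rw [if_neg hS, Finset.sum_eq_zero]
    intro T hT
    rw [Finset.mem_filter, Finset.mem_powerset] at hT
    rw [if_neg, smul_zero]
    rintro rfl
    exact hS hT.1

end Support

namespace ColoredGraph

variable {d : ℕ} {V : Type} (Γ : ColoredGraph d V)

theorem comp_nbr {B : Set (Fin (d + 1))} {c : Fin (d + 1)} (hc : c ∈ B) (u : V) :
    Γ.comp B (Γ.nbr c u) = Γ.comp B u :=
  (Quot.sound ⟨c, hc, rfl⟩).symm

/-- Since `nbr c` is an involution, a property that passes along edges passes along them in both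
directions, and hence through a whole component. -/
theorem comp_eq_induction {B : Set (Fin (d + 1))} {u v : V} (h : Γ.comp B u = Γ.comp B v)
    {p : V → Prop} (hu : p u) (hp : ∀ w, ∀ c ∈ B, p w → p (Γ.nbr c w)) : p v := by
  have h2 : ∀ a b, Relation.EqvGen (fun u v : V => ∃ c ∈ B, Γ.nbr c u = v) a b → (p a ↔ p b) := by
    intro a b hab
    induction hab with
    | rel a b hab =>
      obtain ⟨c, hc, rfl⟩ := hab
      refine ⟨hp a c hc, fun h => ?_⟩
      rw [← Γ.nbr_nbr c a]
      exact hp _ c hc h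
    | refl a => rfl
    | symm a b _ ih => exact ih.symm
    | trans a b c _ _ ih1 ih2 => exact ih1.trans ih2
  exact (h2 u v (Quot.eqvGen_exact h)).1 hu

theorem comp_mono {B B' : Set (Fin (d + 1))} (hB : B ⊆ B') {u v : V} (h : Γ.comp B u = Γ.comp B v) :
    Γ.comp B' u = Γ.comp B' v :=
  Γ.comp_eq_induction h (p := fun w => Γ.comp B' u = Γ.comp B' w) rfl fun w c hc hw => by
    rw [Γ.comp_nbr (hB hc), hw]

theorem comp_surjective (B : Set (Fin (d + 1))) : Function.Surjective (Γ.comp B) :=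
  Quot.mk_surjective

/-- A vertex in a component. -/
def rep {B : Set (Fin (d + 1))} (σ : Γ.Component B) : V := Quot.out σ

@[simp] theorem comp_rep {B : Set (Fin (d + 1))} (σ : Γ.Component B) : Γ.comp B (Γ.rep σ) = σ :=
  Quot.out_eq σ

instance [Finite V] (B : Set (Fin (d + 1))) : Finite (Γ.Component B) :=
  Finite.of_surjective _ (Γ.comp_surjective B)

/-- The colours that are not in `S`; the components of the subgraph with these colours correspond
to the cells with label set `S`. -/
abbrev Cell (S : Finset (Fin (d + 1))) : Type := Γ.Component ((S : Set (Fin (d + 1)))ᶜ)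

/-- The cell with label set `S` of the simplex of a vertex. -/
abbrev cell (S : Finset (Fin (d + 1))) (u : V) : Γ.Cell S := Γ.comp _ u

theorem cell_mono {S T : Finset (Fin (d + 1))} (h : S ⊆ T) {u v : V}
    (huv : Γ.cell T u = Γ.cell T v) : Γ.cell S u = Γ.cell S v :=
  Γ.comp_mono (Set.compl_subset_compl.2 (by exact_mod_cast h)) huv

theorem cell_nbr {S : Finset (Fin (d + 1))} {c : Fin (d + 1)} (hc : c ∉ S) (u : V) :
    Γ.cell S (Γ.nbr c u) = Γ.cell S u :=
  Γ.comp_nbr (by simpa using hc) u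

variable {E : Type*} [NormedAddCommGroup E] [NormedSpace ℝ E]

/-- The maps `R u` realize the simplices of the complex of the graph in a vector space. -/
structure IsRealization (R : V → (Fin (d + 1) → ℝ) → E) : Prop where
  piecewise : ∀ u, PiecewiseAffineOn (R u) (stdSimplex ℝ (Fin (d + 1)))
  eq_iff : ∀ {u v x y}, x ∈ stdSimplex ℝ (Fin (d + 1)) → y ∈ stdSimplex ℝ (Fin (d + 1)) →
    (R u x = R v y ↔ x = y ∧ Γ.cell (supp x) u = Γ.cell (supp x) v)

/-- The union of the interiors of the cells with the property `p`. -/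
def cells (R : V → (Fin (d + 1) → ℝ) → E) (p : ∀ S, Γ.Cell S → Prop) : Set E :=
  {y | ∃ u x, x ∈ stdSimplex ℝ (Fin (d + 1)) ∧ p (supp x) (Γ.cell (supp x) u) ∧ R u x = y}

/-- The number of cells with label set `S` and the property `p`. -/
def numCells (p : ∀ S, Γ.Cell S → Prop) (S : Finset (Fin (d + 1))) : ℕ :=
  Nat.card {σ : Γ.Cell S // p S σ}

section

variable {Γ} {R : V → (Fin (d + 1) → ℝ) → E} (hR : Γ.IsRealization R)
include hR

theorem IsRealization.injOn (u : V) : Set.InjOn (R u) (stdSimplex ℝ (Fin (d + 1))) :=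
  fun _ hx _ hy h => ((hR.eq_iff hx hy).1 h).1

variable [Finite V]

open Classical in
theorem IsRealization.ind_cells (p : ∀ S, Γ.Cell S → Prop) [∀ S, Fintype (Γ.Cell S)] :
    ind (Γ.cells R p) = ∑ S ∈ Finset.univ.filter Finset.Nonempty, ∑ σ : Γ.Cell S with p S σ,
      ind (R (Γ.rep σ) '' openSimplex S) := by
  ext y
  simp only [Finset.sum_apply]
  by_cases hy : ∃ u x, x ∈ stdSimplex ℝ (Fin (d + 1)) ∧ R u x = y
  · obtain ⟨u, x, hx, rfl⟩ := hy
    have h1 : ∀ S (σ : Γ.Cell S), R u x ∈ R (Γ.rep σ) '' openSimplex S ↔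
        supp x = S ∧ Γ.cell S u = σ := by
      intro S σ
      constructor
      · rintro ⟨z, ⟨hz, rfl⟩, hzx⟩
        obtain ⟨rfl, h⟩ := (hR.eq_iff hz hx).1 hzx
        exact ⟨rfl, by rw [← h]; exact Γ.comp_rep σ⟩
      · rintro ⟨rfl, rfl⟩
        exact ⟨x, ⟨hx, rfl⟩, (hR.eq_iff hx hx).2 ⟨rfl, Γ.comp_rep _⟩⟩
    have h2 : R u x ∈ Γ.cells R p ↔ p (supp x) (Γ.cell (supp x) u) := by
      constructor
      · rintro ⟨v, z, hz, hp, hzx⟩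
        obtain ⟨rfl, h⟩ := (hR.eq_iff hz hx).1 hzx
        rwa [← h]
      · intro h
        exact ⟨u, x, hx, h, rfl⟩
    rw [Finset.sum_eq_single_of_mem (supp x) (by simp [supp_nonempty hx])]
    · rw [Finset.sum_filter, Finset.sum_eq_single_of_mem (Γ.cell (supp x) u) (Finset.mem_univ _)]
      · rw [ind_of_mem ((h1 _ _).2 ⟨rfl, rfl⟩), ind_apply, if_congr h2 rfl rfl]
      · intro σ _ hσ
        rw [ind_of_notMem fun h => hσ ((h1 _ _).1 h).2.symm, ite_self]
    · intro S _ hS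
      refine Finset.sum_eq_zero fun σ _ => ind_of_notMem fun h => hS ((h1 _ _).1 h).1.symm
  · rw [ind_of_notMem]
    · refine (Finset.sum_eq_zero fun S _ => Finset.sum_eq_zero fun σ _ => ind_of_notMem ?_).symm
      rintro ⟨x, hx, rfl⟩
      exact hy ⟨_, x, hx.1, rfl⟩
    · rintro ⟨u, x, hx, -, rfl⟩
      exact hy ⟨u, x, hx, rfl⟩

theorem IsRealization.hasEuler_cells (p : ∀ S, Γ.Cell S → Prop) :
    HasEuler (ind (Γ.cells R p)) (∑ S ∈ Finset.univ.filter Finset.Nonempty,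
      (-1) ^ (S.card + 1) * (Γ.numCells p S : ℤ)) := by
  classical
  have : ∀ S, Fintype (Γ.Cell S) := fun S => Fintype.ofFinite _
  rw [hR.ind_cells]
  refine HasEuler.sum _ fun S hS => ?_
  rw [Finset.mem_filter] at hS
  have := HasEuler.sum (Finset.univ.filter fun σ : Γ.Cell S => p S σ) (fun σ _ =>
    hasEuler_image_openSimplex (hR.piecewise (Γ.rep σ)) (hR.injOn _) hS.2)
  rw [Finset.sum_const, nsmul_eq_mul, mul_comm] at this
  rwa [numCells, Nat.card_eq_fintype_card, Fintype.card_subtype]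

open Classical in
theorem IsRealization.hasLocalEuler_cells (p : ∀ S, Γ.Cell S → Prop) [∀ S, Fintype (Γ.Cell S)]
    (u : V) {x : Fin (d + 1) → ℝ} (hx : x ∈ stdSimplex ℝ (Fin (d + 1))) :
    HasLocalEuler (R u x) (ind (Γ.cells R p)) (∑ S ∈ Finset.univ.filter Finset.Nonempty,
      ∑ σ : Γ.Cell S with p S σ, if supp x ⊆ S ∧ Γ.cell (supp x) (Γ.rep σ) = Γ.cell (supp x) u then
        (-1) ^ (S.card + 1) else 0) := by
  rw [hR.ind_cells]
  refine HasLocalEuler.sum _ fun S hS => HasLocalEuler.sum _ fun σ hσ => ?_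
  by_cases h : Γ.cell (supp x) (Γ.rep σ) = Γ.cell (supp x) u
  · rw [← (hR.eq_iff hx hx).2 ⟨rfl, h⟩]
    simpa [h] using hasLocalEuler_image_openSimplex (hR.piecewise (Γ.rep σ)) (hR.injOn _) S hx
  · rw [if_neg fun h' => h h'.2]
    refine .of_eventually_zero ?_
    have h2 : R u x ∉ R (Γ.rep σ) '' stdSimplex ℝ (Fin (d + 1)) := by
      rintro ⟨y, hy, hyx⟩
      obtain ⟨rfl, h2⟩ := (hR.eq_iff hy hx).1 hyx
      exact h h2
    have h3 := ((isCompact_stdSimplex ℝ _).image_of_continuousOn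
        (hR.piecewise (Γ.rep σ)).continuousOn).isClosed.isOpen_compl.mem_nhds h2
    filter_upwards [h3] with y hy
    exact ind_of_notMem fun h' => hy (Set.image_mono (fun z hz => hz.1) h')

/-- The sum of the local Euler characteristics in the cells with label set `S₀`. -/
theorem IsRealization.sum_localEuler [FiniteDimensional ℝ E] (p : ∀ S, Γ.Cell S → Prop)
    {S₀ : Finset (Fin (d + 1))} {x : Fin (d + 1) → ℝ} (hx : x ∈ openSimplex S₀)
    [Fintype (Γ.Cell S₀)] (val : Γ.Cell S₀ → ℤ)
    (h : ∀ u, HasLocalEuler (R u x) (ind (Γ.cells R p)) (val (Γ.cell S₀ u))) :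
    ∑ σ, val σ = ∑ S ∈ Finset.univ.filter (S₀ ⊆ ·), (-1) ^ (S.card + 1) * (Γ.numCells p S : ℤ) := by
  classical
  have : ∀ S, Fintype (Γ.Cell S) := fun S => Fintype.ofFinite _
  obtain ⟨hx, rfl⟩ := hx
  have h1 : ∀ σ₀, val σ₀ = ∑ S ∈ Finset.univ.filter Finset.Nonempty,
      ∑ σ : Γ.Cell S with p S σ, if supp x ⊆ S ∧ Γ.cell (supp x) (Γ.rep σ) = σ₀ then
        (-1) ^ (S.card + 1) else 0 := by
    intro σ₀
    have h2 := (h (Γ.rep σ₀)).unique (hR.hasLocalEuler_cells p (Γ.rep σ₀) hx)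
    rwa [show Γ.cell (supp x) (Γ.rep σ₀) = σ₀ from Γ.comp_rep σ₀] at h2
  rw [Finset.sum_congr rfl fun σ _ => h1 σ, Finset.sum_comm]
  have hsub : (Finset.univ.filter fun S => supp x ⊆ S) ⊆ Finset.univ.filter Finset.Nonempty := by
    intro S hS
    rw [Finset.mem_filter] at hS ⊢
    exact ⟨hS.1, (supp_nonempty hx).mono hS.2⟩
  rw [← Finset.sum_subset hsub]
  · refine Finset.sum_congr rfl fun S hS => ?_
    rw [Finset.mem_filter] at hS
    -- A cell with labels `S` has exactly one face with labels `supp x` when `supp x ⊆ S`, so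
    -- summing over these faces counts every cell once.
    rw [Finset.sum_comm]
    simp only [hS.2, true_and, Finset.sum_ite_eq, Finset.mem_univ, if_true]
    rw [Finset.sum_const, nsmul_eq_mul, mul_comm, numCells, Nat.card_eq_fintype_card,
      Fintype.card_subtype]
  · intro S _ hS
    have hS' : ¬ supp x ⊆ S := fun h => hS (by simp [h])
    simp [hS']

end

end ColoredGraph
end

noncomputable section
set_option linter.unusedSectionVars false

/-! ## Realizations of manifolds and their boundary -/

theorem exists_affineSubspace_simplexFace {κ : Type*} [Fintype κ] [DecidableEq κ] {S : Finset κ}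
    {k : ℕ} (hS : S.Nonempty) (hk : S.card ≤ k) : ∃ L : AffineSubspace ℝ (κ → ℝ),
      Module.finrank ℝ L.direction + 1 ≤ k ∧ simplexFace S ⊆ L := by
  refine ⟨affineSpan ℝ ((S.image fun i => Pi.single i (1 : ℝ) : Finset (κ → ℝ)) : Set (κ → ℝ)),
    ?_, fun x hx => ?_⟩
  · obtain ⟨m, hm⟩ := Nat.exists_eq_succ_of_ne_zero hS.card_pos.ne'
    rw [direction_affineSpan]
    have := finrank_vectorSpan_image_finset_le ℝ (fun i : κ => (Pi.single i (1 : ℝ) : κ → ℝ)) S hm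
    omega
  · refine convexHull_subset_affineSpan _ ?_
    have h1 : ∑ i ∈ S, x i = 1 := by
      rw [← hx.1.2]
      exact Finset.sum_subset (Finset.subset_univ _) fun i _ hi => hx.2 i hi
    have h2 : x = ∑ i ∈ S, x i • (Pi.single i (1 : ℝ) : κ → ℝ) := by
      ext j
      rw [Finset.sum_apply]
      simp only [Pi.smul_apply, Pi.single_apply, smul_eq_mul, mul_ite, mul_one, mul_zero,
        Finset.sum_ite_eq]
      split_ifs with h
      · rfl
      · exact hx.2 j h
    rw [h2]
    exact (convex_convexHull ℝ _).sum_mem (fun i _ => hx.1.1 i) h1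
      fun i hi => subset_convexHull ℝ _ (by simpa using ⟨i, hi, rfl⟩)

namespace ColoredGraph

section Carrier

variable {d : ℕ} {V : Type} (Γ : ColoredGraph d V)

/-- Gluing across an edge of colour `c` preserves coordinates and is allowed only where coordinate
`c` vanishes. So a point may be carried along exactly the edges with colours outside its support. -/
theorem charMap_eq_iff {u v : V} {x y : stdSimplex ℝ (Fin (d + 1))} :
    Γ.charMap u x = Γ.charMap v y ↔
      x = y ∧ Γ.cell (supp x.1) u = Γ.cell (supp x.1) v := by
  constructor
  · intro h
    have h1 : ∀ a b, Relation.EqvGen (fun a b : (Σ _ : V, stdSimplex ℝ (Fin (d + 1))) =>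
        ∃ j, Γ.nbr j a.1 = b.1 ∧ a.2 = b.2 ∧ (a.2 : Fin (d + 1) → ℝ) j = 0) a b →
        a.2 = b.2 ∧ Γ.cell (supp (a.2 : Fin (d + 1) → ℝ)) a.1 =
          Γ.cell (supp (a.2 : Fin (d + 1) → ℝ)) b.1 := by
      intro a b hab
      induction hab with
      | rel a b hab =>
        obtain ⟨j, hj, h2, h3⟩ := hab
        refine ⟨h2, ?_⟩
        rw [← hj, Γ.cell_nbr (by simpa using h3)]
      | refl a => exact ⟨rfl, rfl⟩
      | symm a b _ ih => exact ⟨ih.1.symm, by rw [← ih.1]; exact ih.2.symm⟩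
      | trans a b c _ _ ih1 ih2 =>
        exact ⟨ih1.1.trans ih2.1, ih1.2.trans (by rw [ih1.1]; exact ih2.2)⟩
    exact h1 _ _ (Quot.eqvGen_exact h)
  · rintro ⟨rfl, h⟩
    refine Γ.comp_eq_induction h (p := fun w => Γ.charMap u x = Γ.charMap w x) rfl
      fun w c hc hw => hw.trans (Quot.sound ⟨c, rfl, rfl, ?_⟩)
    have : x.1 c = 0 := by simpa using hc
    exact this

theorem exists_charMap (q : Γ.Carrier) : ∃ u x, Γ.charMap u x = q := by
  obtain ⟨⟨u, x⟩, rfl⟩ := Quot.mk_surjective q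
  exact ⟨u, x, rfl⟩

theorem continuous_charMap (u : V) : Continuous (Γ.charMap u) := by
  refine continuous_quot_mk.comp ?_
  exact continuous_sigmaMk (σ := fun _ : V => stdSimplex ℝ (Fin (d + 1)))

variable {E : Type*} [NormedAddCommGroup E] [NormedSpace ℝ E] {Γ}

theorem exists_isRealization {P : Set E} (f : Γ.Carrier ≃ₜ P)
    (hf : ∀ u, IsPL (stdSimplex ℝ (Fin (d + 1))) (fun x => (f (Γ.charMap u x) : E))) :
    ∃ R : V → (Fin (d + 1) → ℝ) → E, Γ.IsRealization R ∧
      (∀ u (x : stdSimplex ℝ (Fin (d + 1))), R u x.1 = f (Γ.charMap u x)) := by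
  classical
  let R : V → (Fin (d + 1) → ℝ) → E := fun u x =>
    if hx : x ∈ stdSimplex ℝ (Fin (d + 1)) then f (Γ.charMap u ⟨x, hx⟩) else 0
  have hR : ∀ u (x : stdSimplex ℝ (Fin (d + 1))), R u x.1 = f (Γ.charMap u x) :=
    fun u x => dif_pos x.2
  refine ⟨R, ⟨fun u => (hf u).piecewiseAffineOn (hR u), ?_⟩, hR⟩
  intro u v x y hx hy
  rw [show R u x = _ from hR u ⟨x, hx⟩, show R v y = _ from hR v ⟨y, hy⟩, Subtype.coe_inj, f.injective.eq_iff, Γ.charMap_eq_iff,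
    Subtype.mk_eq_mk]

end Carrier

section

variable {d : ℕ} {V : Type} {Γ : ColoredGraph d V}
  {E : Type*} [NormedAddCommGroup E] [NormedSpace ℝ E] {R : V → (Fin (d + 1) → ℝ) → E}

theorem IsRealization.mem_cells (hR : Γ.IsRealization R) {p : ∀ S, Γ.Cell S → Prop} {u : V}
    {x : Fin (d + 1) → ℝ} (hx : x ∈ stdSimplex ℝ (Fin (d + 1))) :
    R u x ∈ Γ.cells R p ↔ p (supp x) (Γ.cell (supp x) u) := by
  constructor
  · rintro ⟨v, z, hz, hp, hzx⟩
    obtain ⟨rfl, h⟩ := (hR.eq_iff hz hx).1 hzx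
    rwa [← h]
  · intro h
    exact ⟨u, x, hx, h, rfl⟩

theorem IsRealization.hasLocalEuler_cells_card [Finite V] (hR : Γ.IsRealization R)
    (p : ∀ S, Γ.Cell S → Prop) (u : V) {x : Fin (d + 1) → ℝ}
    (hx : x ∈ stdSimplex ℝ (Fin (d + 1))) :
    HasLocalEuler (R u x) (ind (Γ.cells R p)) (∑ S ∈ Finset.univ.filter (supp x ⊆ ·),
      (-1) ^ (S.card + 1) * (Nat.card {σ : Γ.Cell S // p S σ ∧
        ∃ v, Γ.cell S v = σ ∧ Γ.cell (supp x) v = Γ.cell (supp x) u} : ℤ)) := by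
  classical
  have : ∀ S, Fintype (Γ.Cell S) := fun S => Fintype.ofFinite _
  convert hR.hasLocalEuler_cells p u hx using 1
  have hsub : (Finset.univ.filter fun S => supp x ⊆ S) ⊆ Finset.univ.filter Finset.Nonempty := by
    intro S hS
    rw [Finset.mem_filter] at hS ⊢
    exact ⟨hS.1, (supp_nonempty hx).mono hS.2⟩
  rw [← Finset.sum_subset hsub]
  · refine Finset.sum_congr rfl fun S hS => ?_
    rw [Finset.mem_filter] at hS
    rw [← Finset.sum_filter, Finset.sum_const, nsmul_eq_mul, mul_comm, Nat.card_eq_fintype_card,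
      Fintype.card_subtype, Finset.filter_filter]
    congr 3
    ext σ
    simp only [Finset.mem_filter, Finset.mem_univ, true_and, hS.2]
    refine and_congr_right fun _ => ⟨?_, fun h => ⟨_, Γ.comp_rep σ, h⟩⟩
    rintro ⟨v, hv, hv'⟩
    rw [← hv']
    exact Γ.cell_mono hS.2 ((Γ.comp_rep σ).trans hv.symm)
  · intro S _ hS
    have hS' : ¬ supp x ⊆ S := fun h => hS (by simp [h])
    simp [hS']

/-- The image of the cells with at most `k` labels in a chart lies in finitely many affine
subspaces of dimension less than `k`. -/
theorem IsRealization.exists_affineSubspaces [Finite V] (hR : Γ.IsRealization R) {n : ℕ} {N : Set E}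
    {F : E → Fin n → ℝ} (hF : PiecewiseAffineOn F N) (k : ℕ) :
    ∃ 𝓛 : Finset (AffineSubspace ℝ (Fin n → ℝ)), (∀ L ∈ 𝓛, Module.finrank ℝ L.direction + 1 ≤ k) ∧
      ∀ u, ∀ x ∈ stdSimplex ℝ (Fin (d + 1)), (supp x).card ≤ k → R u x ∈ N →
        ∃ L ∈ 𝓛, F (R u x) ∈ L := by
  classical
  have := Fintype.ofFinite V
  have h1 : ∀ u, ∀ S : Finset (Fin (d + 1)), ∃ 𝓛 : Finset (AffineSubspace ℝ (Fin n → ℝ)),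
      (∀ L ∈ 𝓛, Module.finrank ℝ L.direction + 1 ≤ k) ∧
      (S.Nonempty → S.card ≤ k → ∀ x ∈ simplexFace S, R u x ∈ N → ∃ L ∈ 𝓛, F (R u x) ∈ L) := by
    intro u S
    by_cases hS : S.Nonempty ∧ S.card ≤ k
    · obtain ⟨L, hL, hSL⟩ := exists_affineSubspace_simplexFace hS.1 hS.2
      obtain ⟨𝓛, h𝓛, hx⟩ := (((hR.piecewise u).comp hF).inter
        (isCompact_simplexFace S).isClosed (convex_simplexFace S)).exists_affineSubspaces L
        (fun x hx => hSL hx.2)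
      refine ⟨𝓛, fun L' hL' => ?_, fun _ _ x hxS hxN => hx x ⟨⟨hxS.1, hxN⟩, hxS⟩⟩
      have := h𝓛 L' hL'
      omega
    · exact ⟨∅, by simp, fun h h' => absurd ⟨h, h'⟩ hS⟩
  choose 𝓛 h𝓛 hx using h1
  refine ⟨Finset.univ.biUnion fun u => Finset.univ.biUnion fun S => 𝓛 u S, fun L hL => ?_,
    fun u x hxs hk hN => ?_⟩
  · simp only [Finset.mem_biUnion, Finset.mem_univ, true_and] at hL
    obtain ⟨u, S, hL⟩ := hL
    exact h𝓛 u S L hL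
  · obtain ⟨L, hL, h⟩ := hx u (supp x) (supp_nonempty hxs) hk x
      ((mem_simplexFace_iff hxs).2 subset_rfl) hN
    refine ⟨L, ?_, h⟩
    simp only [Finset.mem_biUnion, Finset.mem_univ, true_and]
    exact ⟨u, _, hL⟩

theorem IsRealization.isClosed_image [Finite V] (hR : Γ.IsRealization R) (U : Set V)
    {C : Set (Fin (d + 1) → ℝ)} (hC : IsClosed C) :
    IsClosed {y | ∃ u ∈ U, ∃ x ∈ stdSimplex ℝ (Fin (d + 1)), x ∈ C ∧ R u x = y} := by
  have h1 : {y | ∃ u ∈ U, ∃ x ∈ stdSimplex ℝ (Fin (d + 1)), x ∈ C ∧ R u x = y} =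
      ⋃ u ∈ U, R u '' (stdSimplex ℝ (Fin (d + 1)) ∩ C) := by
    ext y
    simp only [Set.mem_ofPred_eq, Set.mem_iUnion, Set.mem_image, Set.mem_inter_iff, exists_prop,
      and_assoc]
  rw [h1]
  exact U.toFinite.isClosed_biUnion fun u _ =>
    (((isCompact_stdSimplex ℝ _).inter_right hC).image_of_continuousOn
      ((hR.piecewise u).continuousOn.mono Set.inter_subset_left)).isClosed

end

end ColoredGraph
end

/-! ### Boundary cells and the boundary facets of a realization -/

noncomputable section
set_option linter.unusedSectionVars false

namespace ColoredGraph

section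

variable {d : ℕ} {V : Type} (Γ : ColoredGraph d V)

/-- The cells of the boundary: those without the last label in the simplex of a boundary vertex. -/
def IsBoundaryCell (S : Finset (Fin (d + 1))) (σ : Γ.Cell S) : Prop :=
  Fin.last d ∉ S ∧ ∃ u, Γ.nbr (Fin.last d) u = u ∧ Γ.cell S u = σ

theorem comp_singleton_eq_iff {c : Fin (d + 1)} {u v : V} :
    Γ.comp {c} u = Γ.comp {c} v ↔ v = u ∨ v = Γ.nbr c u := by
  constructor
  · intro h
    refine Γ.comp_eq_induction h (p := fun v => v = u ∨ v = Γ.nbr c u) (Or.inl rfl) ?_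
    rintro w _ rfl (rfl | rfl)
    · exact Or.inr rfl
    · exact Or.inl (Γ.nbr_nbr _ _)
  · rintro (rfl | rfl)
    · rfl
    · exact (Γ.comp_nbr (Set.mem_singleton c) u).symm

theorem cell_univ_injective : Function.Injective (Γ.cell Finset.univ) := by
  intro u v h
  exact Γ.comp_eq_induction h (p := fun v => u = v) rfl (by simp)

theorem cell_erase_eq_iff {c : Fin (d + 1)} {u v : V} :
    Γ.cell (Finset.univ.erase c) u = Γ.cell (Finset.univ.erase c) v ↔ v = u ∨ v = Γ.nbr c u := by
  rw [← Γ.comp_singleton_eq_iff]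
  have h : ((Finset.univ.erase c : Finset (Fin (d + 1))) : Set (Fin (d + 1)))ᶜ = {c} := by
    ext i; simp
  constructor
  · exact fun h' => Γ.comp_mono h.le h'
  · exact fun h' => Γ.comp_mono h.ge h'

theorem cell_erase_erase_eq_iff {b c : Fin (d + 1)} {u v : V} :
    Γ.cell ((Finset.univ.erase b).erase c) u = Γ.cell ((Finset.univ.erase b).erase c) v ↔
      Γ.comp {c, b} u = Γ.comp {c, b} v := by
  have h : (((Finset.univ.erase b).erase c : Finset (Fin (d + 1))) : Set (Fin (d + 1)))ᶜ =
      {c, b} := by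
    ext i; simp; tauto
  constructor
  · exact fun h' => Γ.comp_mono h.le h'
  · exact fun h' => Γ.comp_mono h.ge h'

end

theorem exists_erase_of_card {n : ℕ} {S : Finset (Fin n)} (h : n ≤ S.card + 1) :
    S = Finset.univ ∨ ∃ c, S = Finset.univ.erase c := by
  by_cases hS : S = Finset.univ
  · exact Or.inl hS
  · right
    obtain ⟨c, hc⟩ : ∃ c, c ∉ S := by
      by_contra! h'
      exact hS (Finset.eq_univ_iff_forall.2 h')
    refine ⟨c, Finset.eq_of_subset_of_card_le ?_ ?_⟩
    · exact fun i hi => Finset.mem_erase.2 ⟨fun h => hc (h ▸ hi), Finset.mem_univ _⟩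
    · rw [Finset.card_erase_of_mem (Finset.mem_univ _), Finset.card_univ, Fintype.card_fin]
      omega

theorem supersets_erase {n : ℕ} (c : Fin n) :
    Finset.univ.filter (Finset.univ.erase c ⊆ ·) = {Finset.univ, Finset.univ.erase c} := by
  ext S
  simp only [Finset.mem_filter, Finset.mem_univ, true_and, Finset.mem_insert, Finset.mem_singleton]
  constructor
  · intro h
    by_cases hc : c ∈ S
    · left
      rw [Finset.eq_univ_iff_forall]
      intro i
      by_cases hi : i = c
      · rwa [hi]
      · exact h (Finset.mem_erase.2 ⟨hi, Finset.mem_univ _⟩)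
    · right
      refine subset_antisymm (fun i hi => Finset.mem_erase.2 ⟨?_, Finset.mem_univ _⟩) h
      rintro rfl
      exact hc hi
  · rintro (rfl | rfl)
    · exact Finset.subset_univ _
    · exact subset_rfl

section

variable {n : ℕ} {V : Type} {Γ : ColoredGraph (n + 1) V}
  {E : Type*} [NormedAddCommGroup E] [NormedSpace ℝ E] {R : V → (Fin (n + 2) → ℝ) → E} {P : Set E}

theorem card_cell_univ (q : V → Prop) (r : V → Prop) :
    Nat.card {σ : Γ.Cell Finset.univ // (∃ w, q w ∧ Γ.cell Finset.univ w = σ) ∧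
      ∃ v, Γ.cell Finset.univ v = σ ∧ r v} = Nat.card {v // q v ∧ r v} := by
  refine Nat.card_congr (Equiv.ofBijective
    (fun v : {v // q v ∧ r v} => ⟨Γ.cell Finset.univ v.1, ⟨v.1, v.2.1, rfl⟩, v.1, rfl, v.2.2⟩)
    ⟨fun v w hvw => ?_, ?_⟩).symm
  · exact Subtype.ext (Γ.cell_univ_injective (Subtype.ext_iff.1 hvw))
  · rintro ⟨σ, ⟨w, hw, rfl⟩, v, hv, hr⟩
    obtain rfl := Γ.cell_univ_injective hv
    exact ⟨⟨v, hw, hr⟩, rfl⟩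

/-- The maps `R u` realize the complex of the graph as the manifold `P`. -/
structure IsManifoldRealization (Γ : ColoredGraph (n + 1) V) (R : V → (Fin (n + 2) → ℝ) → E)
    (P : Set E) : Prop where
  real : Γ.IsRealization R
  manifold : IsPLManifold (n + 1) P
  mem_iff : ∀ y, y ∈ P ↔ ∃ u, ∃ x ∈ stdSimplex ℝ (Fin (n + 2)), R u x = y

variable (h : Γ.IsManifoldRealization R P)
include h

theorem IsManifoldRealization.eq_cells : P = Γ.cells R fun _ _ => True := by
  ext y
  rw [h.mem_iff]
  simp [cells]

theorem IsManifoldRealization.mem {u : V} {x : Fin (n + 2) → ℝ}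
    (hx : x ∈ stdSimplex ℝ (Fin (n + 2))) : R u x ∈ P := (h.mem_iff _).2 ⟨u, x, hx, rfl⟩

variable [Finite V] [FiniteDimensional ℝ E]

theorem IsManifoldRealization.notMem_plBoundary_of_univ {u : V} {x : Fin (n + 2) → ℝ}
    (hx : x ∈ openSimplex Finset.univ) : R u x ∉ plBoundary (n + 1) P := by
  obtain ⟨hx, hS⟩ := hx
  rw [h.manifold.mem_plBoundary_iff (h.mem hx)]
  intro h0
  rw [h.eq_cells] at h0
  have h1 := h0.unique (h.real.hasLocalEuler_cells_card _ u hx)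
  rw [hS, show Finset.univ.filter (Finset.univ ⊆ ·) = ({Finset.univ} : Finset (Finset (Fin (n + 2))))
    from by ext S; simp [Finset.univ_subset_iff], Finset.sum_singleton] at h1
  have h2 : (fun σ : Γ.Cell Finset.univ => True ∧ ∃ v, Γ.cell Finset.univ v = σ ∧
      Γ.cell Finset.univ v = Γ.cell Finset.univ u) = fun σ => σ = Γ.cell Finset.univ u := by
    ext σ
    constructor
    · rintro ⟨-, v, rfl, hv⟩
      exact hv
    · rintro rfl
      exact ⟨trivial, u, rfl, rfl⟩
  rw [h2] at h1
  simp only [Nat.card_unique, Nat.cast_one, mul_one] at h1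
  exact pow_ne_zero _ (by norm_num) h1.symm

/-- An interior point of the facet lies in the simplices of `u` and `nbr c u`. If these are k
simplices, the local value is (-1)^(n+1) (k - 1), which vanishes exactly when the two coincide. -/
theorem IsManifoldRealization.mem_plBoundary_erase_iff {u : V} {x : Fin (n + 2) → ℝ}
    {c : Fin (n + 2)} (hx : x ∈ openSimplex (Finset.univ.erase c)) :
    R u x ∈ plBoundary (n + 1) P ↔ Γ.nbr c u = u := by
  classical
  have := Fintype.ofFinite V
  obtain ⟨hx, hS⟩ := hx
  rw [h.manifold.mem_plBoundary_iff (h.mem hx), h.eq_cells]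
  have h1 := h.real.hasLocalEuler_cells_card (fun _ _ => True) u hx
  rw [hS, supersets_erase, Finset.sum_pair (by
    intro h'; have := Finset.mem_univ c; rw [h'] at this; simp at this)] at h1
  have h2 : (fun σ : Γ.Cell (Finset.univ.erase c) => True ∧ ∃ v, Γ.cell (Finset.univ.erase c) v = σ ∧
      Γ.cell (Finset.univ.erase c) v = Γ.cell (Finset.univ.erase c) u) =
      fun σ => σ = Γ.cell (Finset.univ.erase c) u := by
    ext σ
    constructor
    · rintro ⟨-, v, rfl, hv⟩
      exact hv
    · rintro rfl
      exact ⟨trivial, u, rfl, rfl⟩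
  have h3 := card_cell_univ (Γ := Γ) (fun _ => True) fun v =>
    Γ.cell (Finset.univ.erase c) v = Γ.cell (Finset.univ.erase c) u
  have h4 : ∀ σ : Γ.Cell Finset.univ, (∃ w, True ∧ Γ.cell Finset.univ w = σ) = True := by
    intro σ
    simp only [true_and, eq_iff_iff, iff_true]
    exact Γ.comp_surjective _ σ
  simp only [h4] at h3
  have h5 : Nat.card {v // True ∧ Γ.cell (Finset.univ.erase c) v = Γ.cell (Finset.univ.erase c) u}
      = ({u, Γ.nbr c u} : Finset V).card := by
    rw [Nat.card_eq_fintype_card, Fintype.card_subtype]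
    congr 1
    ext v
    simp only [Finset.mem_filter, Finset.mem_univ, true_and, Finset.mem_insert,
      Finset.mem_singleton]
    rw [eq_comm, Γ.cell_erase_eq_iff]
  rw [h3, h5, h2] at h1
  have h6 : ∀ m : ℤ, HasLocalEuler (R u x) (ind (Γ.cells R fun _ _ => True)) m → m = _ :=
    fun m hm => hm.unique h1
  have hc : (Finset.univ.erase c : Finset (Fin (n + 2))).card = n + 1 := by
    rw [Finset.card_erase_of_mem (Finset.mem_univ _)]; simp
  simp only [Finset.card_univ, Fintype.card_fin, hc, Nat.card_unique, Nat.cast_one, mul_one] at h1 h6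
  constructor
  · intro h0
    by_contra hu
    have := h6 _ h0
    rw [Finset.card_pair (Ne.symm hu)] at this
    rw [pow_succ] at this
    push_cast at this
    have h7 : (-1 : ℤ) ^ (n + 1 + 1) ≠ 0 := pow_ne_zero _ (by norm_num)
    apply h7
    linarith
  · intro hu
    convert h1
    rw [hu, pow_succ]
    simp

end

end ColoredGraph
end

/-! ### The boundary as a subcomplex, and the Dehn-Sommerville relations -/

noncomputable section
set_option linter.unusedSectionVars false

theorem simplexFace_subset_closure_openSimplex {κ : Type*} [Fintype κ] {S : Finset κ}
    (hS : S.Nonempty) : simplexFace S ⊆ closure (openSimplex S) := by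
  intro x hx
  obtain ⟨b, hb, hbS⟩ := openSimplex_nonempty hS
  have h1 : Filter.Tendsto (fun t : ℝ => AffineMap.lineMap x b t) (𝓝[>] 0) (𝓝 x) := by
    have : Continuous fun t : ℝ => AffineMap.lineMap (k := ℝ) x b t := AffineMap.lineMap_continuous
    have := this.tendsto 0
    rw [AffineMap.lineMap_apply_zero] at this
    exact this.mono_left nhdsWithin_le_nhds
  refine mem_closure_of_tendsto h1 ?_
  filter_upwards [Ioo_mem_nhdsGT (zero_lt_one (α := ℝ))] with t ht
  have hconv := (convex_stdSimplex ℝ κ).lineMap_mem hx.1 hb ⟨ht.1.le, ht.2.le⟩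
  refine ⟨hconv, ?_⟩
  ext i
  have hi : AffineMap.lineMap x b t i = (1 - t) * x i + t * b i := by
    simp [AffineMap.lineMap_apply]; ring
  rw [mem_supp, hi]
  by_cases hiS : i ∈ S
  · have hbi : b i ≠ 0 := by rw [← hbS] at hiS; exact mem_supp.1 hiS
    have h2 : 0 < b i := lt_of_le_of_ne (hb.1 i) hbi.symm
    have h3 := hx.1.1 i
    have h4 : 0 < t * b i := mul_pos ht.1 h2
    have h5 : 0 ≤ (1 - t) * x i := mul_nonneg (by linarith [ht.2]) h3
    simp only [hiS, iff_true]
    linarith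
  · have hbi : b i = 0 := by
      by_contra h'
      exact hiS (by rw [← hbS]; exact mem_supp.2 h')
    simp [hiS, hbi, hx.2 i hiS]

namespace ColoredGraph

variable {n : ℕ} {V : Type} {Γ : ColoredGraph (n + 1) V}
  {E : Type*} [NormedAddCommGroup E] [NormedSpace ℝ E] {R : V → (Fin (n + 2) → ℝ) → E} {P : Set E}

theorem mem_simplexFace_erase {d : ℕ} {c : Fin d} {x : Fin d → ℝ}
    (hx : x ∈ stdSimplex ℝ (Fin d)) : x ∈ simplexFace (Finset.univ.erase c) ↔ x c = 0 := by
  rw [mem_simplexFace_iff hx]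
  constructor
  · intro h
    by_contra hc
    simpa using h (mem_supp.2 hc)
  · intro h i hi
    rw [Finset.mem_erase]
    refine ⟨?_, Finset.mem_univ _⟩
    rintro rfl
    exact mem_supp.1 hi h

theorem erase_nonempty (c : Fin (n + 2)) : (Finset.univ.erase c).Nonempty := by
  rw [← Finset.card_pos, Finset.card_erase_of_mem (Finset.mem_univ _)]
  simp

variable (h : Γ.IsManifoldRealization R P) [Finite V] [FiniteDimensional ℝ E]
include h

theorem IsManifoldRealization.tendsto {u : V} {x : Fin (n + 2) → ℝ}
    (hx : x ∈ stdSimplex ℝ (Fin (n + 2))) :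
    Filter.Tendsto (R u) (𝓝[stdSimplex ℝ (Fin (n + 2))] x) (𝓝[P] (R u x)) :=
  tendsto_nhdsWithin_iff.2 ⟨(h.real.piecewise u).continuousOn x hx,
    eventually_mem_nhdsWithin.mono fun _ hz => h.mem hz⟩

/-- The facet criterion applies to the interior of the free facet of `u`; the rest follows because
the boundary is closed in `P`. -/
theorem IsManifoldRealization.mem_plBoundary {u : V} (hu : Γ.nbr (Fin.last (n + 1)) u = u)
    {x : Fin (n + 2) → ℝ} (hx : x ∈ stdSimplex ℝ (Fin (n + 2))) (hx0 : x (Fin.last (n + 1)) = 0) :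
    R u x ∈ plBoundary (n + 1) P := by
  refine h.manifold.mem_plBoundary_of_frequently (h.mem hx) ?_
  refine (h.tendsto hx).frequently ?_
  rw [frequently_nhdsWithin_iff]
  have h1 := simplexFace_subset_closure_openSimplex (erase_nonempty (Fin.last (n + 1)))
    ((mem_simplexFace_erase hx).2 hx0)
  rw [mem_closure_iff_frequently] at h1
  exact h1.mono fun z hz => ⟨(h.mem_plBoundary_erase_iff hz).2 hu, hz.1⟩

theorem IsManifoldRealization.mem_plBoundary_of_card {u : V} {x : Fin (n + 2) → ℝ}
    (hx : x ∈ stdSimplex ℝ (Fin (n + 2))) (hb : R u x ∈ plBoundary (n + 1) P)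
    (hc : n < (supp x).card) : Γ.nbr (Fin.last (n + 1)) u = u ∧
      supp x = Finset.univ.erase (Fin.last (n + 1)) := by
  rcases exists_erase_of_card (S := supp x) (by omega) with hS | ⟨c, hS⟩
  · exact absurd hb (h.notMem_plBoundary_of_univ ⟨hx, hS⟩)
  · have h1 := (h.mem_plBoundary_erase_iff ⟨hx, hS⟩).1 hb
    have h2 : c = Fin.last (n + 1) := by
      by_contra h'
      exact Γ.nbr_ne c u h' h1
    subst h2
    exact ⟨h1, hS⟩

/-- The free facets form a closed set. A boundary point outside it would have an open set of an
`n`-dimensional boundary chart avoiding it. Cells with at most `n` labels occupy only finitely many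
affine subspaces of dimension below `n` there, so some point of this open set has more labels; being
on the boundary, it lies in a free facet by `mem_plBoundary_of_card`, a contradiction. -/
theorem IsManifoldRealization.mem_plBoundary_iff {y : E} : y ∈ plBoundary (n + 1) P ↔
    ∃ u ∈ {u | Γ.nbr (Fin.last (n + 1)) u = u}, ∃ x ∈ stdSimplex ℝ (Fin (n + 2)),
      x ∈ {x | x (Fin.last (n + 1)) = 0} ∧ R u x = y := by
  constructor
  swap
  · rintro ⟨u, hu, x, hx, hx0, rfl⟩
    exact h.mem_plBoundary hu hx hx0
  intro hy
  by_contra hcon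
  have hcl := h.real.isClosed_image {u | Γ.nbr (Fin.last (n + 1)) u = u}
    (C := {x | x (Fin.last (n + 1)) = 0}) (isClosed_eq (continuous_apply _) continuous_const)
  obtain ⟨N, F, G, hN, -, hyN, hF, hQ, hFy, hGc, hG⟩ := h.manifold.hasChart_plBoundary hy
  obtain ⟨𝓛, h𝓛, hcov⟩ := h.real.exists_affineSubspaces hF n
  have hsub : {q : Fin n → ℝ | ∀ k, |q k| < 1} ⊆ cube n := fun q hq k =>
    ⟨(abs_lt.1 (hq k)).1.le, (abs_lt.1 (hq k)).2.le⟩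
  have hopen : IsOpen {q : Fin n → ℝ | ∀ k, |q k| < 1} := by
    rw [Set.ofPred_forall]
    exact isOpen_iInter_of_finite fun k => isOpen_lt (continuous_apply k).abs continuous_const
  have hW := (hGc.mono hsub).isOpen_inter_preimage hopen hcl.isOpen_compl
  obtain ⟨q, ⟨hq1, hq2⟩, hq⟩ := exists_mem_forall_notMem_affineSubspace hW
    ⟨0, by simp, by
      rw [Set.mem_preimage, ← hFy, hG y hyN]
      exact hcon⟩ 𝓛 (fun L hL => h𝓛 L hL)
  have hq3 := hsub hq1
  rw [← hQ] at hq3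
  obtain ⟨y', hy', rfl⟩ := hq3
  rw [Set.mem_preimage, hG y' hy'] at hq2
  obtain ⟨u, x, hx, rfl⟩ := (h.mem_iff _).1 (hN hy').1
  by_cases hc : (supp x).card ≤ n
  · obtain ⟨L, hL, hxL⟩ := hcov u x hx hc hy'
    exact hq L hL hxL
  · obtain ⟨h1, h2⟩ := h.mem_plBoundary_of_card hx (hN hy') (not_le.1 hc)
    refine hq2 ⟨u, h1, x, hx, ?_, rfl⟩
    exact (mem_simplexFace_erase hx).1 ((mem_simplexFace_iff hx).2 h2.le)

theorem IsManifoldRealization.plBoundary_eq :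
    plBoundary (n + 1) P = Γ.cells R Γ.IsBoundaryCell := by
  ext y
  rw [h.mem_plBoundary_iff]
  constructor
  · rintro ⟨u, hu, x, hx, hx0, rfl⟩
    exact ⟨u, x, hx, ⟨by simpa using hx0, u, hu, rfl⟩, rfl⟩
  · rintro ⟨u, x, hx, ⟨hS, v, hv, hvu⟩, rfl⟩
    exact ⟨v, hv, x, hx, by simpa using hS, (h.real.eq_iff hx hx).2 ⟨rfl, hvu⟩⟩

theorem IsManifoldRealization.mem_plBoundary_iff_isBoundaryCell {u : V} {x : Fin (n + 2) → ℝ}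
    (hx : x ∈ stdSimplex ℝ (Fin (n + 2))) :
    R u x ∈ plBoundary (n + 1) P ↔ Γ.IsBoundaryCell (supp x) (Γ.cell (supp x) u) := by
  rw [h.plBoundary_eq, h.real.mem_cells hx]

/-- The Dehn-Sommerville relations: choose one interior point in each cell with labels `S` and add
up the local values, which are 0 on boundary cells and (-1)^(n+1) on the others. -/
theorem IsManifoldRealization.sum_numCells {S : Finset (Fin (n + 2))} (hS : S.Nonempty) :
    (-1) ^ (n + 1) * ((Γ.numCells (fun _ _ => True) S : ℤ) - Γ.numCells Γ.IsBoundaryCell S) =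
      ∑ T ∈ Finset.univ.filter (S ⊆ ·), (-1) ^ (T.card + 1) *
        (Γ.numCells (fun _ _ => True) T : ℤ) := by
  classical
  have := Fintype.ofFinite (Γ.Cell S)
  obtain ⟨x, hx⟩ := openSimplex_nonempty hS
  rw [← h.real.sum_localEuler (fun _ _ => True) hx
    (fun σ => if Γ.IsBoundaryCell S σ then 0 else (-1) ^ (n + 1))]
  · rw [Finset.sum_ite, Finset.sum_const_zero, zero_add, Finset.sum_const, nsmul_eq_mul, mul_comm]
    congr 1
    rw [numCells, numCells, Nat.card_eq_fintype_card, Nat.card_eq_fintype_card, Fintype.card_subtype,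
      Fintype.card_subtype]
    have := Finset.card_filter_add_card_filter_not (s := (Finset.univ : Finset (Γ.Cell S)))
      (fun σ => Γ.IsBoundaryCell S σ)
    rw [Finset.filter_true, ← this]
    push_cast
    ring
  · intro u
    obtain ⟨hx, rfl⟩ := hx
    have h1 := h.mem_plBoundary_iff_isBoundaryCell (u := u) hx
    rw [← h.eq_cells]
    split_ifs with hb
    · exact (h.manifold.mem_plBoundary_iff (h.mem hx)).1 (h1.2 hb)
    · exact (h.manifold.notMem_plBoundary_iff (h.mem hx)).1 fun h' => hb (h1.1 h')

theorem IsManifoldRealization.hasLocalEuler_plBoundary {y : E} (hy : y ∈ plBoundary (n + 1) P) :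
    HasLocalEuler y (ind (plBoundary (n + 1) P)) ((-1) ^ n) :=
  (h.manifold.hasChart_plBoundary hy).eventually_hasLocalEuler_cube.self_of_nhdsWithin hy

end ColoredGraph
end

/-! ### Adjacency and connectedness of the boundary facets -/

noncomputable section
set_option linter.unusedSectionVars false

namespace ColoredGraph

variable {n : ℕ} {V : Type} {Γ : ColoredGraph (n + 1) V}
  {E : Type*} [NormedAddCommGroup E] [NormedSpace ℝ E] {R : V → (Fin (n + 2) → ℝ) → E} {P : Set E}

theorem cell_erase_last_injOn {u v : V} (hu : Γ.nbr (Fin.last (n + 1)) u = u)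
    (huv : Γ.cell (Finset.univ.erase (Fin.last (n + 1))) u =
      Γ.cell (Finset.univ.erase (Fin.last (n + 1))) v) : v = u := by
  rw [Γ.cell_erase_eq_iff, hu, or_self] at huv
  exact huv

variable (h : Γ.IsManifoldRealization R P) [Finite V] [FiniteDimensional ℝ E]
include h

/-- A path with alternating colours `c` and last has two ends. Geometrically: at an interior point
of a face of codimension one of the boundary where k boundary facets meet, the local value of the
boundary is (-1)^n (k - 1). It is (-1)^n because the boundary is a manifold without boundary, so k =
2. The assumption `0 < n` makes this face nonempty. -/
theorem IsManifoldRealization.ncard_boundary_comp (hn : 0 < n) {u : V}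
    (hu : Γ.nbr (Fin.last (n + 1)) u = u) {c : Fin (n + 2)} (hc : c ≠ Fin.last (n + 1)) :
    {w | Γ.nbr (Fin.last (n + 1)) w = w ∧
      Γ.comp {c, Fin.last (n + 1)} w = Γ.comp {c, Fin.last (n + 1)} u}.ncard = 2 := by
  classical
  let b := Fin.last (n + 1)
  let S : Finset (Fin (n + 2)) := Finset.univ.erase b
  have hbS : b ∉ S := Finset.notMem_erase _ _
  have hcS : c ∈ S := Finset.mem_erase.2 ⟨hc, Finset.mem_univ _⟩
  have hScard : S.card = n + 1 := by
    rw [Finset.card_erase_of_mem (Finset.mem_univ _)]; simp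
  have hS0card : (S.erase c).card = n := by
    rw [Finset.card_erase_of_mem hcS, hScard]; simp
  obtain ⟨x, hx, hxS⟩ := openSimplex_nonempty (S := S.erase c) (Finset.card_pos.1 (by omega))
  have hbd : R u x ∈ plBoundary (n + 1) P := by
    rw [h.mem_plBoundary_iff_isBoundaryCell hx, hxS]
    exact ⟨fun h' => hbS (Finset.mem_of_mem_erase h'), u, hu, rfl⟩
  have h1 := h.hasLocalEuler_plBoundary hbd
  rw [h.plBoundary_eq] at h1
  have h2 := h1.unique (h.real.hasLocalEuler_cells_card _ u hx)
  rw [hxS] at h2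
  have hsub : ({S, S.erase c} : Finset (Finset (Fin (n + 2)))) ⊆
      Finset.univ.filter (S.erase c ⊆ ·) := by
    intro T hT
    simp only [Finset.mem_insert, Finset.mem_singleton] at hT
    rcases hT with rfl | rfl
    · simp [Finset.erase_subset]
    · simp
  rw [← Finset.sum_subset hsub, Finset.sum_pair] at h2
  · have h3 : (fun σ : Γ.Cell (S.erase c) => Γ.IsBoundaryCell (S.erase c) σ ∧
        ∃ v, Γ.cell (S.erase c) v = σ ∧ Γ.cell (S.erase c) v = Γ.cell (S.erase c) u) =
        fun σ => σ = Γ.cell (S.erase c) u := by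
      ext σ
      constructor
      · rintro ⟨-, v, rfl, hv⟩
        exact hv
      · rintro rfl
        exact ⟨⟨fun h' => hbS (Finset.mem_of_mem_erase h'), u, hu, rfl⟩, u, rfl, rfl⟩
    have h4 : Nat.card {σ : Γ.Cell S // Γ.IsBoundaryCell S σ ∧
        ∃ v, Γ.cell S v = σ ∧ Γ.cell (S.erase c) v = Γ.cell (S.erase c) u} =
        {w | Γ.nbr b w = w ∧ Γ.comp {c, b} w = Γ.comp {c, b} u}.ncard := by
      rw [← Nat.card_coe_set_eq]
      refine (Nat.card_congr (Equiv.ofBijective (fun w => ⟨Γ.cell S w.1, ⟨hbS, w.1, w.2.1, rfl⟩,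
        w.1, rfl, Γ.cell_erase_erase_eq_iff.2 w.2.2⟩) ⟨fun v w hvw => ?_, ?_⟩)).symm
      · exact Subtype.ext (cell_erase_last_injOn w.2.1 (Subtype.ext_iff.1 hvw).symm)
      · rintro ⟨σ, ⟨-, w, hw, rfl⟩, v, hv, hr⟩
        obtain rfl := cell_erase_last_injOn hw hv.symm
        exact ⟨⟨v, hw, Γ.cell_erase_erase_eq_iff.1 hr⟩, rfl⟩
    rw [h3, h4, hScard, hS0card] at h2
    simp only [Nat.card_unique, Nat.cast_one, mul_one, pow_succ] at h2
    have h5 : (-1 : ℤ) ^ n ≠ 0 := pow_ne_zero _ (by norm_num)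
    have h6 : (-1 : ℤ) ^ n * ((({w | Γ.nbr b w = w ∧
      Γ.comp {c, b} w = Γ.comp {c, b} u}.ncard : ℕ) : ℤ) - 2) = 0 := by linarith
    have := (mul_eq_zero.1 h6).resolve_left h5
    exact_mod_cast sub_eq_zero.1 this
  · intro h'
    rw [h'] at hcS
    exact Finset.notMem_erase _ _ hcS
  · intro T hT hT'
    have hbT : b ∈ T := by
      by_contra hbT
      refine hT' ?_
      rw [Finset.mem_filter] at hT
      have hTS : T ⊆ S := fun i hi =>
        Finset.mem_erase.2 ⟨fun h' => hbT (h' ▸ hi), Finset.mem_univ _⟩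
      simp only [Finset.mem_insert, Finset.mem_singleton]
      by_cases hcT : c ∈ T
      · left
        refine subset_antisymm hTS fun i hi => ?_
        by_cases hic : i = c
        · rwa [hic]
        · exact hT.2 (Finset.mem_erase.2 ⟨hic, hi⟩)
      · right
        refine subset_antisymm (fun i hi => ?_) hT.2
        exact Finset.mem_erase.2 ⟨fun h' => hcT (h' ▸ hi), hTS hi⟩
    rw [Nat.card_eq_zero.2 (Or.inl ⟨fun σ => σ.2.1.1 hbT⟩)]
    simp

/-- The link of a boundary cell in the boundary is connected, also after its cells of
codimension two are removed. -/
theorem IsManifoldRealization.boundary_induction {S : Finset (Fin (n + 2))} (hS : S.Nonempty)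
    (hlast : Fin.last (n + 1) ∉ S) {u v : V} (hu : Γ.nbr (Fin.last (n + 1)) u = u)
    (hv : Γ.nbr (Fin.last (n + 1)) v = v) (huv : Γ.cell S u = Γ.cell S v) {p : V → Prop} (hpu : p u)
    (hp : ∀ w w' c, Γ.nbr (Fin.last (n + 1)) w = w → Γ.nbr (Fin.last (n + 1)) w' = w' → c ∉ S →
      c ≠ Fin.last (n + 1) →
      Γ.comp {c, Fin.last (n + 1)} w = Γ.comp {c, Fin.last (n + 1)} w' → p w → p w') : p v := by
  classical
  by_contra hpv
  obtain ⟨x, hx, rfl⟩ := openSimplex_nonempty hS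
  have hx0 : x (Fin.last (n + 1)) = 0 := by simpa using hlast
  have hface := (mem_simplexFace_erase hx).2 hx0
  let face : Set (Fin (n + 2) → ℝ) := {x | x (Fin.last (n + 1)) = 0}
  have hfacecl : IsClosed face := isClosed_eq (continuous_apply _) continuous_const
  let Z : Set V → Set E := fun U => {y | ∃ w ∈ U, ∃ z ∈ stdSimplex ℝ (Fin (n + 2)),
    z ∈ face ∧ R w z = y}
  have hZ : ∀ U, IsClosed (Z U) := fun U => h.real.isClosed_image U hfacecl
  have hbd : R u x ∈ plBoundary (n + 1) P := h.mem_plBoundary hu hx hx0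
  obtain ⟨N, F, G, hN, hNn, hyN, hF, hQ, hFy, hGc, hG⟩ := h.manifold.hasChart_plBoundary hbd
  have hGN : ∀ q ∈ cube n, G q ∈ N ∧ F (G q) = q := by
    intro q hq
    rw [← hQ] at hq
    obtain ⟨y', hy', rfl⟩ := hq
    rw [hG y' hy']
    exact ⟨hy', rfl⟩
  -- Cells with at most `n - 1` labels have codimension at least two in the boundary, so leaving
  -- them out keeps a ball in the chart connected.
  obtain ⟨𝓛, h𝓛, hcov⟩ := h.real.exists_affineSubspaces hF (n - 1)
  -- This closed set contains the points at which some label of the given cell has coordinate zero.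
  -- Staying away from it ensures that only faces with a missing label outside `S` are crossed.
  have hbad := h.real.isClosed_image Set.univ (C := ⋃ i ∈ supp x, {z | z i = 0})
    ((supp x).finite_toSet.isClosed_biUnion fun i _ => isClosed_eq (continuous_apply _) continuous_const)
  have hsub : {q : Fin n → ℝ | ∀ k, |q k| < 1} ⊆ cube n := fun q hq k =>
    ⟨(abs_lt.1 (hq k)).1.le, (abs_lt.1 (hq k)).2.le⟩
  have hopen : IsOpen {q : Fin n → ℝ | ∀ k, |q k| < 1} := by
    rw [Set.ofPred_forall]
    exact isOpen_iInter_of_finite fun k => isOpen_lt (continuous_apply k).abs continuous_const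
  have hW0 := (hGc.mono hsub).isOpen_inter_preimage hopen hbad.isOpen_compl
  obtain ⟨r, hr, hrW⟩ := Metric.isOpen_iff.1 hW0 0 (by
    refine ⟨by simp, ?_⟩
    rw [Set.mem_preimage, ← hFy, hG _ hyN]
    rintro ⟨w, -, z, hz, hz0, hzx⟩
    obtain ⟨rfl, -⟩ := (h.real.eq_iff hz hx).1 hzx
    simp only [Set.mem_iUnion] at hz0
    obtain ⟨i, hi, hzi⟩ := hz0
    exact mem_supp.1 hi hzi)
  have hball : Metric.ball 0 r ⊆ cube n := fun q hq => hsub (hrW hq).1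
  have hdim : ∀ L ∈ 𝓛, Module.finrank ℝ L.direction + 1 < n := fun L hL => by
    have := h𝓛 L hL
    omega
  have hconn := isPreconnected_diff_affineSubspaces Metric.isOpen_ball (convex_ball 0 r) 𝓛 hdim
  -- Near the point there are interior points of the facet of `w`. They are away from all other free
  -- facets, a finite union of closed sets, so a point in general position close to one of them lies
  -- in the facet of `w`.
  have key : ∀ w, Γ.nbr (Fin.last (n + 1)) w = w → R w x = R u x →
      ∃ q ∈ {q ∈ Metric.ball 0 r | ∀ L ∈ 𝓛, q ∉ L}, G q ∈ Z {w} := by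
    intro w hw hwx
    have ht1 : Filter.Tendsto (R w) (𝓝[simplexFace (Finset.univ.erase (Fin.last (n + 1)))] x)
        (𝓝[plBoundary (n + 1) P] (R u x)) := by
      refine tendsto_nhdsWithin_iff.2 ⟨?_, eventually_mem_nhdsWithin.mono fun z hz =>
        h.mem_plBoundary hw hz.1 ((mem_simplexFace_erase hz.1).1 hz)⟩
      rw [← hwx]
      exact ((h.real.piecewise w).continuousOn.mono (fun z hz => hz.1)) x hface
    have ht2 : Filter.Tendsto F (𝓝[plBoundary (n + 1) P] (R u x)) (𝓝 0) := by
      have := hF.continuousOn _ hyN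
      rw [ContinuousWithinAt, hFy] at this
      exact this.mono_left (nhdsWithin_le_of_mem hNn)
    have he1 := ht1.eventually (Filter.eventually_mem_set.2 hNn)
    have he2 := (ht2.comp ht1).eventually (Metric.ball_mem_nhds 0 hr)
    have hfr : ∃ᶠ z in 𝓝[simplexFace (Finset.univ.erase (Fin.last (n + 1)))] x,
        z ∈ openSimplex (Finset.univ.erase (Fin.last (n + 1))) := by
      rw [frequently_nhdsWithin_iff]
      have h1 := simplexFace_subset_closure_openSimplex (erase_nonempty (Fin.last (n + 1))) hface
      rw [mem_closure_iff_frequently] at h1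
      exact h1.mono fun z hz => ⟨hz, (mem_simplexFace_iff hz.1).2 hz.2.le⟩
    obtain ⟨z, hz, hzN, hzW⟩ := (hfr.and_eventually (he1.and he2)).exists
    have hW1 := (hGc.mono hball).isOpen_inter_preimage Metric.isOpen_ball
      (hZ {w' | Γ.nbr (Fin.last (n + 1)) w' = w' ∧ w' ≠ w}).isOpen_compl
    obtain ⟨q, ⟨hq1, hq2⟩, hq3⟩ := exists_mem_forall_notMem_affineSubspace hW1 ⟨F (R w z), hzW, by
      rw [Set.mem_preimage, hG _ hzN]
      rintro ⟨w', ⟨hw'1, hw'2⟩, z', hz', -, hzz⟩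
      obtain ⟨rfl, h2⟩ := (h.real.eq_iff hz' hz.1).1 hzz
      rw [hz.2] at h2
      exact hw'2 (cell_erase_last_injOn hw'1 h2).symm⟩ 𝓛 (fun L hL => by
        have := hdim L hL
        omega)
    refine ⟨q, ⟨hq1, hq3⟩, ?_⟩
    obtain ⟨w', hw', z', hz', hz'0, hzq⟩ := h.mem_plBoundary_iff.1 (hN (hGN q (hball hq1)).1)
    by_cases hww : w' = w
    · exact ⟨w', hww, z', hz', hz'0, hzq⟩
    · exact absurd ⟨w', ⟨hw', hww⟩, z', hz', hz'0, hzq⟩ hq2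
  have hvx : R v x = R u x := (h.real.eq_iff hx hx).2 ⟨rfl, huv.symm⟩
  obtain ⟨qu, hqu, hGu⟩ := key u hu rfl
  obtain ⟨qv, hqv, hGv⟩ := key v hv hvx
  -- If `p` failed at `v`, the facets with and without `p` would give two closed sets covering the
  -- connected punctured ball and both meeting it. They would then meet at a point of the punctured
  -- ball.
  let U : Set V := {w | Γ.nbr (Fin.last (n + 1)) w = w ∧ p w}
  let U' : Set V := {w | Γ.nbr (Fin.last (n + 1)) w = w ∧ ¬ p w}
  have hcube : IsClosed (cube n) := by rw [cube_eq_Icc]; exact isClosed_Icc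
  have hmono : ∀ {A B : Set V}, A ⊆ B → Z A ⊆ Z B := by
    rintro A B hAB y ⟨w, hw, hy⟩
    exact ⟨w, hAB hw, hy⟩
  obtain ⟨q, hq, ⟨hq1, hq2⟩, -, hq3⟩ := isPreconnected_closed_iff.1 hconn
    (cube n ∩ G ⁻¹' Z U) (cube n ∩ G ⁻¹' Z U') (hGc.preimage_isClosed_of_isClosed hcube (hZ U))
    (hGc.preimage_isClosed_of_isClosed hcube (hZ U')) (by
      intro q hq
      have hqc := hball hq.1
      obtain ⟨w, hw, z, hz, hz0, hzq⟩ := h.mem_plBoundary_iff.1 (hN (hGN q hqc).1)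
      by_cases hpw : p w
      · exact Or.inl ⟨hqc, w, ⟨hw, hpw⟩, z, hz, hz0, hzq⟩
      · exact Or.inr ⟨hqc, w, ⟨hw, hpw⟩, z, hz, hz0, hzq⟩)
    ⟨qu, hqu, hball hqu.1, hmono (Set.singleton_subset_iff.2 (show u ∈ U from ⟨hu, hpu⟩)) hGu⟩
    ⟨qv, hqv, hball hqv.1, hmono (Set.singleton_subset_iff.2 (show v ∈ U' from ⟨hv, hpv⟩)) hGv⟩
  obtain ⟨w, ⟨hw, hpw⟩, z, hz, hz0, hzq⟩ := hq2
  obtain ⟨w', ⟨hw', hpw'⟩, z', hz', hz'0, hzq'⟩ := hq3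
  obtain ⟨rfl, hcell⟩ := (h.real.eq_iff hz hz').1 (hzq.trans hzq'.symm)
  -- The common point avoids the codimension two cells, so it lies inside a facet, where `w' = w`,
  -- or inside a face of codimension one, where the two facets are adjacent for some colour `c`.
  have hcard : n ≤ (supp z).card := by
    by_contra hlt
    obtain ⟨hqN, hqF⟩ := hGN q hq1
    rw [← hzq] at hqN hqF
    obtain ⟨L, hL, hzL⟩ := hcov w z hz (by omega) hqN
    rw [hqF] at hzL
    exact hq.2 L hL hzL
  have hlz : Fin.last (n + 1) ∉ supp z := fun h' => mem_supp.1 h' hz0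
  by_cases hfull : supp z = Finset.univ.erase (Fin.last (n + 1))
  · rw [hfull] at hcell
    rw [cell_erase_last_injOn hw hcell] at hpw'
    exact hpw' hpw
  · obtain ⟨c, hcl, hcz⟩ : ∃ c, c ≠ Fin.last (n + 1) ∧ c ∉ supp z := by
      by_contra! hcon
      refine hfull (subset_antisymm (fun i hi => Finset.mem_erase.2 ⟨?_, Finset.mem_univ _⟩)
        fun i hi => hcon i (Finset.ne_of_mem_erase hi))
      rintro rfl
      exact hlz hi
    have hzeq : supp z = (Finset.univ.erase (Fin.last (n + 1))).erase c := by
      refine Finset.eq_of_subset_of_card_le (fun i hi => ?_) ?_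
      · rw [Finset.mem_erase, Finset.mem_erase]
        refine ⟨?_, ?_, Finset.mem_univ _⟩
        · rintro rfl; exact hcz hi
        · rintro rfl; exact hlz hi
      · rw [Finset.card_erase_of_mem (Finset.mem_erase.2 ⟨hcl, Finset.mem_univ _⟩),
          Finset.card_erase_of_mem (Finset.mem_univ _)]
        simpa using hcard
    rw [hzeq, Γ.cell_erase_erase_eq_iff] at hcell
    refine hpw' (hp w w' c hw hw' (fun hcx => ?_) hcl hcell hpw)
    refine (hrW hq.1).2 ⟨w, trivial, z, hz, ?_, hzq⟩
    simp only [Set.mem_iUnion]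
    exact ⟨c, hcx, by simpa using hcz⟩

end ColoredGraph
end

noncomputable section

/-! ## Generating sets of fundamental groups -/

/-- A family of objects on the vertices of a connected graph that is compatible with the transport
along the edges of a spanning tree. -/
theorem exists_spanning_family {W A : Type*} [Finite W] [Finite A] (s t : A → W)
    {Q : W → Type*} (θ : ∀ e, Q (s e) ≃ Q (t e)) (r : W) (q₀ : Q r)
    (hconn : ∀ U : Set W, r ∈ U → (∀ e, s e ∈ U ↔ t e ∈ U) → U = Set.univ) :
    ∃ a : ∀ w, Q w, a r = q₀ ∧ ∃ T : Finset A, Nat.card W ≤ T.card + 1 ∧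
      ∀ e ∈ T, θ e (a (s e)) = a (t e) := by
  classical
  have := Fintype.ofFinite W
  have hne : ∀ w, Nonempty (Q w) := by
    have := hconn {w | Nonempty (Q w)} ⟨q₀⟩ fun e => ⟨fun h => h.map (θ e), fun h => h.map (θ e).symm⟩
    intro w
    exact this.ge (Set.mem_univ w)
  -- A tree grows by one edge at a time. As long as `U` is not everything, some edge has just one
  -- end in `U`, and the object at its new end is defined by transport along this edge, forwards or
  -- backwards.
  have key : ∀ k, k + 1 ≤ Nat.card W → ∃ U : Finset W, U.card = k + 1 ∧ r ∈ U ∧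
      ∃ a : ∀ w, Q w, a r = q₀ ∧ ∃ T : Finset A, T.card = k ∧
        ∀ e ∈ T, s e ∈ U ∧ t e ∈ U ∧ θ e (a (s e)) = a (t e) := by
    intro k
    induction k with
    | zero =>
      intro _
      refine ⟨{r}, by simp, by simp, Function.update (fun w => (hne w).some) r q₀, by simp, ∅, by simp,
        by simp⟩
    | succ k ih =>
      intro hk
      obtain ⟨U, hU, hr, a, ha, T, hT, hTa⟩ := ih (by omega)
      have hex : ∃ e, ¬ (s e ∈ U ↔ t e ∈ U) := by
        by_contra! hcon
        have h1 := hconn U (by exact_mod_cast hr) (fun e => by exact_mod_cast hcon e)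
        have h2 : U = Finset.univ := by exact_mod_cast h1
        rw [h2, Finset.card_univ, ← Nat.card_eq_fintype_card] at hU
        omega
      obtain ⟨e, he⟩ := hex
      have heT : e ∉ T := fun h => he ⟨fun _ => (hTa e h).2.1, fun _ => (hTa e h).1⟩
      by_cases hs : s e ∈ U
      · have ht : t e ∉ U := fun h => he ⟨fun _ => h, fun _ => hs⟩
        have hsub : ∀ w ∈ U, w ≠ t e := fun w hw h => ht (h ▸ hw)
        refine ⟨insert (t e) U, by rw [Finset.card_insert_of_notMem ht, hU],
          Finset.mem_insert_of_mem hr, Function.update a (t e) (θ e (a (s e))), ?_,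
          insert e T, by rw [Finset.card_insert_of_notMem heT, hT], fun e' he' => ?_⟩
        · rw [Function.update_of_ne (hsub r hr), ha]
        · rcases Finset.mem_insert.1 he' with rfl | he'
          · refine ⟨Finset.mem_insert_of_mem hs, Finset.mem_insert_self _ _, ?_⟩
            rw [Function.update_of_ne (hsub _ hs), Function.update_self]
          · obtain ⟨h1, h2, h3⟩ := hTa e' he'
            refine ⟨Finset.mem_insert_of_mem h1, Finset.mem_insert_of_mem h2, ?_⟩
            rw [Function.update_of_ne (hsub _ h1), Function.update_of_ne (hsub _ h2), h3]
      · have ht : t e ∈ U := by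
          by_contra h
          exact he ⟨fun h' => absurd h' hs, fun h' => absurd h' h⟩
        have hsub : ∀ w ∈ U, w ≠ s e := fun w hw h => hs (h ▸ hw)
        refine ⟨insert (s e) U, by rw [Finset.card_insert_of_notMem hs, hU],
          Finset.mem_insert_of_mem hr, Function.update a (s e) ((θ e).symm (a (t e))), ?_,
          insert e T, by rw [Finset.card_insert_of_notMem heT, hT], fun e' he' => ?_⟩
        · rw [Function.update_of_ne (hsub r hr), ha]
        · rcases Finset.mem_insert.1 he' with rfl | he'
          · refine ⟨Finset.mem_insert_self _ _, Finset.mem_insert_of_mem ht, ?_⟩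
            rw [Function.update_of_ne (hsub _ ht), Function.update_self, Equiv.apply_symm_apply]
          · obtain ⟨h1, h2, h3⟩ := hTa e' he'
            refine ⟨Finset.mem_insert_of_mem h1, Finset.mem_insert_of_mem h2, ?_⟩
            rw [Function.update_of_ne (hsub _ h1), Function.update_of_ne (hsub _ h2), h3]
  have hpos : 0 < Nat.card W := by
    have : Nonempty W := ⟨r⟩
    exact Nat.card_pos
  obtain ⟨U, -, -, a, ha, T, hT, hTa⟩ := key (Nat.card W - 1) (by omega)
  exact ⟨a, ha, T, by omega, fun e he => (hTa e he).2.2⟩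

/-- A connected graph has at most one vertex more than edges. -/
theorem card_le_card_edges_add_one {W A : Type*} [Finite W] [Finite A] (s t : A → W) (r : W)
    (hconn : ∀ U : Set W, r ∈ U → (∀ e, s e ∈ U ↔ t e ∈ U) → U = Set.univ) :
    Nat.card W ≤ Nat.card A + 1 := by
  have := Fintype.ofFinite A
  obtain ⟨-, -, T, hT, -⟩ := exists_spanning_family s t (Q := fun _ => Unit)
    (fun _ => Equiv.refl _) r () hconn
  have := T.card_le_univ
  rw [Nat.card_eq_fintype_card (α := A)]
  omega

section Homotopy

open unitInterval

variable {X : Type*} [TopologicalSpace X]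

/-- The two ways around a square are homotopic. -/
theorem trans_eq_trans_of_square (K : C(I × I, X)) {a b c e : X} {p : Path a b} {r : Path b e}
    {l : Path a c} {q : Path c e} (hp : ∀ s, p s = K (s, 0)) (hr : ∀ s, r s = K (1, s))
    (hl : ∀ s, l s = K (0, s)) (hq : ∀ s, q s = K (s, 1)) :
    (Path.Homotopic.Quotient.mk p).trans (.mk r) = (Path.Homotopic.Quotient.mk l).trans (.mk q) := by
  obtain rfl : K (0, 0) = a := by rw [← hp, p.source]
  obtain rfl : K (1, 0) = b := by rw [← hp, p.target]
  obtain rfl : K (0, 1) = c := by rw [← hl, l.target]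
  obtain rfl : K (1, 1) = e := by rw [← hr, r.target]
  have : ContractibleSpace I := (convex_Icc (0 : ℝ) 1).contractibleSpace ⟨0, by simp⟩
  let i : Path (0 : I) 1 := ⟨⟨id, continuous_id⟩, rfl, rfl⟩
  have h1 := SimplyConnectedSpace.paths_homotopic
    ((i.prod (Path.refl (0 : I))).trans ((Path.refl (1 : I)).prod i))
    (((Path.refl (0 : I)).prod i).trans (i.prod (Path.refl (1 : I))))
  have h2 := h1.map K
  rw [Path.map_trans, Path.map_trans] at h2
  rw [← Path.Homotopic.Quotient.mk_trans, ← Path.Homotopic.Quotient.mk_trans, Path.Homotopic.Quotient.eq]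
  convert h2 <;> ext s
  · exact hp s
  · exact hr s
  · exact hl s
  · exact hq s

/-- A property of classes of paths with a fixed origin that is preserved under extension by paths
inside the members of an open cover is preserved under extension by arbitrary paths. -/
theorem extend_of_openCover {x₀ : X} {G : ∀ q, Path.Homotopic.Quotient x₀ q → Prop} {ι : Type*}
    {c : ι → Set X} (hc : ∀ i, IsOpen (c i)) (hcov : ∀ q, ∃ i, q ∈ c i)
    (hG : ∀ i, ∀ {a b : X} (γ : Path.Homotopic.Quotient x₀ a) (δ : Path a b), (∀ s, δ s ∈ c i) → G a γ →
      G b (γ.trans (.mk δ))) {a b : X} (γ : Path.Homotopic.Quotient x₀ a) (δ : Path a b) (hγ : G a γ) :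
    G b (γ.trans (.mk δ)) := by
  obtain ⟨t, ht0, htm, ⟨N, hN⟩, ht⟩ := exists_monotone_Icc_subset_open_cover_unitInterval
    (c := fun i => δ ⁻¹' c i) (fun i => (hc i).preimage δ.continuous) (fun s _ => by
      obtain ⟨i, hi⟩ := hcov (δ s)
      exact Set.mem_iUnion.2 ⟨i, hi⟩)
  have key : ∀ n, G (δ (t n)) (γ.trans (.mk ((δ.subpath 0 (t n)).cast δ.source.symm rfl))) := by
    intro n
    induction n with
    | zero =>
      have h1 : ∀ (q : X) (ε : Path a q) (h : q = a), (∀ s, ε s = a) → G q (γ.trans (.mk ε)) := by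
        rintro q ε rfl hε
        have : ε = Path.refl q := by ext s; exact hε s
        rw [this, Path.Homotopic.Quotient.mk_refl, Path.Homotopic.Quotient.trans_refl]
        exact hγ
      refine h1 _ _ (by rw [ht0, δ.source]) fun s => ?_
      simp [ht0, Path.subpath]
    | succ n ih =>
      obtain ⟨i, hi⟩ := ht n
      have h1 := hG i _ (δ.subpath (t n) (t (n + 1))) (fun s => by
        have : δ.subpath (t n) (t (n + 1)) s ∈ Set.range (δ.subpath (t n) (t (n + 1))) := ⟨s, rfl⟩
        rw [Path.range_subpath_of_le _ _ _ (htm n.le_succ)] at this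
        obtain ⟨s', hs', h⟩ := this
        rw [← h]
        exact hi hs') ih
      rw [Path.Homotopic.Quotient.trans_assoc, ← Path.Homotopic.Quotient.mk_trans] at h1
      convert h1 using 2
      rw [Path.Homotopic.Quotient.eq]
      have h2 : ((δ.subpath 0 (t n)).trans (δ.subpath (t n) (t (n + 1)))).Homotopic
        (δ.subpath 0 (t (n + 1))) := ⟨Path.Homotopy.subpathTransSubpath δ _ _ _⟩
      exact h2.symm.pathCast δ.source.symm rfl
  have h1 : ∀ (q : X) (ε : Path a q) (h : q = b), (∀ s, ε s = δ s) → G q (γ.trans (.mk ε)) →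
      G b (γ.trans (.mk δ)) := by
    rintro q ε rfl hε
    have : ε = δ := by ext s; exact hε s
    rw [this]
    exact id
  refine h1 _ _ (by rw [hN N le_rfl, δ.target]) (fun s => ?_) (key N)
  simp [hN N le_rfl, Path.subpath]

variable {x₀ : X}

/-- Two classes of paths with the same ends are equivalent modulo a subgroup of the fundamental
group at the origin. -/
def RelMod (H : Subgroup (FundamentalGroup X x₀)) {q : X} (γ γ' : Path.Homotopic.Quotient x₀ q) : Prop :=
  ∃ h ∈ H, γ = (FundamentalGroup.toPath h).trans γ'

theorem RelMod.refl (H : Subgroup (FundamentalGroup X x₀)) {q : X} (γ : Path.Homotopic.Quotient x₀ q) :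
    RelMod H γ γ :=
  ⟨1, H.one_mem, (Path.Homotopic.Quotient.refl_trans γ).symm⟩

theorem RelMod.symm {H : Subgroup (FundamentalGroup X x₀)} {q : X} {γ γ' : Path.Homotopic.Quotient x₀ q}
    (h : RelMod H γ γ') : RelMod H γ' γ := by
  obtain ⟨h, hh, rfl⟩ := h
  refine ⟨h⁻¹, H.inv_mem hh, ?_⟩
  rw [← Path.Homotopic.Quotient.trans_assoc]
  exact ((congrArg (fun z => Path.Homotopic.Quotient.trans z γ') (Path.Homotopic.Quotient.symm_trans (FundamentalGroup.toPath h))).trans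
    (Path.Homotopic.Quotient.refl_trans γ')).symm

theorem RelMod.trans {H : Subgroup (FundamentalGroup X x₀)} {q : X} {γ γ' γ'' : Path.Homotopic.Quotient x₀ q}
    (h : RelMod H γ γ') (h' : RelMod H γ' γ'') : RelMod H γ γ'' := by
  obtain ⟨h, hh, rfl⟩ := h
  obtain ⟨h', hh', rfl⟩ := h'
  exact ⟨h' * h, H.mul_mem hh' hh, (Path.Homotopic.Quotient.trans_assoc _ _ _).symm⟩

theorem RelMod.extend {H : Subgroup (FundamentalGroup X x₀)} {q q' : X} {γ γ' : Path.Homotopic.Quotient x₀ q}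
    (h : RelMod H γ γ') (δ : Path.Homotopic.Quotient q q') : RelMod H (γ.trans δ) (γ'.trans δ) := by
  obtain ⟨h, hh, rfl⟩ := h
  exact ⟨h, hh, Path.Homotopic.Quotient.trans_assoc _ _ _⟩

theorem RelMod.mem {H : Subgroup (FundamentalGroup X x₀)} {h : FundamentalGroup X x₀}
    (hh : RelMod H (FundamentalGroup.toPath h) (Path.Homotopic.Quotient.refl x₀)) : h ∈ H := by
  obtain ⟨h', hh', h1⟩ := hh
  rw [Path.Homotopic.Quotient.trans_refl] at h1
  exact (show h = h' from h1) ▸ hh'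

end Homotopy
end

noncomputable section
set_option linter.unusedSectionVars false

/-! ## Generators of the fundamental group of the complex of a graph -/

open unitInterval

section Segments

variable {κ : Type*} [Fintype κ]

/-- The point at the parameter `s` of the segment between two points of the standard simplex. -/
def segPoint (x y : stdSimplex ℝ κ) (s : I) : stdSimplex ℝ κ :=
  ⟨AffineMap.lineMap x.1 y.1 (s : ℝ), (convex_stdSimplex ℝ κ).lineMap_mem x.2 y.2 s.2⟩

theorem segPoint_apply (x y : stdSimplex ℝ κ) (s : I) (k : κ) :
    (segPoint x y s).1 k = (1 - s) * x.1 k + s * y.1 k := by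
  simp [segPoint, AffineMap.lineMap_apply]
  ring

@[simp] theorem segPoint_zero (x y : stdSimplex ℝ κ) : segPoint x y 0 = x := by
  ext k; simp [segPoint]

@[simp] theorem segPoint_one (x y : stdSimplex ℝ κ) : segPoint x y 1 = y := by
  ext k; simp [segPoint]

theorem continuous_segPoint {Z : Type*} [TopologicalSpace Z] {f g : Z → stdSimplex ℝ κ} {s : Z → I}
    (hf : Continuous f) (hg : Continuous g) (hs : Continuous s) :
    Continuous fun z => segPoint (f z) (g z) (s z) := by
  refine Continuous.subtype_mk (continuous_pi fun k => ?_) _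
  have h1 : ∀ z, AffineMap.lineMap (f z).1 (g z).1 (s z : ℝ) k =
      (1 - s z) * (f z).1 k + s z * (g z).1 k := fun z => segPoint_apply _ _ _ _
  simp only [h1]
  have hf' : Continuous fun z => (f z).1 k := (continuous_apply k).comp (continuous_subtype_val.comp hf)
  have hg' : Continuous fun z => (g z).1 k := (continuous_apply k).comp (continuous_subtype_val.comp hg)
  have hs' : Continuous fun z => (s z : ℝ) := continuous_subtype_val.comp hs
  fun_prop

/-- The segment between two points of the standard simplex. -/
def segPath (x y : stdSimplex ℝ κ) : Path x y where
  toFun := segPoint x y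
  continuous_toFun := continuous_segPoint continuous_const continuous_const continuous_id
  source' := segPoint_zero x y
  target' := segPoint_one x y

variable [DecidableEq κ]

/-- A vertex of the standard simplex. -/
def vert (a : κ) : stdSimplex ℝ κ := ⟨Pi.single a 1, single_mem_stdSimplex ℝ a⟩

@[simp] theorem supp_vert (a : κ) : supp (vert a).1 = {a} := by
  ext k
  by_cases h : k = a
  · subst h; simp [vert]
  · simp [vert, h]

theorem vert_apply_of_ne {a c : κ} (h : c ≠ a) : (vert a).1 c = 0 := by
  simp [vert, h]

end Segments

namespace ColoredGraph

variable {d : ℕ} {V : Type} (Γ : ColoredGraph d V)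

/-- The point of the carrier at a vertex of the complex. -/
def vtx (a : Fin (d + 1)) (w : Γ.Cell {a}) : Γ.Carrier := Γ.charMap (Γ.rep w) (vert a)

theorem charMap_vert (u : V) (a : Fin (d + 1)) :
    Γ.charMap u (vert a) = Γ.vtx a (Γ.cell {a} u) := by
  rw [vtx, charMap_eq_iff, supp_vert]
  exact ⟨rfl, (Γ.comp_rep _).symm⟩

theorem charMap_nbr {c : Fin (d + 1)} (u : V) {x : stdSimplex ℝ (Fin (d + 1))} (hx : x.1 c = 0) :
    Γ.charMap (Γ.nbr c u) x = Γ.charMap u x := by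
  rw [charMap_eq_iff]
  exact ⟨rfl, Γ.cell_nbr (by simpa using hx) u⟩

variable {Γ}

/-- The class of the image of a segment in the simplex of a vertex. -/
def lineClass (u : V) (x y : stdSimplex ℝ (Fin (d + 1))) {q q' : Γ.Carrier} (h : Γ.charMap u x = q)
    (h' : Γ.charMap u y = q') : Path.Homotopic.Quotient q q' :=
  .mk (((segPath x y).map (Γ.continuous_charMap u)).cast h.symm h'.symm)

theorem lineClass_trans (u : V) (x y z : stdSimplex ℝ (Fin (d + 1))) {q q' q'' : Γ.Carrier}
    (h : Γ.charMap u x = q) (h' : Γ.charMap u y = q') (h'' : Γ.charMap u z = q'') :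
    (lineClass u x y h h').trans (lineClass u y z h' h'') = lineClass u x z h h'' := by
  subst h h' h''
  have : ContractibleSpace (stdSimplex ℝ (Fin (d + 1))) :=
    (convex_stdSimplex ℝ _).contractibleSpace ⟨_, x.2⟩
  have h1 := (SimplyConnectedSpace.paths_homotopic ((segPath x y).trans (segPath y z))
    (segPath x z)).map ⟨_, Γ.continuous_charMap u⟩
  rw [Path.map_trans] at h1
  exact Path.Homotopic.Quotient.eq.2 h1

theorem lineClass_self (u : V) (x : stdSimplex ℝ (Fin (d + 1))) {q : Γ.Carrier}
    (h : Γ.charMap u x = q) : lineClass u x x h h = Path.Homotopic.Quotient.refl q := by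
  subst h
  have : ContractibleSpace (stdSimplex ℝ (Fin (d + 1))) :=
    (convex_stdSimplex ℝ _).contractibleSpace ⟨_, x.2⟩
  exact Path.Homotopic.Quotient.eq.2 ((SimplyConnectedSpace.paths_homotopic (segPath x x)
    (Path.refl x)).map ⟨_, Γ.continuous_charMap u⟩)

theorem lineClass_nbr {c : Fin (d + 1)} (u : V) {x y : stdSimplex ℝ (Fin (d + 1))} {q q' : Γ.Carrier}
    (hx : x.1 c = 0) (hy : y.1 c = 0) (h : Γ.charMap u x = q) (h' : Γ.charMap u y = q')
    (k : Γ.charMap (Γ.nbr c u) x = q) (k' : Γ.charMap (Γ.nbr c u) y = q') :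
    lineClass u x y h h' = lineClass (Γ.nbr c u) x y k k' := by
  refine congrArg _ (Path.ext (funext fun s => ?_))
  exact (Γ.charMap_nbr u (by
    rw [show (segPath x y s).1 c = _ from segPoint_apply x y s c, hx, hy]; ring)).symm

variable {x₀ : Γ.Carrier} {a : Fin (d + 1)}

/-- The class of a path through the vertex with label `a` of the simplex of `u`. -/
def reach (α : ∀ w, Path.Homotopic.Quotient x₀ (Γ.vtx a w)) (u : V) (x : stdSimplex ℝ (Fin (d + 1)))
    {q : Γ.Carrier} (h : Γ.charMap u x = q) : Path.Homotopic.Quotient x₀ q :=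
  (α (Γ.cell {a} u)).trans (lineClass u (vert a) x (Γ.charMap_vert u a) h)

theorem reach_trans (α : ∀ w, Path.Homotopic.Quotient x₀ (Γ.vtx a w)) (u : V)
    (x y : stdSimplex ℝ (Fin (d + 1))) {q q' : Γ.Carrier} (h : Γ.charMap u x = q)
    (h' : Γ.charMap u y = q') : (reach α u x h).trans (lineClass u x y h h') = reach α u y h' := by
  rw [reach, Path.Homotopic.Quotient.trans_assoc, lineClass_trans, reach]

theorem reach_eq (α : ∀ w, Path.Homotopic.Quotient x₀ (Γ.vtx a w)) (u : V)
    (x : stdSimplex ℝ (Fin (d + 1))) {q : Γ.Carrier} (h : Γ.charMap u x = q) {w : Γ.Cell {a}}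
    (hw : Γ.cell {a} u = w) : reach α u x h =
      (α w).trans (lineClass u (vert a) x ((Γ.charMap_vert u a).trans (by rw [hw])) h) := by
  subst hw
  rfl

/-- For `c ≠ a` the simplices of `u` and `nbr c u` share the vertex labelled `a` as well as the
point `x`, and hence the whole segment. -/
theorem reach_nbr (α : ∀ w, Path.Homotopic.Quotient x₀ (Γ.vtx a w)) {c : Fin (d + 1)} (hc : c ≠ a)
    (u : V) {x : stdSimplex ℝ (Fin (d + 1))} (hx : x.1 c = 0) {q : Γ.Carrier}
    (h : Γ.charMap u x = q) (h' : Γ.charMap (Γ.nbr c u) x = q) :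
    reach α u x h = reach α (Γ.nbr c u) x h' := by
  rw [reach_eq α (Γ.nbr c u) x h' (Γ.cell_nbr (by simpa using hc) u), reach]
  congr 1
  exact lineClass_nbr u (vert_apply_of_ne hc) hx _ _ _ _

section TwoLabels

variable {b : Fin (d + 1)} (hab : a ≠ b) {H : Subgroup (FundamentalGroup Γ.Carrier x₀)}
  {α : ∀ w, Path.Homotopic.Quotient x₀ (Γ.vtx a w)} {β : ∀ w, Path.Homotopic.Quotient x₀ (Γ.vtx b w)}
  (hαβ : ∀ u, RelMod H (reach α u (vert b) (Γ.charMap_vert u b)) (β (Γ.cell {b} u)))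

include hαβ in
theorem relMod_reach_reach (u : V) (x : stdSimplex ℝ (Fin (d + 1))) {q : Γ.Carrier}
    (h : Γ.charMap u x = q) : RelMod H (reach α u x h) (reach β u x h) := by
  rw [← reach_trans α u (vert b) x (Γ.charMap_vert u b)]
  exact (hαβ u).extend _

-- Two labels suffice to compare all simplices containing a point. Crossing an edge of colour `c ≠
-- a` keeps the path through the vertex labelled `a`; crossing colour `a` keeps the path through the
-- vertex labelled `b`, which agrees with the former modulo `H`.
include hab hαβ in
theorem relMod_reach {u v : V} {x y : stdSimplex ℝ (Fin (d + 1))} {q : Γ.Carrier}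
    (hu : Γ.charMap u x = q) (hv : Γ.charMap v y = q) :
    RelMod H (reach α u x hu) (reach α v y hv) := by
  obtain ⟨rfl, h1⟩ := Γ.charMap_eq_iff.1 (hu.trans hv.symm)
  obtain ⟨hw, h⟩ := Γ.comp_eq_induction h1
    (p := fun w => ∃ hw : Γ.charMap w x = q, RelMod H (reach α u x hu) (reach α w x hw))
    ⟨hu, RelMod.refl _ _⟩ (by
      rintro w c hc ⟨hw, hrel⟩
      have hxc : x.1 c = 0 := by simpa using hc
      have hw' := (Γ.charMap_nbr w hxc).trans hw
      refine ⟨hw', hrel.trans ?_⟩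
      by_cases hca : c = a
      · have hcb : c ≠ b := by rw [hca]; exact hab
        refine (relMod_reach_reach hαβ w x hw).trans ?_
        rw [reach_nbr β hcb w hxc hw hw']
        exact (relMod_reach_reach hαβ _ x hw').symm
      · rw [reach_nbr α hca w hxc hw hw']
        exact RelMod.refl _ _)
  exact h

end TwoLabels

/-- The factor of the contraction towards the vertices with label `a`. -/
def slideFactor (a : Fin (d + 1)) (x : stdSimplex ℝ (Fin (d + 1))) : I :=
  ⟨min 1 ((d + 2) * x.1 a), le_min zero_le_one (mul_nonneg (by positivity) (x.2.1 a)), min_le_left _ _⟩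

theorem continuous_slideFactor (a : Fin (d + 1)) :
    Continuous (slideFactor a) := by
  refine Continuous.subtype_mk ?_ _
  have : Continuous fun x : stdSimplex ℝ (Fin (d + 1)) => x.1 a :=
    (continuous_apply a).comp continuous_subtype_val
  exact continuous_const.min (continuous_const.mul this)

variable (Γ) in
/-- The contraction of the carrier towards its vertices with label `a`. -/
def slide (a : Fin (d + 1)) (p : Γ.Carrier × I) : Γ.Carrier :=
  Quot.lift (fun z : (Σ _ : V, stdSimplex ℝ (Fin (d + 1))) =>
    Γ.charMap z.1 (segPoint z.2 (vert a) (p.2 * slideFactor a z.2)))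
    (by
      rintro ⟨u, x⟩ ⟨v, y⟩ ⟨j, rfl, rfl : x = y, hx⟩
      -- Compatibility with the gluing along colour `j`: for `j = a` the slide factor is zero and
      -- the point stays in place, while for `j ≠ a` the facet opposite `j` contains the target
      -- vertex.
      refine (Γ.charMap_nbr u ?_).symm
      have hx' : x.1 j = 0 := hx
      rw [segPoint_apply, hx']
      by_cases hj : j = a
      · subst hj
        simp [slideFactor, hx']
      · simp [vert_apply_of_ne hj]) p.1

theorem slide_charMap (a : Fin (d + 1)) (u : V) (x : stdSimplex ℝ (Fin (d + 1))) (s : I) :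
    Γ.slide a (Γ.charMap u x, s) = Γ.charMap u (segPoint x (vert a) (s * slideFactor a x)) := rfl

theorem continuous_slide (a : Fin (d + 1)) : Continuous (Γ.slide a) := by
  refine (isQuotientMap_quot_mk (X := Σ _ : V, stdSimplex ℝ (Fin (d + 1)))).continuous_lift_prod_left ?_
  rw [← (Homeomorph.sigmaProdDistrib (X := fun _ : V => stdSimplex ℝ (Fin (d + 1)))
    (Y := I)).symm.isQuotientMap.continuous_iff.symm.trans Iff.rfl]
  refine continuous_sigma fun u => ?_
  refine (Γ.continuous_charMap u).comp ?_
  exact continuous_segPoint continuous_fst continuous_const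
    (continuous_snd.mul ((continuous_slideFactor a).comp continuous_fst))

variable (Γ) in
/-- A neighbourhood of a vertex of the complex. -/
def star (a : Fin (d + 1)) (w : Γ.Cell {a}) : Set Γ.Carrier :=
  {q | ∃ u x, Γ.charMap u x = q ∧ Γ.cell {a} u = w ∧ 1 < (d + 2) * x.1 a}

theorem isOpen_star (a : Fin (d + 1)) (w : Γ.Cell {a}) : IsOpen (Γ.star a w) := by
  refine (isQuotientMap_quot_mk (X := Σ _ : V, stdSimplex ℝ (Fin (d + 1)))).isOpen_preimage.1 ?_
  refine isOpen_sigma_iff.2 fun u => ?_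
  have hc : Continuous fun x : stdSimplex ℝ (Fin (d + 1)) => x.1 a :=
    (continuous_apply a).comp continuous_subtype_val
  have h1 : IsOpen {x : stdSimplex ℝ (Fin (d + 1)) | Γ.cell {a} u = w ∧ 1 < (d + 2) * x.1 a} := by
    by_cases hu : Γ.cell {a} u = w
    · simp only [hu, true_and]
      exact isOpen_lt continuous_const (continuous_const.mul hc)
    · simp [hu]
  convert h1 using 1
  ext x
  constructor
  · rintro ⟨v, y, hvy, hv, hy⟩
    obtain ⟨rfl, h2⟩ := Γ.charMap_eq_iff.1 hvy
    refine ⟨?_, hy⟩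
    rw [← hv]
    refine (Γ.cell_mono ?_ h2).symm
    rw [Finset.singleton_subset_iff, mem_supp]
    intro h0
    rw [h0] at hy
    norm_num at hy
  · rintro ⟨hu, hx⟩
    exact ⟨u, x, rfl, hu, hx⟩

theorem exists_mem_star (q : Γ.Carrier) : ∃ p : Σ a, Γ.Cell {a}, q ∈ Γ.star p.1 p.2 := by
  obtain ⟨u, x, rfl⟩ := Γ.exists_charMap q
  -- The `d + 1` coordinates add up to one, so they cannot all be at most 1 / (d + 2).
  obtain ⟨a, ha⟩ : ∃ a, 1 < (d + 2) * x.1 a := by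
    by_contra! hcon
    have h1 : ∑ a, ((d : ℝ) + 2) * x.1 a ≤ ∑ _a : Fin (d + 1), (1 : ℝ) :=
      Finset.sum_le_sum fun a _ => hcon a
    rw [← Finset.mul_sum, show ∑ a, x.1 a = 1 from x.2.2] at h1
    simp at h1
  exact ⟨⟨a, Γ.cell {a} u⟩, u, x, rfl, rfl, ha⟩

theorem slideFactor_eq_one {x : stdSimplex ℝ (Fin (d + 1))} (hx : 1 < (d + 2) * x.1 a) :
    slideFactor a x = 1 :=
  Subtype.ext (min_eq_left hx.le)

/-- A path near a vertex of the complex is homotopic to a path through that vertex. -/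
theorem mk_eq_of_mem_star {w : Γ.Cell {a}} {q q' : Γ.Carrier} (δ : Path q q')
    (hδ : ∀ s, δ s ∈ Γ.star a w) : ∃ (u v : V) (x y : stdSimplex ℝ (Fin (d + 1)))
      (hu : Γ.charMap u x = q) (hv : Γ.charMap v y = q') (hu' : Γ.charMap u (vert a) = Γ.vtx a w)
      (hv' : Γ.charMap v (vert a) = Γ.vtx a w),
      .mk δ = (lineClass u x (vert a) hu hu').trans (lineClass v (vert a) y hv' hv) := by
  obtain ⟨u, x, hu, hw, hx⟩ := hδ 0
  obtain ⟨v, y, hv, hw', hy⟩ := hδ 1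
  rw [δ.source] at hu
  rw [δ.target] at hv
  have hu' : Γ.charMap u (vert a) = Γ.vtx a w := by rw [Γ.charMap_vert, hw]
  have hv' : Γ.charMap v (vert a) = Γ.vtx a w := by rw [Γ.charMap_vert, hw']
  refine ⟨u, v, x, y, hu, hv, hu', hv', ?_⟩
  -- The square moves `δ` by the contraction: one side is `δ`, the opposite one is constant at the
  -- vertex. The other two are the segments from the ends of `δ` to the vertex, because the slide
  -- factor is one on the star.
  have key := trans_eq_trans_of_square
    (K := ⟨fun p => Γ.slide a (δ p.1, p.2), (continuous_slide a).comp
      ((δ.continuous.comp continuous_fst).prodMk continuous_snd)⟩)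
    (p := δ) (r := ((segPath y (vert a)).map (Γ.continuous_charMap v)).cast hv.symm hv'.symm)
    (l := ((segPath x (vert a)).map (Γ.continuous_charMap u)).cast hu.symm hu'.symm)
    (q := Path.refl _) (fun s => ?_) (fun s => ?_) (fun s => ?_) (fun s => ?_)
  · have h1 : (Path.Homotopic.Quotient.mk δ).trans (lineClass v y (vert a) hv hv') =
        (lineClass u x (vert a) hu hu').trans (.refl _) := key
    rw [Path.Homotopic.Quotient.trans_refl] at h1
    rw [← h1, Path.Homotopic.Quotient.trans_assoc, lineClass_trans, lineClass_self,
      Path.Homotopic.Quotient.trans_refl]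
  · obtain ⟨u', x', h⟩ := Γ.exists_charMap (δ s)
    change δ s = Γ.slide a (δ s, 0)
    rw [← h, slide_charMap, zero_mul, segPoint_zero]
  · change Γ.charMap v (segPoint y (vert a) s) = Γ.slide a (δ 1, s)
    rw [δ.target, ← hv, slide_charMap, slideFactor_eq_one hy, mul_one]
  · change Γ.charMap u (segPoint x (vert a) s) = Γ.slide a (δ 0, s)
    rw [δ.source, ← hu, slide_charMap, slideFactor_eq_one hx, mul_one]
  · obtain ⟨u', x', h, hw'', hx'⟩ := hδ s
    change Γ.vtx a w = Γ.slide a (δ s, 1)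
    rw [← h, slide_charMap, slideFactor_eq_one hx', one_mul, segPoint_one, Γ.charMap_vert, hw'']

/-- Extension by a class of paths. -/
def extendEquiv {X : Type*} [TopologicalSpace X] (x₀ : X) {q q' : X}
    (δ : Path.Homotopic.Quotient q q') :
    Path.Homotopic.Quotient x₀ q ≃ Path.Homotopic.Quotient x₀ q' where
  toFun γ := γ.trans δ
  invFun γ := γ.trans δ.symm
  left_inv γ := by
    beta_reduce
    rw [Path.Homotopic.Quotient.trans_assoc, Path.Homotopic.Quotient.trans_symm,
      Path.Homotopic.Quotient.trans_refl]
  right_inv γ := by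
    beta_reduce
    rw [Path.Homotopic.Quotient.trans_assoc, Path.Homotopic.Quotient.symm_trans,
      Path.Homotopic.Quotient.trans_refl]

/-- The fundamental group of the complex of a connected graph is generated by the loops in the
graph formed by the cells with the labels `i` and `j`. -/
theorem exists_generators [Finite V] (hΓ : Γ.IsConnected) {i j : Fin (d + 1)} (hij : i ≠ j)
    (x₀ : Γ.Carrier) : ∃ S : Finset (FundamentalGroup Γ.Carrier x₀),
      Subgroup.closure (S : Set (FundamentalGroup Γ.Carrier x₀)) = ⊤ ∧
      S.card + Nat.card (Γ.Cell {i}) + Nat.card (Γ.Cell {j}) ≤ Nat.card (Γ.Cell {i, j}) + 1 := by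
  classical
  obtain ⟨u₀, z₀, hz₀⟩ := Γ.exists_charMap x₀
  -- The bipartite graph of the vertices labelled `i` and `j`, with one edge for each cell labelled
  -- `{i, j}`.
  let s : Γ.Cell {i, j} → Γ.Cell {i} ⊕ Γ.Cell {j} := fun e => Sum.inl (Γ.cell {i} (Γ.rep e))
  let t : Γ.Cell {i, j} → Γ.Cell {i} ⊕ Γ.Cell {j} := fun e => Sum.inr (Γ.cell {j} (Γ.rep e))
  let Q : Γ.Cell {i} ⊕ Γ.Cell {j} → Type := fun w =>
    Path.Homotopic.Quotient x₀ (Sum.elim (Γ.vtx i) (Γ.vtx j) w)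
  let ln : ∀ e : Γ.Cell {i, j}, Path.Homotopic.Quotient (Γ.vtx i (Γ.cell {i} (Γ.rep e)))
      (Γ.vtx j (Γ.cell {j} (Γ.rep e))) := fun e =>
    lineClass (Γ.rep e) (vert i) (vert j) (Γ.charMap_vert _ i) (Γ.charMap_vert _ j)
  let θ : ∀ e, Q (s e) ≃ Q (t e) := fun e =>
    extendEquiv x₀ (ln e)
  have hsub1 : ({i} : Finset (Fin (d + 1))) ⊆ {i, j} := by simp
  have hsub2 : ({j} : Finset (Fin (d + 1))) ⊆ {i, j} := by simp
  obtain ⟨f, hf, T, hT, hTf⟩ := exists_spanning_family s t θ (Sum.inl (Γ.cell {i} u₀))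
    (lineClass u₀ z₀ (vert i) hz₀ (Γ.charMap_vert u₀ i)) (by
      intro U hU hUst
      have h1 : ∀ u, Sum.inl (Γ.cell {i} u) ∈ U ↔ Sum.inr (Γ.cell {j} u) ∈ U := by
        intro u
        have h2 := hUst (Γ.cell {i, j} u)
        have h3 : Γ.cell {i, j} (Γ.rep (Γ.cell {i, j} u)) = Γ.cell {i, j} u := Γ.comp_rep _
        simpa only [s, t, Γ.cell_mono hsub1 h3, Γ.cell_mono hsub2 h3] using h2
      -- An edge of `Γ` with colour other than `i` keeps the vertex labelled `i`, and an edge of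
      -- colour `i` keeps the vertex labelled `j`. So the connectedness of `Γ` passes to the
      -- bipartite graph.
      have h2 : ∀ u, Sum.inl (Γ.cell {i} u) ∈ U := by
        intro u
        refine Γ.comp_eq_induction (hΓ.2 u₀ u) (p := fun u => Sum.inl (Γ.cell {i} u) ∈ U) hU ?_
        intro w c _ hw
        by_cases hc : c = i
        · have hcj : c ∉ ({j} : Finset (Fin (d + 1))) := by simpa [hc] using hij
          rw [h1, Γ.cell_nbr hcj, ← h1]
          exact hw
        · rw [Γ.cell_nbr (by simpa using hc)]
          exact hw
      rw [Set.eq_univ_iff_forall]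
      rintro (w | w)
      · obtain ⟨u, rfl⟩ := Γ.comp_surjective _ w
        exact h2 u
      · obtain ⟨u, rfl⟩ := Γ.comp_surjective _ w
        exact (h1 u).1 (h2 u))
  let α : ∀ w, Path.Homotopic.Quotient x₀ (Γ.vtx i w) := fun w => f (Sum.inl w)
  let β : ∀ w, Path.Homotopic.Quotient x₀ (Γ.vtx j w) := fun w => f (Sum.inr w)
  have := Fintype.ofFinite (Γ.Cell {i, j})
  -- The generators are the loops of the edges outside the spanning tree `T`. Since `T` has at least
  -- F(i) + F(j) - 1 edges, this gives the bound on their number.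
  let loop : Γ.Cell {i, j} → FundamentalGroup Γ.Carrier x₀ := fun e => FundamentalGroup.fromPath
    (((α (Γ.cell {i} (Γ.rep e))).trans (ln e)).trans (β (Γ.cell {j} (Γ.rep e))).symm)
  refine ⟨(Finset.univ \ T).image loop, ?_, ?_⟩
  swap
  · have h1 := Finset.card_image_le (s := Finset.univ \ T) (f := loop)
    rw [Finset.card_sdiff_of_subset (Finset.subset_univ _)] at h1
    have h2 := T.card_le_univ
    rw [Nat.card_sum] at hT
    rw [Finset.card_univ] at h1
    rw [Nat.card_eq_fintype_card (α := Γ.Cell {i, j})]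
    omega
  set H := Subgroup.closure (((Finset.univ \ T).image loop : Finset _) :
    Set (FundamentalGroup Γ.Carrier x₀)) with hH
  have hedge : ∀ e : Γ.Cell {i, j}, RelMod H ((α (Γ.cell {i} (Γ.rep e))).trans (ln e))
      (β (Γ.cell {j} (Γ.rep e))) := by
    intro e
    by_cases he : e ∈ T
    · have h1 : (α (Γ.cell {i} (Γ.rep e))).trans (ln e) = β (Γ.cell {j} (Γ.rep e)) := hTf e he
      rw [h1]
      exact RelMod.refl _ _
    · refine ⟨loop e, Subgroup.subset_closure ?_, ?_⟩
      · rw [Finset.mem_coe]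
        exact Finset.mem_image_of_mem _ (by simpa using he)
      · change _ = ((((α (Γ.cell {i} (Γ.rep e))).trans (ln e)).trans
          (β (Γ.cell {j} (Γ.rep e))).symm)).trans _
        rw [Path.Homotopic.Quotient.trans_assoc _ _ (β _), Path.Homotopic.Quotient.symm_trans,
          Path.Homotopic.Quotient.trans_refl]
  have hαβ : ∀ u, RelMod H (reach α u (vert j) (Γ.charMap_vert u j)) (β (Γ.cell {j} u)) := by
    intro u
    have h3 : Γ.cell {i, j} (Γ.rep (Γ.cell {i, j} u)) = Γ.cell {i, j} u := Γ.comp_rep _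
    refine Γ.comp_eq_induction h3 (p := fun u => RelMod H (reach α u (vert j) (Γ.charMap_vert u j))
      (β (Γ.cell {j} u))) (hedge _) ?_
    intro w c hc hw
    have hci : c ≠ i := fun h => hc (by simp [h])
    have hcj : c ≠ j := fun h => hc (by simp [h])
    have h4 : ∀ z (hz : Γ.cell {j} w = z) (h5 : Γ.charMap w (vert j) = Γ.vtx j z),
        RelMod H (reach α w (vert j) h5) (β z) := by
      rintro z rfl h5
      exact hw
    have h6 := h4 (Γ.cell {j} (Γ.nbr c w)) (Γ.cell_nbr (by simpa using hcj) w).symm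
      (by rw [Γ.cell_nbr (by simpa using hcj), Γ.charMap_vert])
    rwa [reach_nbr α hci w (vert_apply_of_ne hcj) _ (Γ.charMap_vert _ j)] at h6
  rw [eq_top_iff]
  intro g _
  -- A class satisfies `G` if modulo `H` it is the standard class through the vertex labelled `i` of
  -- some simplex at its end. This survives every path inside a star, since such a path can be
  -- replaced by two segments through the vertex of the star.
  let G : ∀ q, Path.Homotopic.Quotient x₀ q → Prop := fun q γ =>
    ∃ (u : V) (x : stdSimplex ℝ (Fin (d + 1))) (h : Γ.charMap u x = q), RelMod H γ (reach α u x h)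
  have h0 : reach α u₀ z₀ hz₀ = Path.Homotopic.Quotient.refl x₀ := by
    have hα : α (Γ.cell {i} u₀) = lineClass u₀ z₀ (vert i) hz₀ (Γ.charMap_vert u₀ i) := hf
    rw [reach, hα]
    exact (lineClass_trans _ _ _ _ _ _ _).trans (lineClass_self _ _ _)
  have hstart : G x₀ (.refl x₀) := ⟨u₀, z₀, hz₀, by rw [h0]; exact RelMod.refl _ _⟩
  have hstep : ∀ (p : Σ a, Γ.Cell {a}) {q q' : Γ.Carrier} (γ : Path.Homotopic.Quotient x₀ q)
      (δ : Path q q'), (∀ s, δ s ∈ Γ.star p.1 p.2) → G q γ → G q' (γ.trans (.mk δ)) := by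
    rintro ⟨a, w⟩ q q' γ δ hδ ⟨u', x', h', hγ⟩
    obtain ⟨u, v, x, y, hu, hv, hu', hv', h1⟩ := mk_eq_of_mem_star δ hδ
    refine ⟨v, y, hv, ?_⟩
    rw [h1, ← Path.Homotopic.Quotient.trans_assoc]
    have h2 := (hγ.trans (relMod_reach hij hαβ h' hu)).extend (lineClass u x (vert a) hu hu')
    rw [reach_trans] at h2
    have h3 := (h2.trans (relMod_reach hij hαβ hu' hv')).extend (lineClass v (vert a) y hv' hv)
    rwa [reach_trans] at h3
  induction g using Path.Homotopic.Quotient.ind with | mk δ =>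
  obtain ⟨u, x, h, hrel⟩ := extend_of_openCover (fun p : Σ a, Γ.Cell {a} => isOpen_star p.1 p.2)
    exists_mem_star hstep (.refl x₀) δ hstart
  have h5 := hrel.trans (relMod_reach hij hαβ h hz₀)
  rw [h0, Path.Homotopic.Quotient.refl_trans] at h5
  exact RelMod.mem h5

end ColoredGraph
end

noncomputable section
set_option linter.unusedSectionVars false

/-! ## The ranks of the fundamental groups of a manifold and of its double -/

theorem FundamentalGroup.mapOfEq_surjective {X Y : Type*} [TopologicalSpace X] [TopologicalSpace Y]
    (f : X ≃ₜ Y) {x : X} {y : Y} (h : f x = y) :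
    Function.Surjective (FundamentalGroup.mapOfEq (f : C(X, Y)) h) := by
  subst h
  intro p
  refine ⟨FundamentalGroup.mapOfEq (f.symm : C(Y, X)) (f.symm_apply_apply x) p, ?_⟩
  rw [FundamentalGroup.mapOfEq_apply, FundamentalGroup.mapOfEq_apply]
  induction p using Path.Homotopic.Quotient.ind with | mk p =>
  refine congrArg Path.Homotopic.Quotient.mk (Path.ext (funext fun s => ?_))
  exact f.apply_symm_apply (p s)

namespace ColoredGraph

variable {d : ℕ} {V : Type} {Γ : ColoredGraph d V}

theorem numCells_true (S : Finset (Fin (d + 1))) :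
    Γ.numCells (fun _ _ => True) S = Nat.card (Γ.Cell S) :=
  Nat.card_congr (Equiv.subtypeUnivEquiv fun _ => trivial)

/-- The bound is the number of edges outside a spanning tree of the graph with labels `i` and `j`.
-/
theorem groupRank_le_of_homeomorph [Finite V] (hΓ : Γ.IsConnected) {i j : Fin (d + 1)} (hij : i ≠ j)
    {X : Type*} [TopologicalSpace X] (f : Γ.Carrier ≃ₜ X) (x : X) :
    groupRank (FundamentalGroup X x) ≤ (((Nat.card (Γ.Cell {i, j}) : ℝ) + 1 -
      Nat.card (Γ.Cell {i}) - Nat.card (Γ.Cell {j}) : ℝ) : EReal) := by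
  classical
  obtain ⟨S, hS, hcard⟩ := exists_generators hΓ hij (f.symm x)
  let φ := FundamentalGroup.mapOfEq (f : C(Γ.Carrier, X)) (f.apply_symm_apply x)
  have h0 : groupRank (FundamentalGroup X x) ≤ ((S.image φ).card : EReal) := by
    refine sInf_le ⟨S.image φ, ?_, rfl⟩
    rw [Finset.coe_image, ← MonoidHom.map_closure, hS, ← MonoidHom.range_eq_map,
      MonoidHom.range_eq_top]
    exact FundamentalGroup.mapOfEq_surjective f _
  refine h0.trans ?_
  have h1 := Finset.card_image_le (s := S) (f := φ)
  have h2 : ((S.image φ).card : ℝ) + Nat.card (Γ.Cell {i}) + Nat.card (Γ.Cell {j}) ≤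
      Nat.card (Γ.Cell {i, j}) + 1 := by
    exact_mod_cast (by omega : (S.image φ).card + Nat.card (Γ.Cell {i}) + Nat.card (Γ.Cell {j}) ≤
      Nat.card (Γ.Cell {i, j}) + 1)
  have h3 : (((S.image φ).card : ℕ) : EReal) = (((S.image φ).card : ℝ) : EReal) := by simp
  rw [h3, EReal.coe_le_coe_iff]
  linarith

variable (Γ)

open Classical in
/-- The double of a graph: two copies, with the copies of each boundary vertex joined by an edge of
the last colour. -/
def double : ColoredGraph d (V × Bool) where
  nbr c z := if c = Fin.last d ∧ Γ.nbr (Fin.last d) z.1 = z.1 then (z.1, !z.2) else (Γ.nbr c z.1, z.2)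
  nbr_nbr c z := by
    by_cases h : c = Fin.last d ∧ Γ.nbr (Fin.last d) z.1 = z.1
    · simp [h]
    · have h' : ¬ (c = Fin.last d ∧ Γ.nbr (Fin.last d) (Γ.nbr c z.1) = Γ.nbr c z.1) := by
        rintro ⟨rfl, h1⟩
        rw [Γ.nbr_nbr] at h1
        exact h ⟨rfl, h1.symm⟩
      simp only [h, if_false, h', Γ.nbr_nbr]
  nbr_ne c z hc := by
    rw [if_neg fun h => hc h.1]
    intro h
    exact Γ.nbr_ne c z.1 hc (congrArg Prod.fst h)

variable {Γ}

theorem double_nbr_boundary {u : V} (hu : Γ.nbr (Fin.last d) u = u) (b : Bool) :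
    Γ.double.nbr (Fin.last d) (u, b) = (u, !b) := by
  simp [double, hu]

theorem double_nbr {c : Fin (d + 1)} {u : V} (h : ¬ (c = Fin.last d ∧ Γ.nbr (Fin.last d) u = u))
    (b : Bool) : Γ.double.nbr c (u, b) = (Γ.nbr c u, b) := by
  simp [double, h]

theorem double_comp {B : Set (Fin (d + 1))} {u v : V} (h : Γ.comp B u = Γ.comp B v) (b : Bool) :
    Γ.double.comp B (u, b) = Γ.double.comp B (v, b) := by
  refine Γ.comp_eq_induction h (p := fun w => Γ.double.comp B (u, b) = Γ.double.comp B (w, b)) rfl ?_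
  intro w c hc hw
  by_cases h' : c = Fin.last d ∧ Γ.nbr (Fin.last d) w = w
  · rw [h'.1, h'.2, hw]
  · rw [← double_nbr h', Γ.double.comp_nbr hc, hw]

/-- The new edge at the boundary vertex `w` joins the two copies of the component. -/
theorem double_comp_not {B : Set (Fin (d + 1))} (hB : Fin.last d ∈ B) {u w : V}
    (hw : Γ.nbr (Fin.last d) w = w) (h : Γ.comp B w = Γ.comp B u) (b b' : Bool) :
    Γ.double.comp B (u, b) = Γ.double.comp B (u, b') := by
  have h1 : Γ.double.comp B (u, b) = Γ.double.comp B (u, !b) := by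
    rw [← double_comp h, ← double_comp h, ← double_nbr_boundary hw b, Γ.double.comp_nbr hB]
  cases b <;> cases b' <;> simp_all

theorem double_isConnected (hΓ : Γ.IsConnected) (hb : ∃ u, Γ.nbr (Fin.last d) u = u) :
    Γ.double.IsConnected := by
  obtain ⟨w, hw⟩ := hb
  refine ⟨⟨(w, true)⟩, fun ⟨u, b⟩ ⟨v, b'⟩ => ?_⟩
  rw [double_comp (hΓ.2 u v) b]
  exact double_comp_not (Set.mem_univ _) hw (hΓ.2 w v) b b'

open Classical in
/-- The cells of the double in terms of the cells of the graph. -/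
def doubleCellMap (S : Finset (Fin (d + 1))) : Γ.double.Cell S →
    {σ : Γ.Cell S // Γ.IsBoundaryCell S σ} ⊕ {σ : Γ.Cell S // ¬ Γ.IsBoundaryCell S σ} × Bool :=
  Quot.lift (fun z => if h : Γ.IsBoundaryCell S (Γ.cell S z.1) then Sum.inl ⟨_, h⟩
      else Sum.inr (⟨_, h⟩, z.2)) (by
    rintro ⟨u, b⟩ _ ⟨c, hc, rfl⟩
    by_cases h' : c = Fin.last d ∧ Γ.nbr (Fin.last d) u = u
    · obtain ⟨rfl, h'⟩ := h'
      rw [double_nbr_boundary h']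
      have : Γ.IsBoundaryCell S (Γ.cell S u) := ⟨by simpa using hc, u, h', rfl⟩
      simp [this]
    · rw [double_nbr h']
      have h1 : Γ.cell S (Γ.nbr c u) = Γ.cell S u := Γ.cell_nbr (by simpa using hc) u
      simp only [h1])

/-- Boundary cells are shared by the two copies, whereas every other cell occurs twice. -/
theorem card_double_cell [Finite V] (S : Finset (Fin (d + 1))) :
    Nat.card (Γ.double.Cell S) + Γ.numCells Γ.IsBoundaryCell S = 2 * Nat.card (Γ.Cell S) := by
  classical
  have hbij : Function.Bijective (doubleCellMap (Γ := Γ) S) := by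
    constructor
    · intro σ τ
      obtain ⟨⟨u, b⟩, rfl⟩ := Γ.double.comp_surjective _ σ
      obtain ⟨⟨v, b'⟩, rfl⟩ := Γ.double.comp_surjective _ τ
      intro h
      change (if h : Γ.IsBoundaryCell S (Γ.cell S u) then _ else _) =
        (if h : Γ.IsBoundaryCell S (Γ.cell S v) then _ else _) at h
      by_cases hu : Γ.IsBoundaryCell S (Γ.cell S u)
      · by_cases hv : Γ.IsBoundaryCell S (Γ.cell S v)
        · rw [dif_pos hu, dif_pos hv] at h
          have h1 : Γ.cell S u = Γ.cell S v := Subtype.ext_iff.1 (Sum.inl.inj h)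
          obtain ⟨hS, w, hw, hwv⟩ := hv
          rw [double_comp h1 b]
          exact double_comp_not (by simpa using hS) hw hwv b b'
        · rw [dif_pos hu, dif_neg hv] at h
          simp at h
      · by_cases hv : Γ.IsBoundaryCell S (Γ.cell S v)
        · rw [dif_neg hu, dif_pos hv] at h
          simp at h
        · rw [dif_neg hu, dif_neg hv] at h
          have h2 := Sum.inr.inj h
          have h1 : Γ.cell S u = Γ.cell S v := Subtype.ext_iff.1 (congrArg Prod.fst h2)
          have h3 : b = b' := congrArg Prod.snd h2
          rw [h3]
          exact double_comp h1 b'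
    · rintro (⟨σ, hσ⟩ | ⟨⟨σ, hσ⟩, b⟩)
      · obtain ⟨u, rfl⟩ := Γ.comp_surjective _ σ
        exact ⟨Γ.double.cell S (u, true), dif_pos hσ⟩
      · obtain ⟨u, rfl⟩ := Γ.comp_surjective _ σ
        exact ⟨Γ.double.cell S (u, b), dif_neg hσ⟩
  have h1 := Nat.card_congr (Equiv.ofBijective _ hbij)
  have h2 : Nat.card (Γ.Cell S) = Nat.card {σ : Γ.Cell S // Γ.IsBoundaryCell S σ} +
      Nat.card {σ : Γ.Cell S // ¬ Γ.IsBoundaryCell S σ} := by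
    rw [← Nat.card_sum]
    exact (Nat.card_congr (Equiv.sumCompl _)).symm
  rw [Nat.card_sum, Nat.card_prod, Nat.card_eq_fintype_card (α := Bool), Fintype.card_bool] at h1
  rw [numCells]
  omega

variable (Γ) in
/-- The inclusion of one of the two copies into the carrier of the double. -/
def inclDouble (b : Bool) : Γ.Carrier → Γ.double.Carrier :=
  Quot.lift (fun z => Γ.double.charMap (z.1, b) z.2) (by
    rintro ⟨u, x⟩ ⟨v, y⟩ ⟨j, rfl, rfl : x = y, hx⟩
    by_cases h' : j = Fin.last d ∧ Γ.nbr (Fin.last d) u = u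
    · obtain ⟨rfl, h'⟩ := h'
      simp only [h']
    · simp only [← double_nbr h']
      exact (Γ.double.charMap_nbr _ hx).symm)

theorem continuous_inclDouble (b : Bool) : Continuous (Γ.inclDouble b) :=
  continuous_quot_lift _ (continuous_sigma fun u => Γ.double.continuous_charMap (u, b))

theorem inclDouble_charMap (b : Bool) (u : V) (x : stdSimplex ℝ (Fin (d + 1))) :
    Γ.inclDouble b (Γ.charMap u x) = Γ.double.charMap (u, b) x := rfl

variable {E : Type*} [AddCommGroup E] [Module ℝ E] [TopologicalSpace E] {P : Set E}

/-- The carrier of the double of a graph is homeomorphic to the double of the manifold. -/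
theorem nonempty_homeomorph_double {n : ℕ} (f : Γ.Carrier ≃ₜ P)
    (hf : ∀ p : P, (p : E) ∈ plBoundary n P ↔ ∃ u, Γ.nbr (Fin.last d) u = u ∧
      ∃ x : stdSimplex ℝ (Fin (d + 1)), x.1 (Fin.last d) = 0 ∧ f (Γ.charMap u x) = p) :
    Nonempty (Γ.double.Carrier ≃ₜ Double n P) := by
  let F : Γ.double.Carrier → Double n P :=
    Quot.lift (fun z => Quot.mk _ ⟨z.1.2, f (Γ.charMap z.1.1 z.2)⟩) (by
      rintro ⟨⟨u, b⟩, x⟩ ⟨_, y⟩ ⟨j, rfl, rfl : x = y, hx⟩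
      by_cases h' : j = Fin.last d ∧ Γ.nbr (Fin.last d) u = u
      · obtain ⟨rfl, h'⟩ := h'
        simp only [double_nbr_boundary h']
        exact Quot.sound ⟨rfl, (hf _).2 ⟨u, h', x, hx, rfl⟩⟩
      · simp only [double_nbr h']
        rw [Γ.charMap_nbr u hx])
  have hF : Continuous F := by
    refine continuous_quot_lift _ (continuous_sigma fun z => ?_)
    refine continuous_quot_mk.comp ?_
    exact (continuous_sigmaMk (σ := fun _ : Bool => P) (i := z.2)).comp
      (f.continuous.comp (Γ.continuous_charMap z.1))
  let G : Double n P → Γ.double.Carrier :=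
    Quot.lift (fun z => Γ.inclDouble z.1 (f.symm z.2)) (by
      rintro ⟨b, p⟩ ⟨b', p'⟩ ⟨rfl : p = p', hp⟩
      obtain ⟨u, hu, x, hx, rfl⟩ := (hf p).1 hp
      simp only [Homeomorph.symm_apply_apply, inclDouble_charMap]
      have h1 : ∀ b, Γ.double.charMap (u, b) x = Γ.double.charMap (u, !b) x := fun b => by
        rw [← double_nbr_boundary hu b, Γ.double.charMap_nbr _ hx]
      cases b <;> cases b' <;> simp [h1 true])
  have hG : Continuous G := continuous_quot_lift _ (continuous_sigma fun b =>
    (continuous_inclDouble b).comp f.symm.continuous)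
  refine ⟨⟨⟨F, G, ?_, ?_⟩, hF, hG⟩⟩
  · intro q
    obtain ⟨⟨u, b⟩, x, rfl⟩ := Γ.double.exists_charMap q
    change Γ.inclDouble b (f.symm (f (Γ.charMap u x))) = _
    rw [f.symm_apply_apply, inclDouble_charMap]
  · intro q
    obtain ⟨⟨b, p⟩, rfl⟩ := Quot.mk_surjective q
    obtain ⟨u, x, hux⟩ := Γ.exists_charMap (f.symm p)
    change F (Γ.inclDouble b (f.symm p)) = _
    rw [← hux, inclDouble_charMap]
    change Quot.mk _ (⟨b, f (Γ.charMap u x)⟩ : Σ _ : Bool, P) = _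
    rw [hux, f.apply_symm_apply]

end ColoredGraph
end

noncomputable section
set_option linter.unusedSectionVars false

/-! ## Boundary components and the vertices of a crystallization -/

namespace ColoredGraph

theorem ncard_cellVertices {d : ℕ} {V : Type} [Finite V] (Γ : ColoredGraph d V) :
    Γ.cellVertices.ncard = ∑ a, Nat.card (Γ.Cell {a}) := by
  have h1 : Function.Injective (fun p : Σ a, Γ.Cell {a} => Γ.vtx p.1 p.2) := by
    rintro ⟨a, σ⟩ ⟨b, τ⟩ hab
    obtain ⟨h1, h2⟩ := Γ.charMap_eq_iff.1 hab
    have h3 : a = b := by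
      have := congrArg (fun x => supp (Subtype.val x)) h1
      simpa using this
    subst h3
    have h4 : Γ.cell {a} (Γ.rep σ) = Γ.cell {a} (Γ.rep τ) :=
      Γ.cell_mono (by rw [supp_vert]) h2
    rw [show Γ.cell {a} (Γ.rep σ) = σ from Γ.comp_rep σ,
      show Γ.cell {a} (Γ.rep τ) = τ from Γ.comp_rep τ] at h4
    rw [h4]
  have h2 : Γ.cellVertices = Set.range (fun p : Σ a, Γ.Cell {a} => Γ.vtx p.1 p.2) := by
    ext q
    constructor
    · rintro ⟨u, x, a, hx, rfl⟩
      refine ⟨⟨a, Γ.cell {a} u⟩, ?_⟩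
      have hx' : x = vert a := Subtype.ext hx
      rw [hx', Γ.charMap_vert]
    · rintro ⟨⟨a, σ⟩, rfl⟩
      exact ⟨Γ.rep σ, vert a, a, rfl, rfl⟩
  rw [h2, ← Nat.card_coe_set_eq, Nat.card_range_of_injective h1, Nat.card_sigma]

variable {n : ℕ} {V : Type} {Γ : ColoredGraph (n + 1) V}
  {E : Type*} [NormedAddCommGroup E] [NormedSpace ℝ E] {R : V → (Fin (n + 2) → ℝ) → E} {P : Set E}

theorem zero_ne_last : (0 : Fin (n + 2)) ≠ Fin.last (n + 1) := by
  rw [Ne, Fin.ext_iff]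
  simp

instance [Finite V] : Finite Γ.BoundaryVertex := 
  inferInstanceAs (Finite {v // Γ.nbr (Fin.last (n + 1)) v = v})

variable (h : Γ.IsManifoldRealization R P) [Finite V] [FiniteDimensional ℝ E]
include h

/-- The boundary component that contains the boundary face of the simplex of a boundary vertex. -/
def IsManifoldRealization.compOf (u : Γ.BoundaryVertex) : BoundaryComponent (n + 1) P :=
  ConnectedComponents.mk ⟨R u.1 (vert 0).1, h.mem_plBoundary u.2 (vert 0).2
    (vert_apply_of_ne zero_ne_last.symm)⟩

theorem IsManifoldRealization.mk_eq_compOf (u : Γ.BoundaryVertex) {x : Fin (n + 2) → ℝ}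
    (hx : x ∈ stdSimplex ℝ (Fin (n + 2))) (hx0 : x (Fin.last (n + 1)) = 0)
    (hy : R u.1 x ∈ plBoundary (n + 1) P) :
    (ConnectedComponents.mk ⟨R u.1 x, hy⟩ : BoundaryComponent (n + 1) P) = h.compOf u := by
  let F := simplexFace (Finset.univ.erase (Fin.last (n + 1)))
  have h1 : IsPreconnected (R u.1 '' F) :=
    (convex_simplexFace _).isPreconnected.image _
      ((h.real.piecewise u.1).continuousOn.mono fun z hz => hz.1)
  have h2 : Subtype.val '' (Subtype.val ⁻¹' (R u.1 '' F) : Set (plBoundary (n + 1) P)) =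
      R u.1 '' F := by
    rw [Subtype.image_preimage_coe, Set.inter_eq_right]
    rintro _ ⟨z, hz, rfl⟩
    exact h.mem_plBoundary u.2 hz.1 ((mem_simplexFace_erase hz.1).1 hz)
  have h3 : IsPreconnected (Subtype.val ⁻¹' (R u.1 '' F) : Set (plBoundary (n + 1) P)) := by
    rw [← Topology.IsInducing.subtypeVal.isPreconnected_image, h2]
    exact h1
  refine ConnectedComponents.coe_eq_coe'.2 (h3.subset_connectedComponent ?_ ?_)
  · exact ⟨_, (mem_simplexFace_erase (vert 0).2).2 (vert_apply_of_ne zero_ne_last.symm), rfl⟩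
  · exact ⟨x, (mem_simplexFace_erase hx).2 hx0, rfl⟩

theorem IsManifoldRealization.mem_carrier_iff {C : BoundaryComponent (n + 1) P} {y : E} :
    y ∈ C.carrier ↔ ∃ u : Γ.BoundaryVertex, h.compOf u = C ∧
      ∃ x ∈ stdSimplex ℝ (Fin (n + 2)), x (Fin.last (n + 1)) = 0 ∧ R u.1 x = y := by
  constructor
  · rintro ⟨hy, rfl⟩
    obtain ⟨u, hu, x, hx, hx0, rfl⟩ := h.mem_plBoundary_iff.1 hy
    exact ⟨⟨u, hu⟩, (h.mk_eq_compOf ⟨u, hu⟩ hx hx0 hy).symm, x, hx, hx0, rfl⟩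
  · rintro ⟨u, rfl, x, hx, hx0, rfl⟩
    exact ⟨h.mem_plBoundary u.2 hx hx0, h.mk_eq_compOf u hx hx0 _⟩

theorem IsManifoldRealization.compOf_surjective : Function.Surjective h.compOf := by
  intro C
  obtain ⟨⟨y, hy⟩, rfl⟩ := ConnectedComponents.surjective_coe C
  obtain ⟨u, hu, -⟩ := h.mem_carrier_iff.1
    (show y ∈ BoundaryComponent.carrier (ConnectedComponents.mk ⟨y, hy⟩) from ⟨hy, rfl⟩)
  exact ⟨u, hu⟩

theorem IsManifoldRealization.finite_boundaryComponent : Finite (BoundaryComponent (n + 1) P) :=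
  Finite.of_surjective _ h.compOf_surjective

theorem IsManifoldRealization.compOf_eq_of_cell_eq {u v : Γ.BoundaryVertex}
    {S : Finset (Fin (n + 2))} (hS : S.Nonempty) (hlast : Fin.last (n + 1) ∉ S)
    (huv : Γ.cell S u.1 = Γ.cell S v.1) : h.compOf u = h.compOf v := by
  obtain ⟨x, hx, rfl⟩ := openSimplex_nonempty hS
  have hx0 : x (Fin.last (n + 1)) = 0 := by simpa using hlast
  have h1 : R u.1 x = R v.1 x := (h.real.eq_iff hx hx).2 ⟨rfl, huv⟩
  rw [← h.mk_eq_compOf u hx hx0 (h.mem_plBoundary u.2 hx hx0),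
    ← h.mk_eq_compOf v hx hx0 (h.mem_plBoundary v.2 hx hx0)]
  congr 2

/-- The boundary component of a boundary cell. -/
def IsManifoldRealization.cellComp (S : Finset (Fin (n + 2)))
    (σ : {σ : Γ.Cell S // Γ.IsBoundaryCell S σ}) : BoundaryComponent (n + 1) P :=
  h.compOf ⟨σ.2.2.choose, σ.2.2.choose_spec.1⟩

/-- The chosen boundary vertex does not matter: facets sharing a nonempty boundary cell lie in the
same component. -/
theorem IsManifoldRealization.cellComp_eq {S : Finset (Fin (n + 2))} (hS : S.Nonempty)
    (hlast : Fin.last (n + 1) ∉ S) (u : Γ.BoundaryVertex)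
    (hσ : Γ.IsBoundaryCell S (Γ.cell S u.1)) : h.cellComp S ⟨_, hσ⟩ = h.compOf u :=
  h.compOf_eq_of_cell_eq hS hlast hσ.2.choose_spec.2

theorem IsManifoldRealization.cellComp_surjective {S : Finset (Fin (n + 2))} (hS : S.Nonempty)
    (hlast : Fin.last (n + 1) ∉ S) : Function.Surjective (h.cellComp S) := by
  intro C
  obtain ⟨u, rfl⟩ := h.compOf_surjective C
  exact ⟨⟨_, hlast, u.1, u.2, rfl⟩, h.cellComp_eq hS hlast u _⟩

/-- The structure of the vertices of a crystallization: each boundary component contains exactly one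
vertex of each label other than the last one, and there is one further vertex. -/
structure IsManifoldRealization.IsMinimal : Prop where
  card_vertex : ∀ a ≠ Fin.last (n + 1), Nat.card (Γ.Cell {a}) = numBoundaryComponents (n + 1) P
  card_last : Nat.card (Γ.Cell {Fin.last (n + 1)}) = 1
  isBoundaryCell : ∀ a ≠ Fin.last (n + 1), ∀ σ, Γ.IsBoundaryCell {a} σ
  injective : ∀ a ≠ Fin.last (n + 1), Function.Injective (h.cellComp {a})

theorem IsManifoldRealization.numBoundaryComponents_le {a : Fin (n + 2)} (ha : a ≠ Fin.last (n + 1)) :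
    numBoundaryComponents (n + 1) P ≤ Γ.numCells Γ.IsBoundaryCell {a} :=
  Nat.card_le_card_of_surjective _
    (h.cellComp_surjective (Finset.singleton_nonempty a) (by simpa using ha.symm))

/-- Every boundary component needs a vertex of each label other than the last, and some vertex has
the last label. The prescribed number of vertices equals this lower bound, so each estimate is an
equality and the corresponding maps are bijective. -/
theorem IsManifoldRealization.isMinimal [Nonempty V]
    (hcard : Γ.cellVertices.ncard = (n + 1) * numBoundaryComponents (n + 1) P + 1) : h.IsMinimal := by
  classical
  have hfin := h.finite_boundaryComponent
  have hle : ∀ a, Γ.numCells Γ.IsBoundaryCell {a} ≤ Nat.card (Γ.Cell {a}) := fun a =>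
    Nat.card_le_card_of_injective _ Subtype.val_injective
  have hpos : 1 ≤ Nat.card (Γ.Cell {Fin.last (n + 1)}) := by
    have : Nonempty (Γ.Cell {Fin.last (n + 1)}) := ⟨Γ.cell _ (Classical.arbitrary V)⟩
    exact Nat.card_pos
  rw [Γ.ncard_cellVertices, Fin.sum_univ_castSucc] at hcard
  have h1 : ∀ a : Fin (n + 1), numBoundaryComponents (n + 1) P ≤ Nat.card (Γ.Cell {a.castSucc}) :=
    fun a => (h.numBoundaryComponents_le (Fin.castSucc_lt_last a).ne).trans (hle _)
  have h2 : ∑ _a : Fin (n + 1), numBoundaryComponents (n + 1) P ≤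
      ∑ a : Fin (n + 1), Nat.card (Γ.Cell {a.castSucc}) := Finset.sum_le_sum fun a _ => h1 a
  have h3 : ∑ _a : Fin (n + 1), numBoundaryComponents (n + 1) P =
    (n + 1) * numBoundaryComponents (n + 1) P := by simp
  have h4 := (Finset.sum_eq_sum_iff_of_le (s := Finset.univ) fun a _ => h1 a).1 (by omega)
  have h5 : ∀ a ≠ Fin.last (n + 1), Nat.card (Γ.Cell {a}) = numBoundaryComponents (n + 1) P := by
    intro a ha
    obtain ⟨a, rfl⟩ := Fin.exists_castSucc_eq.2 ha
    exact (h4 a (Finset.mem_univ a)).symm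
  have h6 : ∀ a ≠ Fin.last (n + 1),
      Γ.numCells Γ.IsBoundaryCell {a} = numBoundaryComponents (n + 1) P := fun a ha =>
    le_antisymm ((hle a).trans (h5 a ha).le) (h.numBoundaryComponents_le ha)
  refine ⟨h5, by omega, fun a ha σ => ?_, fun a ha => ?_⟩
  · have h7 : Function.Surjective (Subtype.val : {σ : Γ.Cell {a} // Γ.IsBoundaryCell {a} σ} → _) := by
      have := Fintype.ofFinite (Γ.Cell {a})
      refine ((Fintype.bijective_iff_injective_and_card _).2 ⟨Subtype.val_injective, ?_⟩).2
      rw [← Nat.card_eq_fintype_card, ← Nat.card_eq_fintype_card, h5 a ha]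
      exact h6 a ha
    obtain ⟨τ, rfl⟩ := h7 σ
    exact τ.2
  · have := Fintype.ofFinite (Γ.Cell {a})
    have := Fintype.ofFinite (BoundaryComponent (n + 1) P)
    refine ((Fintype.bijective_iff_surjective_and_card _).2 ⟨h.cellComp_surjective
      (Finset.singleton_nonempty a) (by simpa using ha.symm), ?_⟩).1
    rw [← Nat.card_eq_fintype_card, ← Nat.card_eq_fintype_card]
    exact h6 a ha

variable {h} in
theorem IsManifoldRealization.IsMinimal.cell_eq (hm : h.IsMinimal)
    {u v : Γ.BoundaryVertex} (huv : h.compOf u = h.compOf v) {a : Fin (n + 2)}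
    (ha : a ≠ Fin.last (n + 1)) : Γ.cell {a} u.1 = Γ.cell {a} v.1 := by
  have hlast : Fin.last (n + 1) ∉ ({a} : Finset (Fin (n + 2))) := by simpa using ha.symm
  rw [← h.cellComp_eq (Finset.singleton_nonempty a) hlast u ⟨hlast, u.1, u.2, rfl⟩,
    ← h.cellComp_eq (Finset.singleton_nonempty a) hlast v ⟨hlast, v.1, v.2, rfl⟩] at huv
  exact Subtype.ext_iff.1 (hm.injective a ha huv)

variable {h} in
/-- The edges with two given labels that are not in the boundary connect the boundary components. -/
theorem IsManifoldRealization.IsMinimal.numBoundaryComponents_le_card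
    (hm : h.IsMinimal) (hΓ : Γ.IsConnected) {i j : Fin (n + 2)}
    (hij : i ≠ j) (hi : i ≠ Fin.last (n + 1)) (hj : j ≠ Fin.last (n + 1)) :
    numBoundaryComponents (n + 1) P + Γ.numCells Γ.IsBoundaryCell {i, j} ≤
      Nat.card (Γ.Cell {i, j}) + 1 := by
  classical
  have hfin := h.finite_boundaryComponent
  let κ : ∀ a ≠ Fin.last (n + 1), V → BoundaryComponent (n + 1) P := fun a ha u =>
    h.cellComp {a} ⟨_, hm.isBoundaryCell a ha (Γ.cell {a} u)⟩
  have hκ : ∀ a ha u v, Γ.cell {a} u = Γ.cell {a} v → κ a ha u = κ a ha v := by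
    intro a ha u v huv
    simp only [κ, huv]
  have hκu : ∀ a ha (u : Γ.BoundaryVertex), κ a ha u.1 = h.compOf u := fun a ha u =>
    h.cellComp_eq (Finset.singleton_nonempty a) (by simpa using ha.symm) u _
  have hsub1 : ({i} : Finset (Fin (n + 2))) ⊆ {i, j} := by simp
  have hsub2 : ({j} : Finset (Fin (n + 2))) ⊆ {i, j} := by simp
  obtain ⟨u₀⟩ := hΓ.1
  -- The graph has the boundary components as vertices and the cells labelled `{i, j}` outside the
  -- boundary as edges. Edges in the boundary would be loops, so they can be left out without losing
  -- connectedness.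
  have key := card_le_card_edges_add_one
    (A := {σ : Γ.Cell {i, j} // ¬ Γ.IsBoundaryCell {i, j} σ})
    (fun σ => κ i hi (Γ.rep σ.1)) (fun σ => κ j hj (Γ.rep σ.1)) (κ i hi u₀) (by
      intro U hU hUst
      have h1 : ∀ u, κ i hi u ∈ U ↔ κ j hj u ∈ U := by
        intro u
        have h3 : Γ.cell {i, j} (Γ.rep (Γ.cell {i, j} u)) = Γ.cell {i, j} u := Γ.comp_rep _
        by_cases hb : Γ.IsBoundaryCell {i, j} (Γ.cell {i, j} u)
        · obtain ⟨-, v, hv, hvu⟩ := hb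
          rw [← hκ i hi _ _ (Γ.cell_mono hsub1 hvu), ← hκ j hj _ _ (Γ.cell_mono hsub2 hvu),
            hκu i hi ⟨v, hv⟩, hκu j hj ⟨v, hv⟩]
        · have h2 := hUst ⟨_, hb⟩
          rwa [hκ i hi _ _ (Γ.cell_mono hsub1 h3), hκ j hj _ _ (Γ.cell_mono hsub2 h3)] at h2
      have h2 : ∀ u, κ i hi u ∈ U := by
        intro u
        refine Γ.comp_eq_induction (hΓ.2 u₀ u) (p := fun u => κ i hi u ∈ U) hU ?_
        intro w c _ hw
        by_cases hc : c = i
        · have hcj : c ∉ ({j} : Finset (Fin (n + 2))) := by simpa [hc] using hij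
          rw [h1, hκ j hj _ _ (Γ.cell_nbr hcj w), ← h1]
          exact hw
        · rw [hκ i hi _ _ (Γ.cell_nbr (by simpa using hc) w)]
          exact hw
      rw [Set.eq_univ_iff_forall]
      intro C
      obtain ⟨u, rfl⟩ := h.compOf_surjective C
      rw [← hκu i hi u]
      exact h2 _)
  have h2 : Nat.card (Γ.Cell {i, j}) = Nat.card {σ : Γ.Cell {i, j} // Γ.IsBoundaryCell {i, j} σ} +
      Nat.card {σ : Γ.Cell {i, j} // ¬ Γ.IsBoundaryCell {i, j} σ} := by
    rw [← Nat.card_sum]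
    exact (Nat.card_congr (Equiv.sumCompl _)).symm
  rw [numCells, numBoundaryComponents]
  omega

end ColoredGraph
end

noncomputable section
set_option linter.unusedSectionVars false

/-! ## Crystallizations of the boundary components -/

section ExtendZero

variable {n : ℕ}

/-- The embedding of a coordinate space into the hyperplane where the last coordinate vanishes. -/
def extendZero (n : ℕ) : (Fin (n + 1) → ℝ) →ₗ[ℝ] (Fin (n + 2) → ℝ) where
  toFun x := Fin.snoc (α := fun _ => ℝ) x 0
  map_add' x y := by
    ext i
    refine Fin.lastCases ?_ (fun i => ?_) i <;> simp
  map_smul' r x := by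
    ext i
    refine Fin.lastCases ?_ (fun i => ?_) i <;> simp

@[simp] theorem extendZero_castSucc (x : Fin (n + 1) → ℝ) (i : Fin (n + 1)) :
    extendZero n x i.castSucc = x i := by simp [extendZero]

@[simp] theorem extendZero_last (x : Fin (n + 1) → ℝ) :
    extendZero n x (Fin.last (n + 1)) = 0 := by simp [extendZero]

theorem extendZero_injective : Function.Injective (extendZero n) := by
  intro x y hxy
  ext i
  rw [← extendZero_castSucc x i, hxy, extendZero_castSucc]

theorem extendZero_comp {z : Fin (n + 2) → ℝ} (hz : z (Fin.last (n + 1)) = 0) :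
    extendZero n (fun i => z i.castSucc) = z := by
  ext i
  refine Fin.lastCases ?_ (fun i => ?_) i <;> simp [hz]

theorem extendZero_mem_stdSimplex {x : Fin (n + 1) → ℝ} :
    extendZero n x ∈ stdSimplex ℝ (Fin (n + 2)) ↔ x ∈ stdSimplex ℝ (Fin (n + 1)) := by
  have h1 : ∑ i, extendZero n x i = ∑ i, x i := by
    rw [Fin.sum_univ_castSucc]; simp
  constructor
  · rintro ⟨h2, h3⟩
    exact ⟨fun i => by simpa using h2 i.castSucc, by rw [← h1, h3]⟩
  · rintro ⟨h2, h3⟩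
    refine ⟨fun i => ?_, by rw [h1, h3]⟩
    refine Fin.lastCases ?_ (fun i => ?_) i
    · simp
    · simpa using h2 i

theorem supp_extendZero (x : Fin (n + 1) → ℝ) :
    supp (extendZero n x) = (supp x).map Fin.castSuccEmb := by
  ext i
  refine Fin.lastCases ?_ (fun i => ?_) i <;> simp

theorem last_notMem_map_castSucc (T : Finset (Fin (n + 1))) :
    Fin.last (n + 1) ∉ T.map Fin.castSuccEmb := by
  simp

/-- A face of a polytope is the convex hull of its vertices in that face. -/
theorem mem_convexHull_filter {κ : Type*} {C : Finset (κ → ℝ)} {y : κ → ℝ}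
    (hy : y ∈ convexHull ℝ (C : Set (κ → ℝ))) {k : κ} (hC : ∀ z ∈ C, 0 ≤ z k) (hyk : y k = 0) :
    y ∈ convexHull ℝ {z | z ∈ C ∧ z k = 0} := by
  obtain ⟨w, hw0, hw1, rfl⟩ := Finset.mem_convexHull'.1 hy
  rw [Finset.sum_apply] at hyk
  have h1 := (Finset.sum_eq_zero_iff_of_nonneg fun z hz => by
    rw [Pi.smul_apply, smul_eq_mul]; exact mul_nonneg (hw0 z hz) (hC z hz)).1 hyk
  classical
  have h2 : ∀ z ∈ C, z ∉ C.filter (fun z => z k = 0) → w z = 0 := by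
    intro z hz hz'
    have h3 := h1 z hz
    rw [Pi.smul_apply, smul_eq_mul] at h3
    exact (mul_eq_zero.1 h3).resolve_right fun h => hz' (Finset.mem_filter.2 ⟨hz, h⟩)
  rw [← Finset.sum_subset (Finset.filter_subset _ C) (fun z hz hz' => by
    rw [h2 z hz hz', zero_smul])]
  refine (convex_convexHull ℝ _).sum_mem (fun z hz => hw0 z (Finset.mem_filter.1 hz).1) ?_
    fun z hz => subset_convexHull ℝ _ (Finset.mem_filter.1 hz)
  rw [← hw1]
  exact Finset.sum_subset (Finset.filter_subset _ C) h2

/-- A polytope of the subdivision meets the facet where the last coordinate vanishes in the hull of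
its vertices there, because this coordinate is nonnegative on the simplex. These faces subdivide the
facet. -/
theorem IsPL.comp_extendZero {E : Type*} [AddCommGroup E] [Module ℝ E]
    {φ : stdSimplex ℝ (Fin (n + 2)) → E} (hφ : IsPL (stdSimplex ℝ (Fin (n + 2))) φ) :
    IsPL (stdSimplex ℝ (Fin (n + 1)))
      (fun x => φ ⟨extendZero n x.1, extendZero_mem_stdSimplex.2 x.2⟩) := by
  classical
  obtain ⟨𝒞, hunion, h𝒞⟩ := hφ
  let ρ : (Fin (n + 2) → ℝ) →ₗ[ℝ] (Fin (n + 1) → ℝ) := LinearMap.funLeft ℝ ℝ Fin.castSucc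
  let cut : Finset (Fin (n + 2) → ℝ) → Finset (Fin (n + 1) → ℝ) := fun C =>
    (C.filter fun z => z (Fin.last (n + 1)) = 0).image ρ
  have hρ : ∀ z : Fin (n + 2) → ℝ, z (Fin.last (n + 1)) = 0 → extendZero n (ρ z) = z :=
    fun z hz => extendZero_comp hz
  have hsub : ∀ C ∈ 𝒞, convexHull ℝ (C : Set (Fin (n + 2) → ℝ)) ⊆ stdSimplex ℝ (Fin (n + 2)) := by
    intro C hC
    rw [hunion]
    exact Set.subset_biUnion_of_mem (u := fun C : Finset (Fin (n + 2) → ℝ) =>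
      convexHull ℝ (C : Set (Fin (n + 2) → ℝ))) hC
  have hcut : ∀ C, ∀ x ∈ convexHull ℝ (cut C : Set (Fin (n + 1) → ℝ)),
      extendZero n x ∈ convexHull ℝ (C : Set (Fin (n + 2) → ℝ)) := by
    intro C x hx
    have h1 : extendZero n x ∈ extendZero n '' convexHull ℝ (cut C : Set (Fin (n + 1) → ℝ)) :=
      ⟨x, hx, rfl⟩
    rw [LinearMap.image_convexHull] at h1
    refine convexHull_mono ?_ h1
    rintro _ ⟨_, hz, rfl⟩
    obtain ⟨z, hzC, rfl⟩ := Finset.mem_image.1 (Finset.mem_coe.1 hz)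
    rw [Finset.mem_filter] at hzC
    rw [hρ z hzC.2]
    exact hzC.1
  refine ⟨𝒞.image cut, ?_, fun C' hC' => ?_⟩
  · ext x
    simp only [Set.mem_iUnion, Finset.mem_image, exists_prop]
    constructor
    · intro hx
      have h1 := extendZero_mem_stdSimplex.2 hx
      rw [hunion] at h1
      simp only [Set.mem_iUnion, exists_prop] at h1
      obtain ⟨C, hC, hxC⟩ := h1
      refine ⟨_, ⟨C, hC, rfl⟩, ?_⟩
      have h2 := mem_convexHull_filter hxC (k := Fin.last (n + 1))
        (fun z hz => (hsub C hC (subset_convexHull ℝ _ hz)).1 _) (extendZero_last x)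
      have h3 : ρ (extendZero n x) ∈ ρ '' convexHull ℝ
        {z | z ∈ C ∧ z (Fin.last (n + 1)) = 0} := ⟨_, h2, rfl⟩
      rw [LinearMap.image_convexHull] at h3
      have h4 : ρ (extendZero n x) = x := by ext i; simp [ρ, LinearMap.funLeft]
      rw [h4] at h3
      refine convexHull_mono ?_ h3
      rintro _ ⟨z, hz, rfl⟩
      exact Finset.mem_coe.2 (Finset.mem_image_of_mem _ (Finset.mem_filter.2 hz))
    · rintro ⟨_, ⟨C, hC, rfl⟩, hx⟩
      exact extendZero_mem_stdSimplex.1 (hsub C hC (hcut C x hx))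
  · obtain ⟨C, hC, rfl⟩ := Finset.mem_image.1 hC'
    obtain ⟨A, hA⟩ := h𝒞 C hC
    refine ⟨A.comp (extendZero n).toAffineMap, fun x hx => ?_⟩
    exact hA ⟨_, extendZero_mem_stdSimplex.2 x.2⟩ (hcut C _ hx)

end ExtendZero

namespace ColoredGraph

section

variable {d : ℕ} {V : Type} {Γ : ColoredGraph d V} [Finite V]

instance : CompactSpace Γ.Carrier := by
  have : CompactSpace (stdSimplex ℝ (Fin (d + 1))) :=
    isCompact_iff_compactSpace.1 (isCompact_stdSimplex ℝ _)
  exact inferInstanceAs (CompactSpace (Quot _))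

variable {E : Type*} [NormedAddCommGroup E] [NormedSpace ℝ E] {R : V → (Fin (d + 1) → ℝ) → E}

theorem IsRealization.exists_homeomorph (hR : Γ.IsRealization R) {Q : Set E}
    (hQ : ∀ y, y ∈ Q ↔ ∃ u, ∃ x ∈ stdSimplex ℝ (Fin (d + 1)), R u x = y) :
    ∃ g : Γ.Carrier ≃ₜ Q, ∀ u x, (g (Γ.charMap u x) : E) = R u x.1 := by
  let g : Γ.Carrier → Q := Quot.lift (fun z => ⟨R z.1 z.2.1, (hQ _).2 ⟨z.1, _, z.2.2, rfl⟩⟩) (by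
    rintro ⟨u, x⟩ ⟨v, y⟩ ⟨j, rfl, rfl : x = y, hx⟩
    refine Subtype.ext ((hR.eq_iff x.2 x.2).2 ⟨rfl, (Γ.cell_nbr ?_ u).symm⟩)
    intro h
    exact mem_supp.1 h hx)
  have hg : Continuous g := by
    refine continuous_quot_lift _ (continuous_sigma fun u => Continuous.subtype_mk ?_ _)
    exact continuousOn_iff_continuous_domRestrict.1 (hR.piecewise u).continuousOn
  have hbij : Function.Bijective g := by
    constructor
    · intro p q hpq
      obtain ⟨u, x, rfl⟩ := Γ.exists_charMap p
      obtain ⟨v, y, rfl⟩ := Γ.exists_charMap q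
      obtain ⟨h1, h2⟩ := (hR.eq_iff x.2 y.2).1 (Subtype.ext_iff.1 hpq)
      exact Γ.charMap_eq_iff.2 ⟨Subtype.ext h1, h2⟩
    · rintro ⟨y, hy⟩
      obtain ⟨u, x, hx, rfl⟩ := (hQ y).1 hy
      exact ⟨Γ.charMap u ⟨x, hx⟩, rfl⟩
  exact ⟨Continuous.homeoOfEquivCompactToT2 (f := Equiv.ofBijective g hbij) hg, fun u x => rfl⟩

end

variable {n : ℕ} {V : Type} {Γ : ColoredGraph (n + 1) V}
  {E : Type*} [NormedAddCommGroup E] [NormedSpace ℝ E] {R : V → (Fin (n + 2) → ℝ) → E} {P : Set E}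
  (h : Γ.IsManifoldRealization R P) [Finite V] [FiniteDimensional ℝ E]
include h

theorem IsManifoldRealization.exists_boundaryNbr (hn : 0 < n) (c : Fin (n + 1))
    (u : Γ.BoundaryVertex) : ∃ v : Γ.BoundaryVertex, v ≠ u ∧
      Γ.comp {c.castSucc, Fin.last (n + 1)} v.1 = Γ.comp {c.castSucc, Fin.last (n + 1)} u.1 ∧
      ∀ w : Γ.BoundaryVertex, Γ.comp {c.castSucc, Fin.last (n + 1)} w.1 =
        Γ.comp {c.castSucc, Fin.last (n + 1)} u.1 → w = u ∨ w = v := by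
  obtain ⟨a, b, hab, hs⟩ := Set.ncard_eq_two.1
    (h.ncard_boundary_comp hn u.2 (Fin.castSucc_lt_last c).ne)
  have key : ∀ w, (Γ.nbr (Fin.last (n + 1)) w = w ∧ Γ.comp {c.castSucc, Fin.last (n + 1)} w =
      Γ.comp {c.castSucc, Fin.last (n + 1)} u.1) ↔ w = a ∨ w = b := fun w => Set.ext_iff.1 hs w
  rcases (key u.1).1 ⟨u.2, rfl⟩ with hu | hu
  · obtain ⟨h1, h2⟩ := (key b).2 (Or.inr rfl)
    refine ⟨⟨b, h1⟩, fun h' => hab ?_, h2, fun w hw => ?_⟩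
    · rw [← hu, ← h']
    · rcases (key w.1).1 ⟨w.2, hw⟩ with h3 | h3
      · exact Or.inl (Subtype.ext (h3.trans hu.symm))
      · exact Or.inr (Subtype.ext h3)
  · obtain ⟨h1, h2⟩ := (key a).2 (Or.inl rfl)
    refine ⟨⟨a, h1⟩, fun h' => hab ?_, h2, fun w hw => ?_⟩
    · rw [← hu, ← h']
    · rcases (key w.1).1 ⟨w.2, hw⟩ with h3 | h3
      · exact Or.inr (Subtype.ext h3)
      · exact Or.inl (Subtype.ext (h3.trans hu.symm))

/-- The neighbour of a boundary vertex in the boundary graph. -/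
def IsManifoldRealization.boundaryNbr (hn : 0 < n) (c : Fin (n + 1)) (u : Γ.BoundaryVertex) :
    Γ.BoundaryVertex := (h.exists_boundaryNbr hn c u).choose

theorem IsManifoldRealization.boundaryNbr_ne (hn : 0 < n) (c : Fin (n + 1)) (u : Γ.BoundaryVertex) :
    h.boundaryNbr hn c u ≠ u := (h.exists_boundaryNbr hn c u).choose_spec.1

theorem IsManifoldRealization.comp_boundaryNbr (hn : 0 < n) (c : Fin (n + 1))
    (u : Γ.BoundaryVertex) : Γ.comp {c.castSucc, Fin.last (n + 1)} (h.boundaryNbr hn c u).1 =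
      Γ.comp {c.castSucc, Fin.last (n + 1)} u.1 := (h.exists_boundaryNbr hn c u).choose_spec.2.1

theorem IsManifoldRealization.eq_or_eq_boundaryNbr (hn : 0 < n) (c : Fin (n + 1))
    {u w : Γ.BoundaryVertex} (hw : Γ.comp {c.castSucc, Fin.last (n + 1)} w.1 =
      Γ.comp {c.castSucc, Fin.last (n + 1)} u.1) : w = u ∨ w = h.boundaryNbr hn c u :=
  (h.exists_boundaryNbr hn c u).choose_spec.2.2 w hw

theorem IsManifoldRealization.boundaryNbr_boundaryNbr (hn : 0 < n) (c : Fin (n + 1))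
    (u : Γ.BoundaryVertex) : h.boundaryNbr hn c (h.boundaryNbr hn c u) = u := by
  rcases h.eq_or_eq_boundaryNbr hn c (h.comp_boundaryNbr hn c u).symm with h1 | h1
  · exact absurd h1.symm (h.boundaryNbr_ne hn c u)
  · exact h1.symm

theorem IsManifoldRealization.compOf_eq_of_comp_eq (hn : 0 < n) (c : Fin (n + 1))
    {u w : Γ.BoundaryVertex} (hw : Γ.comp {c.castSucc, Fin.last (n + 1)} w.1 =
      Γ.comp {c.castSucc, Fin.last (n + 1)} u.1) : h.compOf w = h.compOf u := by
  refine h.compOf_eq_of_cell_eq (S := (Finset.univ.erase (Fin.last (n + 1))).erase c.castSucc) ?_ ?_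
    (Γ.cell_erase_erase_eq_iff.2 hw)
  · rw [← Finset.card_pos, Finset.card_erase_of_mem
      (Finset.mem_erase.2 ⟨(Fin.castSucc_lt_last c).ne, Finset.mem_univ _⟩),
      Finset.card_erase_of_mem (Finset.mem_univ _)]
    simpa using hn
  · simp

/-- The boundary graph of a boundary component. -/
def IsManifoldRealization.componentGraph (hn : 0 < n) (C : BoundaryComponent (n + 1) P) :
    ColoredGraph n {u : Γ.BoundaryVertex // h.compOf u = C} where
  nbr c u := ⟨h.boundaryNbr hn c u.1,
    (h.compOf_eq_of_comp_eq hn c (h.comp_boundaryNbr hn c u.1)).trans u.2⟩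
  nbr_nbr c u := Subtype.ext (h.boundaryNbr_boundaryNbr hn c u.1)
  nbr_ne c u _ h' := h.boundaryNbr_ne hn c u.1 (Subtype.ext_iff.1 h')

theorem IsManifoldRealization.componentGraph_nbr_ne (hn : 0 < n) (C : BoundaryComponent (n + 1) P)
    (c : Fin (n + 1)) (u : {u : Γ.BoundaryVertex // h.compOf u = C}) :
    (h.componentGraph hn C).nbr c u ≠ u :=
  fun h' => h.boundaryNbr_ne hn c u.1 (Subtype.ext_iff.1 h')

/-- A path in the boundary graph lifts to a path in `Γ` using only additional edges of the last
colour. The converse is the connectedness of links in the boundary, `boundary_induction`. -/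
theorem IsManifoldRealization.componentGraph_cell_eq_iff (hn : 0 < n)
    {C : BoundaryComponent (n + 1) P} {T : Finset (Fin (n + 1))} (hT : T.Nonempty)
    {u v : {u : Γ.BoundaryVertex // h.compOf u = C}} :
    (h.componentGraph hn C).cell T u = (h.componentGraph hn C).cell T v ↔
      Γ.cell (T.map Fin.castSuccEmb) u.1.1 = Γ.cell (T.map Fin.castSuccEmb) v.1.1 := by
  constructor
  · intro huv
    refine (h.componentGraph hn C).comp_eq_induction huv (p := fun w =>
      Γ.cell (T.map Fin.castSuccEmb) u.1.1 = Γ.cell (T.map Fin.castSuccEmb) w.1.1) rfl ?_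
    intro w c hc hw
    refine hw.trans (Γ.comp_mono ?_ (h.comp_boundaryNbr hn c w.1)).symm
    rintro _ (rfl | rfl)
    · simpa using hc
    · simp
  · intro huv
    obtain ⟨hv, h1⟩ := h.boundary_induction (hT.map) (last_notMem_map_castSucc T) u.1.2 v.1.2 huv
      (p := fun w => ∃ (hw : Γ.nbr (Fin.last (n + 1)) w = w) (hw' : h.compOf ⟨w, hw⟩ = C),
        (h.componentGraph hn C).cell T u = (h.componentGraph hn C).cell T ⟨⟨w, hw⟩, hw'⟩)
      ⟨u.1.2, u.2, rfl⟩ (by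
        rintro w w' c hw hw' hcS hc hcomp ⟨_, hwC, hrel⟩
        obtain ⟨c, rfl⟩ := Fin.exists_castSucc_eq.2 hc
        have hC : h.compOf ⟨w', hw'⟩ = C :=
          (h.compOf_eq_of_comp_eq hn c (u := ⟨w, hw⟩) (w := ⟨w', hw'⟩) hcomp.symm).trans hwC
        refine ⟨hw', hC, hrel.trans ?_⟩
        rcases h.eq_or_eq_boundaryNbr hn c (u := ⟨w, hw⟩) (w := ⟨w', hw'⟩) hcomp.symm with h1 | h1
        · simp only [h1]
        · have hcT : c ∉ T := fun h' => hcS (Finset.mem_map_of_mem _ h')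
          rw [← (h.componentGraph hn C).cell_nbr hcT]
          congr 1
          exact Subtype.ext h1.symm)
    exact h1.2

/-- The realization of the boundary graph of a boundary component. -/
theorem IsManifoldRealization.isRealization_componentGraph (hn : 0 < n)
    (C : BoundaryComponent (n + 1) P) : (h.componentGraph hn C).IsRealization
      (fun u x => R u.1.1 (extendZero n x)) := by
  refine ⟨fun u => ?_, fun {u v x y} hx hy => ?_⟩
  · have h1 : PiecewiseAffineOn (extendZero n) (stdSimplex ℝ (Fin (n + 1))) := by
      refine ⟨{stdSimplex ℝ (Fin (n + 1))}, by simp, fun D hD => ?_⟩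
      rw [Finset.mem_singleton.1 hD]
      exact ⟨isCompact_stdSimplex ℝ _, convex_stdSimplex ℝ _, (extendZero n).toAffineMap,
        fun x _ => rfl⟩
    have h2 := h1.comp (h.real.piecewise u.1.1)
    have h3 : stdSimplex ℝ (Fin (n + 1)) ∩ extendZero n ⁻¹' stdSimplex ℝ (Fin (n + 2)) =
        stdSimplex ℝ (Fin (n + 1)) :=
      Set.inter_eq_left.2 fun x hx => extendZero_mem_stdSimplex.2 hx
    rwa [h3] at h2
  · rw [h.real.eq_iff (extendZero_mem_stdSimplex.2 hx) (extendZero_mem_stdSimplex.2 hy),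
      extendZero_injective.eq_iff, supp_extendZero,
      h.componentGraph_cell_eq_iff hn (supp_nonempty hx)]

theorem IsManifoldRealization.mem_carrier_iff_componentGraph
    {C : BoundaryComponent (n + 1) P} (y : E) : y ∈ C.carrier ↔
      ∃ u : {u : Γ.BoundaryVertex // h.compOf u = C}, ∃ x ∈ stdSimplex ℝ (Fin (n + 1)),
        R u.1.1 (extendZero n x) = y := by
  rw [h.mem_carrier_iff]
  constructor
  · rintro ⟨u, hu, x, hx, hx0, rfl⟩
    refine ⟨⟨u, hu⟩, fun i => x i.castSucc, ?_, ?_⟩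
    · rw [← extendZero_mem_stdSimplex, extendZero_comp hx0]
      exact hx
    · rw [extendZero_comp hx0]
  · rintro ⟨u, x, hx, rfl⟩
    exact ⟨u.1, u.2, _, extendZero_mem_stdSimplex.2 hx, extendZero_last x, rfl⟩

/-- The other boundary components lie in a finite union of closed facets missing `y`, so near `y`
the component agrees with the whole boundary. -/
theorem IsManifoldRealization.hasLocalEuler_carrier {C : BoundaryComponent (n + 1) P} {y : E}
    (hy : y ∈ C.carrier) : HasLocalEuler y (ind C.carrier) ((-1) ^ n) := by
  obtain ⟨hyb, hyC⟩ := hy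
  refine (h.hasLocalEuler_plBoundary hyb).congr ?_
  have hcl := h.real.isClosed_image {u | ∃ hu : Γ.nbr (Fin.last (n + 1)) u = u, h.compOf ⟨u, hu⟩ ≠ C}
    (C := {x | x (Fin.last (n + 1)) = 0}) (isClosed_eq (continuous_apply _) continuous_const)
  have hyn : y ∉ {y | ∃ u ∈ {u | ∃ hu : Γ.nbr (Fin.last (n + 1)) u = u, h.compOf ⟨u, hu⟩ ≠ C},
      ∃ x ∈ stdSimplex ℝ (Fin (n + 2)), x ∈ {x | x (Fin.last (n + 1)) = 0} ∧ R u x = y} := by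
    rintro ⟨u, ⟨hu, huC⟩, x, hx, hx0, rfl⟩
    exact huC ((h.mk_eq_compOf ⟨u, hu⟩ hx hx0 hyb).symm.trans hyC)
  filter_upwards [hcl.isOpen_compl.mem_nhds hyn] with z hz
  refine ind_congr ⟨fun hzC => hzC.1, fun hzb => ⟨hzb, ?_⟩⟩
  obtain ⟨u, hu, x, hx, hx0, rfl⟩ := h.mem_plBoundary_iff.1 hzb
  rw [h.mk_eq_compOf ⟨u, hu⟩ hx hx0 hzb]
  by_contra hne
  exact hz ⟨u, ⟨hu, hne⟩, x, hx, hx0, rfl⟩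

theorem IsManifoldRealization.plBoundary_carrier (hn : 0 < n) (C : BoundaryComponent (n + 1) P) :
    plBoundary n C.carrier = ∅ := by
  obtain ⟨m, rfl⟩ := Nat.exists_eq_succ_of_ne_zero hn.ne'
  rw [Set.eq_empty_iff_forall_notMem]
  rintro y ⟨hy, hchart⟩
  have := (h.hasLocalEuler_carrier hy).unique hchart.hasLocalEuler_halfCube
  exact pow_ne_zero _ (by norm_num) this

-- The boundary graph of `C` is contracted because `C` has only one vertex of each label: by
-- `componentGraph_cell_eq_iff`, deleting a colour leaves one component for each vertex with this
-- label.
variable {h} in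
theorem IsManifoldRealization.IsMinimal.isCrystallization_componentGraph
    (hm : h.IsMinimal) (hn : 0 < n)
    (hPL : ∀ u, IsPL (stdSimplex ℝ (Fin (n + 2))) (fun x => R u x.1))
    (C : BoundaryComponent (n + 1) P) : (h.componentGraph hn C).IsCrystallization C.carrier := by
  refine ⟨?_, Or.inl ⟨h.plBoundary_carrier hn C, ?_, fun c u v => ?_⟩⟩
  · obtain ⟨g, hg⟩ := (h.isRealization_componentGraph hn C).exists_homeomorph
      (h.mem_carrier_iff_componentGraph)
    refine ⟨g, fun u => ?_⟩
    simp only [hg]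
    exact (hPL u.1.1).comp_extendZero
  · obtain ⟨u, hu⟩ := h.compOf_surjective C
    exact ⟨⟨u, hu⟩⟩
  · have h1 := (h.componentGraph_cell_eq_iff hn (Finset.singleton_nonempty c) (u := u) (v := v)).2 (by
      rw [Finset.map_singleton]
      exact hm.cell_eq (u.2.trans v.2.symm) (Fin.castSucc_lt_last c).ne)
    refine (h.componentGraph hn C).comp_mono ?_ h1
    rw [Finset.coe_singleton]

/-- The Dehn-Sommerville relations of a closed manifold, applied to a boundary component. -/
theorem IsManifoldRealization.sum_card_componentGraph (hn : 0 < n) (C : BoundaryComponent (n + 1) P)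
    {S : Finset (Fin (n + 1))} (hS : S.Nonempty) :
    (-1) ^ n * (Nat.card ((h.componentGraph hn C).Cell S) : ℤ) =
      ∑ T ∈ Finset.univ.filter (S ⊆ ·), (-1) ^ (T.card + 1) *
        (Nat.card ((h.componentGraph hn C).Cell T) : ℤ) := by
  classical
  have := Fintype.ofFinite ((h.componentGraph hn C).Cell S)
  obtain ⟨x, hx⟩ := openSimplex_nonempty hS
  have h1 := (h.isRealization_componentGraph hn C).sum_localEuler (fun _ _ => True) hx
    (fun _ => (-1) ^ n) (fun u => by
      have h2 : (h.componentGraph hn C).cells (fun u x => R u.1.1 (extendZero n x))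
          (fun _ _ => True) = C.carrier := by
        ext y
        rw [h.mem_carrier_iff_componentGraph]
        simp [cells]
      rw [h2]
      exact h.hasLocalEuler_carrier ((h.mem_carrier_iff_componentGraph _).2 ⟨u, x, hx.1, rfl⟩))
  simp only [numCells_true] at h1
  rw [← h1, Finset.sum_const, nsmul_eq_mul, mul_comm, Finset.card_univ, Nat.card_eq_fintype_card]

theorem IsManifoldRealization.sum_card_cell_componentGraph (hn : 0 < n)
    [Fintype (BoundaryComponent (n + 1) P)] {T : Finset (Fin (n + 1))} (hT : T.Nonempty) :
    ∑ C, Nat.card ((h.componentGraph hn C).Cell T) =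
      Γ.numCells Γ.IsBoundaryCell (T.map Fin.castSuccEmb) := by
  rw [← Nat.card_sigma]
  let F : (Σ C, (h.componentGraph hn C).Cell T) →
      {σ : Γ.Cell (T.map Fin.castSuccEmb) // Γ.IsBoundaryCell _ σ} := fun p =>
    ⟨Γ.cell _ ((h.componentGraph hn p.1).rep p.2).1.1, last_notMem_map_castSucc T, _,
      ((h.componentGraph hn p.1).rep p.2).1.2, rfl⟩
  have hF : ∀ (C) (u : {u : Γ.BoundaryVertex // h.compOf u = C}),
      (F ⟨C, (h.componentGraph hn C).cell T u⟩).1 = Γ.cell (T.map Fin.castSuccEmb) u.1.1 := by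
    intro C u
    exact (h.componentGraph_cell_eq_iff hn hT).1 ((h.componentGraph hn C).comp_rep _)
  refine Nat.card_congr (Equiv.ofBijective F ⟨?_, ?_⟩)
  · rintro ⟨C, σ⟩ ⟨D, τ⟩ hστ
    obtain ⟨u, rfl⟩ := (h.componentGraph hn C).comp_surjective _ σ
    obtain ⟨v, rfl⟩ := (h.componentGraph hn D).comp_surjective _ τ
    have h1 := Subtype.ext_iff.1 hστ
    rw [hF, hF] at h1
    have h2 : C = D := by
      rw [← u.2, ← v.2]
      exact h.compOf_eq_of_cell_eq hT.map (last_notMem_map_castSucc T) h1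
    subst h2
    rw [show (h.componentGraph hn C).comp _ u = (h.componentGraph hn C).comp _ v from
      (h.componentGraph_cell_eq_iff hn hT).2 h1]
  · rintro ⟨_, hlast, u, hu, rfl⟩
    exact ⟨⟨_, (h.componentGraph hn (h.compOf ⟨u, hu⟩)).cell T ⟨⟨u, hu⟩, rfl⟩⟩,
      Subtype.ext (hF _ ⟨⟨u, hu⟩, rfl⟩)⟩

end ColoredGraph
end

noncomputable section
set_option linter.unusedSectionVars false

/-! ## Counting cycles -/

namespace ColoredGraph

section

variable {d : ℕ} {V : Type} (Γ : ColoredGraph d V)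

theorem numCycles_comm (i j : Fin (d + 1)) : Γ.numCycles i j = Γ.numCycles j i := by
  rw [numCycles, numCycles, Set.pair_comm]

theorem numCycles_eq {i j : Fin (d + 1)} (hi : ∀ v, Γ.nbr i v ≠ v) (hj : ∀ v, Γ.nbr j v ≠ v)
    {S : Finset (Fin (d + 1))} (hS : (S : Set (Fin (d + 1)))ᶜ = {i, j}) :
    Γ.numCycles i j = Nat.card (Γ.Cell S) := by
  rw [numCycles, Cell, hS]
  refine Nat.card_congr (Equiv.subtypeUnivEquiv fun C v _ c hc => ?_)
  rcases hc with rfl | rfl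
  · exact hi v
  · exact hj v

theorem numCycles_last_add [Finite V] {i : Fin (d + 1)} (hi : i ≠ Fin.last d)
    {S : Finset (Fin (d + 1))} (hS : (S : Set (Fin (d + 1)))ᶜ = {i, Fin.last d}) :
    Γ.numCycles i (Fin.last d) + Γ.numCells Γ.IsBoundaryCell S = Nat.card (Γ.Cell S) := by
  classical
  have hlast : Fin.last d ∉ S := by
    have : Fin.last d ∈ (S : Set (Fin (d + 1)))ᶜ := by rw [hS]; simp
    simpa using this
  have h1 : ∀ C : Γ.Cell S, Γ.IsRegularComponent (S : Set (Fin (d + 1)))ᶜ C ↔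
      ¬ Γ.IsBoundaryCell S C := by
    intro C
    constructor
    · rintro hC ⟨-, u, hu, huC⟩
      exact hC u huC _ (by rw [hS]; simp) hu
    · intro hC v hv c hc hcv
      rw [hS] at hc
      rcases hc with rfl | rfl
      · exact Γ.nbr_ne _ v hi hcv
      · exact hC ⟨hlast, v, hcv, hv⟩
  have h2 : Γ.numCycles i (Fin.last d) = Nat.card {C : Γ.Cell S // ¬ Γ.IsBoundaryCell S C} := by
    rw [numCycles, ← hS]
    exact Nat.card_congr (Equiv.subtypeEquivRight h1)
  rw [h2, numCells, add_comm, ← Nat.card_sum]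
  exact Nat.card_congr (Equiv.sumCompl _)

theorem card_cell_univ_eq : Nat.card (Γ.Cell Finset.univ) = Nat.card V :=
  (Nat.card_congr (Equiv.ofBijective _ ⟨Γ.cell_univ_injective, Γ.comp_surjective _⟩)).symm

theorem card_internalVertex_add [Finite V] :
    Nat.card Γ.BoundaryVertex + Nat.card Γ.InternalVertex = Nat.card V := by
  classical
  rw [← Nat.card_congr (Equiv.sumCompl fun v => Γ.nbr (Fin.last d) v = v), Nat.card_sum]
  rfl

theorem numCells_boundary_of_last_mem {S : Finset (Fin (d + 1))} (hS : Fin.last d ∈ S) :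
    Γ.numCells Γ.IsBoundaryCell S = 0 :=
  Nat.card_eq_zero.2 (Or.inl ⟨fun σ => σ.2.1 hS⟩)

theorem coe_map_compl {κ : Type*} [Fintype κ] [DecidableEq κ] (ε : Equiv.Perm κ) {S : Finset κ}
    {a b : κ} (hS : Sᶜ = {a, b}) : ((S.map ε.toEmbedding : Finset κ) : Set κ)ᶜ = {ε a, ε b} := by
  ext x
  obtain ⟨y, rfl⟩ := ε.surjective x
  have : y ∈ Sᶜ ↔ y ∈ ({a, b} : Finset κ) := by rw [hS]
  simpa using this

theorem sum_supersets_map {κ : Type*} [Fintype κ] [DecidableEq κ] (ε : Equiv.Perm κ) (S : Finset κ)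
    (g : Finset κ → ℤ) : ∑ T ∈ Finset.univ.filter (S.map ε.toEmbedding ⊆ ·), g T =
      ∑ T, if S ⊆ T then g (T.map ε.toEmbedding) else 0 := by
  rw [← Finset.sum_filter]
  refine (Finset.sum_equiv (Equiv.finsetCongr ε) (fun T => ?_) fun T _ => rfl).symm
  simp [Equiv.finsetCongr_apply]

end

variable {n : ℕ} {V : Type} {Γ : ColoredGraph (n + 1) V}
  {E : Type*} [NormedAddCommGroup E] [NormedSpace ℝ E] {R : V → (Fin (n + 2) → ℝ) → E} {P : Set E}

theorem card_boundaryVertex_eq : Nat.card Γ.BoundaryVertex =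
    Γ.numCells Γ.IsBoundaryCell (Finset.univ.erase (Fin.last (n + 1))) := by
  refine Nat.card_congr (Equiv.ofBijective (fun u : Γ.BoundaryVertex =>
    ⟨Γ.cell _ u.1, Finset.notMem_erase _ _, u.1, u.2, rfl⟩) ⟨fun u v huv => ?_, ?_⟩)
  · exact Subtype.ext (cell_erase_last_injOn v.2 (Subtype.ext_iff.1 huv).symm)
  · rintro ⟨_, -, u, hu, rfl⟩
    exact ⟨⟨u, hu⟩, rfl⟩

/-- Sending a boundary vertex to its boundary cell with the complementary labels is constant along
edges of the boundary graph; injectivity on components is again `boundary_induction`. -/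
theorem IsManifoldRealization.numBoundaryCycles_eq (h : Γ.IsManifoldRealization R P) [Finite V]
    [FiniteDimensional ℝ E] {i j : Fin (n + 2)} (hi : i ≠ Fin.last (n + 1))
    (hj : j ≠ Fin.last (n + 1)) {S : Finset (Fin (n + 2))} (hS : S.Nonempty)
    (hSij : ∀ c, c ∉ S ↔ c = i ∨ c = j ∨ c = Fin.last (n + 1)) :
    Γ.numBoundaryCycles i j = Γ.numCells Γ.IsBoundaryCell S := by
  have hlast : Fin.last (n + 1) ∉ S := (hSij _).2 (Or.inr (Or.inr rfl))
  let F : Quot (fun u v : Γ.BoundaryVertex => ∃ c ∈ ({i, j} : Set (Fin (n + 2))),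
      Γ.BoundaryAdj c u v) → {σ : Γ.Cell S // Γ.IsBoundaryCell S σ} :=
    Quot.lift (fun u => ⟨Γ.cell S u.1, hlast, u.1, u.2, rfl⟩) (by
      rintro u v ⟨c, hc, -, huv⟩
      refine Subtype.ext (Γ.comp_mono ?_ huv)
      rintro _ (rfl | rfl)
      · simp only [Set.mem_compl_iff, Finset.mem_coe, hSij]
        rcases hc with rfl | rfl
        · exact Or.inl rfl
        · exact Or.inr (Or.inl rfl)
      · simpa using hlast)
  refine Nat.card_congr (Equiv.ofBijective F ⟨?_, ?_⟩)
  · intro a b hab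
    obtain ⟨u, rfl⟩ := Quot.mk_surjective a
    obtain ⟨v, rfl⟩ := Quot.mk_surjective b
    obtain ⟨hv, h1⟩ := h.boundary_induction hS hlast u.2 v.2 (Subtype.ext_iff.1 hab)
      (p := fun w => ∃ hw : Γ.nbr (Fin.last (n + 1)) w = w,
        Quot.mk (fun u v : Γ.BoundaryVertex => ∃ c ∈ ({i, j} : Set (Fin (n + 2))),
          Γ.BoundaryAdj c u v) u = Quot.mk _ ⟨w, hw⟩) ⟨u.2, rfl⟩ (by
        rintro w w' c hw hw' hcS hc hcomp ⟨_, hrel⟩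
        refine ⟨hw', hrel.trans ?_⟩
        by_cases hww : w = w'
        · subst hww; rfl
        · refine Quot.sound ⟨c, ?_, fun h' => hww (congrArg Subtype.val h'), hcomp⟩
          rcases (hSij c).1 hcS with h2 | h2 | h2
          · exact Or.inl h2
          · exact Or.inr h2
          · exact absurd h2 hc)
    exact h1
  · rintro ⟨_, -, u, hu, rfl⟩
    exact ⟨Quot.mk _ ⟨u, hu⟩, rfl⟩

/-! ## The genus of the boundary components -/

/-- Written out, the Dehn-Sommerville relations become linear equations from which the genus is
computed by linear arithmetic. -/
theorem alternating_sum_fin_four (g : Finset (Fin 4) → ℤ) : ∑ T, (-1) ^ (T.card + 1) * g T =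
    -g ∅ + g {0} + g {1} + g {2} + g {3} - g {0, 1} - g {0, 2} - g {0, 3} - g {1, 2} - g {1, 3}
    - g {2, 3} + g {0, 1, 2} + g {0, 1, 3} + g {0, 2, 3} + g {1, 2, 3} - g {0, 1, 2, 3} := by
  have h1 : (Finset.univ : Finset (Finset (Fin 4))) =
    {∅, {0}, {1}, {2}, {3}, {0, 1}, {0, 2}, {0, 3}, {1, 2}, {1, 3}, {2, 3}, {0, 1, 2}, {0, 1, 3},
    {0, 2, 3}, {1, 2, 3}, {0, 1, 2, 3}} := by
    decide +kernel
  rw [h1]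
  repeat rw [Finset.sum_insert (by decide +kernel)]
  rw [Finset.sum_singleton]
  simp [Finset.card_insert_of_notMem]
  ring

theorem regularGenus_le_of_isCrystallization {d : ℕ} {V : Type} [Finite V] (Γ : ColoredGraph d V)
    {E : Type*} [AddCommGroup E] [Module ℝ E] [TopologicalSpace E] {Q : Set E}
    (hQ : Γ.IsCrystallization Q) (ε : CyclicOrder d) :
    _root_.regularGenus d Q ≤ (Γ.rho ε : EReal) := by
  have h1 : _root_.regularGenus d Q ≤ (Γ.regularGenus : EReal) := sInf_le ⟨V, inferInstance, Γ, hQ, rfl⟩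
  refine h1.trans (EReal.coe_le_coe_iff.2 ?_)
  have : Finite (CyclicOrder d) :=
    inferInstanceAs (Finite {ε : Equiv.Perm (Fin (d + 1)) // ε (Fin.last d) = Fin.last d})
  exact ciInf_le (Set.finite_range _).bddBelow ε

section ThreeDimensional

variable {W : Type} [Finite W] (Λ : ColoredGraph 3 W)

/-- In a closed 3-dimensional crystallization the Dehn-Sommerville relations determine the sum of
the four cycle numbers from the number of graph vertices and of edges labelled `ε 1`, `ε 3`. The
genus is then the first Betti number of the graph formed by these edges, which has two vertices. -/
theorem rho_three (hne : ∀ c v, Λ.nbr c v ≠ v)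
    (hrel : ∀ S : Finset (Fin 4), S.Nonempty → (-1) ^ 3 * (Nat.card (Λ.Cell S) : ℤ) =
      ∑ T ∈ Finset.univ.filter (S ⊆ ·), (-1) ^ (T.card + 1) * (Nat.card (Λ.Cell T) : ℤ))
    (hone : ∀ a, Nat.card (Λ.Cell {a}) = 1) (ε : CyclicOrder 3) :
    Λ.rho ε = Nat.card (Λ.Cell {ε.1 1, ε.1 3}) - 1 := by
  set F : Finset (Fin 4) → ℤ := fun T => Nat.card (Λ.Cell (T.map ε.1.toEmbedding)) with hF
  have hrel' : ∀ S : Finset (Fin 4), S.Nonempty → - F S =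
      ∑ T, (-1) ^ (T.card + 1) * if S ⊆ T then F T else 0 := by
    intro S hS
    have h1 := hrel (S.map ε.1.toEmbedding) hS.map
    rw [sum_supersets_map ε.1 S fun T => (-1) ^ (T.card + 1) * (Nat.card (Λ.Cell T) : ℤ)] at h1
    simp only [Finset.card_map] at h1
    simp only [mul_ite, mul_zero]
    rw [← h1]
    ring
  have hone' : ∀ a, F {a} = 1 := fun a => by simp [hF, hone]
  have hcyc : ∀ (S : Finset (Fin 4)) (a b : Fin 4), Sᶜ = {a, b} →
      (Λ.numCycles (ε.1 a) (ε.1 b) : ℤ) = F S := fun S a b hS => by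
    rw [Λ.numCycles_eq (hne _) (hne _) (coe_map_compl ε.1 hS)]
  have hB : IsEmpty Λ.BoundaryVertex := ⟨fun v => hne _ v.1 v.2⟩
  have hB0 : Nat.card Λ.BoundaryVertex = 0 := Nat.card_eq_zero.2 (Or.inl hB)
  have hI : (Nat.card Λ.InternalVertex : ℤ) = F {0, 1, 2, 3} := by
    have h1 := Λ.card_internalVertex_add
    rw [hB0, zero_add] at h1
    rw [h1, ← Λ.card_cell_univ_eq]
    have : ({0, 1, 2, 3} : Finset (Fin 4)) = Finset.univ := by decide
    simp [hF, this]
  have hholes : Λ.numHoles ε = 0 :=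
    Nat.card_eq_zero.2 (Or.inl ⟨fun q => by
      obtain ⟨v, -⟩ := Quot.mk_surjective q
      exact hB.false v⟩)
  have h13 : (Nat.card (Λ.Cell {ε.1 1, ε.1 3}) : ℤ) = F {1, 3} := by simp [hF]
  have e1 := hcyc {2, 3} 0 1 (by decide)
  have e2 := hcyc {0, 3} 1 2 (by decide)
  have e3 := hcyc {0, 1} 2 3 (by decide)
  have e4 := hcyc {1, 2} 3 0 (by decide)
  have r1 := hrel' {1} (by simp)
  have r3 := hrel' {3} (by simp)
  have r012 := hrel' {0, 1, 2} (by simp)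
  have r013 := hrel' {0, 1, 3} (by simp)
  have r023 := hrel' {0, 2, 3} (by simp)
  have r123 := hrel' {1, 2, 3} (by simp)
  rw [alternating_sum_fin_four] at r1 r3 r012 r013 r023 r123
  simp +decide only [if_true, if_false, hone'] at r1 r3 r012 r013 r023 r123
  norm_num at r1 r3 r012 r013 r023 r123
  have key : (Λ.numCycles (ε.1 0) (ε.1 1) + Λ.numCycles (ε.1 1) (ε.1 2) +
      Λ.numCycles (ε.1 2) (ε.1 3) + Λ.numCycles (ε.1 3) (ε.1 0) : ℤ) =
      4 + Nat.card Λ.InternalVertex - 2 * Nat.card (Λ.Cell {ε.1 1, ε.1 3}) := by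
    rw [e1, e2, e3, e4, hI, h13]
    linarith
  have key' : (Λ.numCycles (ε.1 0) (ε.1 1) + Λ.numCycles (ε.1 1) (ε.1 2) +
      Λ.numCycles (ε.1 2) (ε.1 3) + Λ.numCycles (ε.1 3) (ε.1 0) : ℝ) =
      4 + Nat.card Λ.InternalVertex - 2 * Nat.card (Λ.Cell {ε.1 1, ε.1 3}) := by
    exact_mod_cast key
  rw [rho, surfaceChi, hholes, hB0, Fin.sum_univ_four]
  simp only [Fin.isValue, Fin.reduceAdd] 
  push_cast
  linarith

end ThreeDimensional

section

variable {V : Type} [Finite V] {Γ : ColoredGraph 4 V} {E : Type*} [NormedAddCommGroup E]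
  [NormedSpace ℝ E] [FiniteDimensional ℝ E] {R : V → (Fin 5 → ℝ) → E} {P : Set E}
  {h : Γ.IsManifoldRealization R P}

theorem IsManifoldRealization.IsMinimal.regularGenus_carrier_le (hm : h.IsMinimal)
    (hPL : ∀ u, IsPL (stdSimplex ℝ (Fin 5)) (fun x => R u x.1)) (C : BoundaryComponent 4 P)
    {q : Fin 4} (hq : q ≠ 3) : _root_.regularGenus 3 C.carrier ≤
      ((Nat.card ((h.componentGraph three_pos C).Cell {q, 3}) - 1 : ℝ) : EReal) := by
  have hcr := hm.isCrystallization_componentGraph three_pos hPL C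
  -- The transposition of 1 and `q` puts `q` in position 1 and fixes the last colour 3 because `q ≠
  -- 3`.
  have h3 : Equiv.swap (1 : Fin 4) q 3 = 3 := Equiv.swap_apply_of_ne_of_ne (by decide) hq.symm
  let ε : CyclicOrder 3 := ⟨Equiv.swap 1 q, h3⟩
  have hε1 : ε.1 1 = q := Equiv.swap_apply_left _ _
  have hε3 : ε.1 3 = 3 := h3
  refine (regularGenus_le_of_isCrystallization _ hcr ε).trans ?_
  · rw [rho_three _ (h.componentGraph_nbr_ne three_pos C)
      (fun S hS => h.sum_card_componentGraph three_pos C hS)]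
    · rw [hε1, hε3]
    · intro a
      rw [Nat.card_eq_one_iff_unique]
      obtain ⟨hne, hcon⟩ : (h.componentGraph three_pos C).IsContracted := by
        rcases hcr.2 with h1 | h1
        · exact h1.2
        · exact absurd (h.plBoundary_carrier three_pos C) h1.1.ne_empty
      refine ⟨⟨fun σ τ => ?_⟩, ⟨(h.componentGraph three_pos C).cell {a} hne.some⟩⟩
      obtain ⟨u, rfl⟩ := (h.componentGraph three_pos C).comp_surjective _ σ
      obtain ⟨v, rfl⟩ := (h.componentGraph three_pos C).comp_surjective _ τ
      refine (h.componentGraph three_pos C).comp_mono ?_ (hcon a u v)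
      rw [Finset.coe_singleton]

theorem IsManifoldRealization.IsMinimal.boundaryRegularGenus_le (hm : h.IsMinimal)
    (hPL : ∀ u, IsPL (stdSimplex ℝ (Fin 5)) (fun x => R u x.1)) {q : Fin 4} (hq : q ≠ 3) :
    boundaryRegularGenus 3 P ≤ ((Γ.numCells Γ.IsBoundaryCell {q.castSucc, 3} -
      numBoundaryComponents 4 P : ℝ) : EReal) := by
  have := h.finite_boundaryComponent
  have := Fintype.ofFinite (BoundaryComponent 4 P)
  rw [boundaryRegularGenus, finsum_eq_sum_of_fintype]
  refine (Finset.sum_le_sum fun C _ => hm.regularGenus_carrier_le hPL C hq).trans ?_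
  have h1 := h.sum_card_cell_componentGraph three_pos (T := {q, 3}) (by simp)
  have h2 : (∑ C : BoundaryComponent 4 P,
      ((Nat.card ((h.componentGraph three_pos C).Cell {q, 3}) : ℝ) - 1)) =
      Γ.numCells Γ.IsBoundaryCell {q.castSucc, 3} - numBoundaryComponents 4 P := by
    rw [Finset.sum_sub_distrib, ← Nat.cast_sum, h1, numBoundaryComponents, Nat.card_eq_fintype_card]
    simp [Finset.map_insert]
  rw [← h2]
  exact le_of_eq (map_sum (⟨⟨Real.toEReal, EReal.coe_zero⟩, EReal.coe_add⟩ : ℝ →+ EReal) _ _).symm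

end

end ColoredGraph
end

noncomputable section
set_option linter.unusedSectionVars false

/-! ## The genus of a crystallization of a manifold of dimension four -/

namespace ColoredGraph

theorem alternating_sum_fin_five (g : Finset (Fin 5) → ℤ) : ∑ T, (-1) ^ (T.card + 1) * g T =
    -g ∅ + g {0} + g {1} + g {2} + g {3} + g {4} - g {0, 1} - g {0, 2} - g {0, 3} - g {0, 4} - g
    {1, 2} - g {1, 3} - g {1, 4} - g {2, 3} - g {2, 4} - g {3, 4} + g {0, 1, 2} + g {0, 1, 3} +
    g {0, 1, 4} + g {0, 2, 3} + g {0, 2, 4} + g {0, 3, 4} + g {1, 2, 3} + g {1, 2, 4} + g {1, 3,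
    4} + g {2, 3, 4} - g {0, 1, 2, 3} - g {0, 1, 2, 4} - g {0, 1, 3, 4} - g {0, 2, 3, 4} - g {1,
    2, 3, 4} + g {0, 1, 2, 3, 4} := by
  have h1 : (Finset.univ : Finset (Finset (Fin 5))) =
    {∅, {0}, {1}, {2}, {3}, {4}, {0, 1}, {0, 2}, {0, 3}, {0, 4}, {1, 2}, {1, 3}, {1, 4}, {2, 3},
    {2, 4}, {3, 4}, {0, 1, 2}, {0, 1, 3}, {0, 1, 4}, {0, 2, 3}, {0, 2, 4}, {0, 3, 4}, {1, 2, 3},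
    {1, 2, 4}, {1, 3, 4}, {2, 3, 4}, {0, 1, 2, 3}, {0, 1, 2, 4}, {0, 1, 3, 4}, {0, 2, 3, 4}, {1,
    2, 3, 4}, {0, 1, 2, 3, 4}} := by
    decide +kernel
  rw [h1]
  repeat rw [Finset.sum_insert (by decide +kernel)]
  rw [Finset.sum_singleton]
  simp [Finset.card_insert_of_notMem]
  ring

section

variable {V : Type} [Finite V] {Γ : ColoredGraph 4 V} {E : Type*} [NormedAddCommGroup E]
  [NormedSpace ℝ E] [FiniteDimensional ℝ E] {R : V → (Fin 5 → ℝ) → E} {P : Set E}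
  {h : Γ.IsManifoldRealization R P}

theorem IsManifoldRealization.sum_numCells_map (h : Γ.IsManifoldRealization R P)
    (ε : Equiv.Perm (Fin 5)) {S : Finset (Fin 5)} (hS : S.Nonempty) :
    (Nat.card (Γ.Cell (S.map ε.toEmbedding)) : ℤ) -
        Γ.numCells Γ.IsBoundaryCell (S.map ε.toEmbedding) =
      ∑ T, (-1) ^ (T.card + 1) *
        if S ⊆ T then (Nat.card (Γ.Cell (T.map ε.toEmbedding)) : ℤ) else 0 := by
  have h1 := h.sum_numCells (S := S.map ε.toEmbedding) hS.map
  rw [sum_supersets_map ε S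
    fun T => (-1) ^ (T.card + 1) * (Γ.numCells (fun _ _ => True) T : ℤ)] at h1
  simp only [Finset.card_map, numCells_true] at h1
  simp only [mul_ite, mul_zero]
  rw [← h1]
  ring

theorem IsManifoldRealization.hasEuler_map (h : Γ.IsManifoldRealization R P)
    (ε : Equiv.Perm (Fin 5)) : HasEuler (ind P) (∑ T : Finset (Fin 5), (-1) ^ (T.card + 1) *
      if T.Nonempty then (Nat.card (Γ.Cell (T.map ε.toEmbedding)) : ℤ) else 0) := by
  have h1 := h.real.hasEuler_cells fun _ _ => True
  rw [← h.eq_cells] at h1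
  convert h1 using 1
  rw [Finset.sum_filter]
  refine Finset.sum_equiv (Equiv.finsetCongr ε) (fun T => by simp) fun T _ => ?_
  simp [Equiv.finsetCongr_apply, numCells_true]

theorem IsManifoldRealization.IsMinimal.numCells_singleton (hm : h.IsMinimal) {a : Fin 5}
    (ha : a ≠ Fin.last 4) :
    Γ.numCells Γ.IsBoundaryCell {a} = numBoundaryComponents 4 P := by
  rw [← hm.card_vertex a ha]
  exact Nat.card_congr (Equiv.subtypeUnivEquiv (hm.isBoundaryCell a ha))

/-- Cycles, graph vertices and holes are numbers of cells or of boundary cells; after relabelling by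
`ε`, the Dehn-Sommerville relations and the formula for `χ` are linear equations between them.
Eliminating everything except pairs of labels gives the genus. -/
theorem IsManifoldRealization.IsMinimal.rho_eq (hm : h.IsMinimal) {χ : ℤ}
    (hχ : HasEuler (ind P) χ) (ε : CyclicOrder 4) :
    Γ.numCells Γ.IsBoundaryCell {ε.1 1, ε.1 3} = Γ.numCells Γ.IsBoundaryCell {ε.1 0, ε.1 2} ∧
    Γ.rho ε = 2 * χ + Nat.card (Γ.Cell {ε.1 0, ε.1 2}) + Nat.card (Γ.Cell {ε.1 1, ε.1 3}) +
      Nat.card (Γ.Cell {ε.1 0, ε.1 3}) + Nat.card (Γ.Cell {ε.1 2, 4}) +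
      Nat.card (Γ.Cell {ε.1 1, 4}) - 1 - 4 * numBoundaryComponents 4 P -
      Γ.numCells Γ.IsBoundaryCell {ε.1 0, ε.1 2} - Γ.numCells Γ.IsBoundaryCell {ε.1 0, ε.1 3} := by
  have hε : ε.1 4 = 4 := ε.2
  have hlt : ∀ a : Fin 5, a ≠ 4 → ε.1 a ≠ 4 := fun a ha h4 => ha (ε.1.injective (h4.trans hε.symm))
  set F : Finset (Fin 5) → ℤ := fun T => Nat.card (Γ.Cell (T.map ε.1.toEmbedding)) with hF
  set N : Finset (Fin 5) → ℤ :=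
    fun T => Γ.numCells Γ.IsBoundaryCell (T.map ε.1.toEmbedding) with hN
  have hrel : ∀ S : Finset (Fin 5), S.Nonempty → F S - N S =
      ∑ T, (-1) ^ (T.card + 1) * if S ⊆ T then F T else 0 := fun S hS => h.sum_numCells_map ε.1 hS
  have hχ' : χ = ∑ T, (-1) ^ (T.card + 1) * if T.Nonempty then F T else 0 :=
    hχ.unique (h.hasEuler_map ε.1)
  have hN4 : ∀ T : Finset (Fin 5), 4 ∈ T → N T = 0 := fun T hT => by
    rw [hN]
    have h4 : (4 : Fin 5) ∈ T.map ε.1.toEmbedding :=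
      Finset.mem_map.2 ⟨4, hT, hε⟩
    exact Nat.cast_eq_zero.2 (Γ.numCells_boundary_of_last_mem h4)
  have hF1 : ∀ a : Fin 5, a ≠ 4 → F {a} = numBoundaryComponents 4 P := fun a ha => by
    simp only [hF, Finset.map_singleton]
    exact congrArg Nat.cast (hm.card_vertex _ (hlt a ha))
  have hN1 : ∀ a : Fin 5, a ≠ 4 → N {a} = numBoundaryComponents 4 P := fun a ha => by
    simp only [hN, Finset.map_singleton]
    exact congrArg Nat.cast (hm.numCells_singleton (hlt a ha))
  have hF4 : F {4} = 1 := by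
    simp only [hF, Finset.map_singleton]
    have h4 : (ε.1.toEmbedding : Fin 5 ↪ Fin 5) 4 = 4 := hε
    rw [h4]
    exact congrArg Nat.cast hm.card_last
  have hcyc : ∀ (S : Finset (Fin 5)) (a b : Fin 5), a ≠ 4 → b ≠ 4 → Sᶜ = {a, b} →
      (Γ.numCycles (ε.1 a) (ε.1 b) : ℤ) = F S := fun S a b ha hb hS => by
    rw [Γ.numCycles_eq (fun v => Γ.nbr_ne _ v (hlt a ha)) (fun v => Γ.nbr_ne _ v (hlt b hb))
      (coe_map_compl ε.1 hS)]
  -- A component with the colours `ε a` and 4 is either a cycle or a path ending at boundary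
  -- vertices; the paths correspond to the boundary cells and are subtracted.
  have hcyc4 : ∀ (S : Finset (Fin 5)) (a : Fin 5), a ≠ 4 → Sᶜ = {a, 4} →
      (Γ.numCycles (ε.1 a) (ε.1 4) : ℤ) = F S - N S := fun S a ha hS => by
    have h1 : ((S.map ε.1.toEmbedding : Finset (Fin 5)) : Set (Fin 5))ᶜ = {ε.1 a, 4} := by
      rw [coe_map_compl ε.1 hS, hε]
    have h2 := Γ.numCycles_last_add (hlt a ha) h1
    rw [hε, eq_sub_iff_add_eq]
    exact congrArg Nat.cast h2
  have e1 := hcyc {2, 3, 4} 0 1 (by decide) (by decide) (by decide)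
  have e2 := hcyc {0, 3, 4} 1 2 (by decide) (by decide) (by decide)
  have e3 := hcyc {0, 1, 4} 2 3 (by decide) (by decide) (by decide)
  have e4 := hcyc4 {0, 1, 2} 3 (by decide) (by decide)
  have e5 := hcyc4 {1, 2, 3} 0 (by decide) (by decide)
  rw [numCycles_comm] at e5
  have hB : (Nat.card Γ.BoundaryVertex : ℤ) = N {0, 1, 2, 3} := by
    rw [Γ.card_boundaryVertex_eq]
    have h1 : ({0, 1, 2, 3} : Finset (Fin 5)).map ε.1.toEmbedding =
        Finset.univ.erase (Fin.last 4) := by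
      have h2 : ({0, 1, 2, 3} : Finset (Fin 5)) = Finset.univ.erase 4 := by decide
      rw [h2, Finset.map_erase, Finset.map_univ_equiv]
      exact congrArg _ hε
    simp only [hN, h1]
  have hI : (Nat.card Γ.InternalVertex : ℤ) = F {0, 1, 2, 3, 4} - N {0, 1, 2, 3} := by
    have h1 := Γ.card_internalVertex_add
    rw [← Γ.card_cell_univ_eq] at h1
    have h2 : ({0, 1, 2, 3, 4} : Finset (Fin 5)) = Finset.univ := by decide
    have h3 : F {0, 1, 2, 3, 4} = Nat.card (Γ.Cell Finset.univ) := by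
      simp [hF, h2]
    rw [← hB, h3, ← h1]
    push_cast
    ring
  -- The holes are the cycles of the boundary graph with the colours `ε 0` and `ε 3`, hence the
  -- boundary edges with the complementary labels `ε 1` and `ε 2`.
  have hholes : (Γ.numHoles ε : ℤ) = N {1, 2} := by
    rw [numHoles]
    have h1 : (Fin.last 4 - 1 : Fin 5) = 3 := by decide
    rw [h1, h.numBoundaryCycles_eq (S := ({1, 2} : Finset (Fin 5)).map ε.1.toEmbedding)
      (hlt 0 (by decide)) (hlt 3 (by decide))]
    · simp
    · intro c
      obtain ⟨a, rfl⟩ := ε.1.surjective c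
      have h2 : ε.1 a = Fin.last 4 ↔ a = 4 :=
        ⟨fun ha => by_contra fun h4 => hlt a h4 ha, fun ha => ha ▸ hε⟩
      rw [h2, ε.1.injective.eq_iff, ε.1.injective.eq_iff, Finset.mem_map_equiv,
        Equiv.symm_apply_apply]
      clear h2
      revert a
      decide
  have r1234 := hrel {1, 2, 3, 4} (by simp)
  have r0234 := hrel {0, 2, 3, 4} (by simp)
  have r0134 := hrel {0, 1, 3, 4} (by simp)
  have r0124 := hrel {0, 1, 2, 4} (by simp)
  have r0123 := hrel {0, 1, 2, 3} (by simp)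
  have r123 := hrel {1, 2, 3} (by simp)
  have r012 := hrel {0, 1, 2} (by simp)
  have r34 := hrel {3, 4} (by simp)
  have r24 := hrel {2, 4} (by simp)
  have r14 := hrel {1, 4} (by simp)
  have r04 := hrel {0, 4} (by simp)
  have r12 := hrel {1, 2} (by simp)
  have r03 := hrel {0, 3} (by simp)
  have r02 := hrel {0, 2} (by simp)
  have r13 := hrel {1, 3} (by simp)
  have r3 := hrel {3} (by simp)
  have r2 := hrel {2} (by simp)
  have r1 := hrel {1} (by simp)
  have r0 := hrel {0} (by simp)
  rw [alternating_sum_fin_five] at hχ' r1234 r0234 r0134 r0124 r0123 r123 r012 r34 r24 r14 r04 r12 r03 r02 r13 r3 r2 r1 r0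
  simp +decide only [if_true, if_false, hN4 {1, 2, 3, 4} (by decide), hN4 {0, 2, 3, 4} (by decide), hN4 {0, 1, 3,
    4} (by decide), hN4 {0, 1, 2, 4} (by decide), hN4 {3, 4} (by decide), hN4 {2, 4} (by decide),
    hN4 {1, 4} (by decide), hN4 {0, 4} (by decide), hF1 0 (by decide), hF1 1 (by decide), hF1 2 (by
    decide), hF1 3 (by decide), hN1 0 (by decide), hN1 1 (by decide), hN1 2 (by decide), hN1 3 (by
    decide), hF4]
    at hχ' r1234 r0234 r0134 r0124 r0123 r123 r012 r34 r24 r14 r04 r12 r03 r02 r13 r3 r2 r1 r0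
  -- All labels below 4 have equally many boundary vertices. The relations therefore force
  -- complementary pairs of these labels to have equally many boundary edges.
  have n13 : N {1, 3} = N {0, 2} := by
    linarith only [r1234, r0234, r0134, r0124, r34, r24, r14, r13, r04, r02, r3, r2, r1, r0]
  have n12 : N {1, 2} = N {0, 3} := by
    linarith only [r1234, r0234, r0134, r0124, r34, r24, r14, r12, r04, r03, r3, r2, r1, r0]
  -- Four times the genus, so that the halves of the vertex numbers leave no denominators and the
  -- computation stays in the integers.
  have key : (4 : ℤ) - 2 * (Γ.numCycles (ε.1 0) (ε.1 1) + Γ.numCycles (ε.1 1) (ε.1 2) +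
      Γ.numCycles (ε.1 2) (ε.1 3) + Γ.numCycles (ε.1 3) (ε.1 4) + Γ.numCycles (ε.1 4) (ε.1 0)) +
      3 * Nat.card Γ.InternalVertex + 2 * Nat.card Γ.BoundaryVertex - 2 * Γ.numHoles ε =
      4 * (2 * χ + F {0, 2} + F {1, 3} + F {0, 3} + F {2, 4} + F {1, 4} - 1 -
      4 * numBoundaryComponents 4 P - N {0, 2} - N {0, 3}) := by
    rw [e1, e2, e3, e4, e5, hI, hB, hholes, n12]
    linarith only [hχ', r1234, r0234, r0134, r0124, r0123, r123, r012, r34, r14, r12, r03, r02, r3,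
      r2, r0, n12, n13]
  have hFp : ∀ a b : Fin 5, (Nat.card (Γ.Cell {ε.1 a, ε.1 b}) : ℤ) = F {a, b} := fun a b => by
    simp [hF]
  have hNp : ∀ a b : Fin 5, (Γ.numCells Γ.IsBoundaryCell {ε.1 a, ε.1 b} : ℤ) = N {a, b} :=
    fun a b => by simp [hN]
  refine ⟨by exact_mod_cast (hNp 1 3).trans (n13.trans (hNp 0 2).symm), ?_⟩
  rw [← hFp, ← hFp, ← hFp, ← hFp, ← hFp, ← hNp, ← hNp, hε] at key
  have key' : (4 : ℝ) - 2 * (Γ.numCycles (ε.1 0) (ε.1 1) + Γ.numCycles (ε.1 1) (ε.1 2) +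
      Γ.numCycles (ε.1 2) (ε.1 3) + Γ.numCycles (ε.1 3) 4 + Γ.numCycles 4 (ε.1 0)) +
      3 * Nat.card Γ.InternalVertex + 2 * Nat.card Γ.BoundaryVertex - 2 * Γ.numHoles ε =
      4 * (2 * χ + Nat.card (Γ.Cell {ε.1 0, ε.1 2}) + Nat.card (Γ.Cell {ε.1 1, ε.1 3}) +
      Nat.card (Γ.Cell {ε.1 0, ε.1 3}) + Nat.card (Γ.Cell {ε.1 2, 4}) +
      Nat.card (Γ.Cell {ε.1 1, 4}) - 1 - 4 * numBoundaryComponents 4 P -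
      Γ.numCells Γ.IsBoundaryCell {ε.1 0, ε.1 2} -
      Γ.numCells Γ.IsBoundaryCell {ε.1 0, ε.1 3}) := by
    exact_mod_cast key
  rw [rho, surfaceChi, Fin.sum_univ_five]
  simp only [Fin.isValue, Fin.reduceAdd, hε]
  push_cast
  linarith only [key']

/-- The bound `boundaryRegularGenus_le` concerns pairs of labels containing 3. Wherever `ε` places
the label 3, it belongs to one of the pairs `ε 0`, `ε 2` and `ε 1`, `ε 3`, and both have the same
number of boundary edges. -/
theorem IsManifoldRealization.IsMinimal.boundaryRegularGenus_le_of_cyclicOrder (hm : h.IsMinimal)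
    (hPL : ∀ u, IsPL (stdSimplex ℝ (Fin 5)) (fun x => R u x.1)) {χ : ℤ}
    (hχ : HasEuler (ind P) χ) (ε : CyclicOrder 4) :
    boundaryRegularGenus 3 P ≤ ((Γ.numCells Γ.IsBoundaryCell {ε.1 0, ε.1 2} -
      numBoundaryComponents 4 P : ℝ) : EReal) := by
  have hε : ε.1 4 = 4 := ε.2
  have key : ∀ a b : Fin 5, ε.1 a = 3 → a ≠ b → b ≠ 4 → boundaryRegularGenus 3 P ≤
      ((Γ.numCells Γ.IsBoundaryCell {ε.1 a, ε.1 b} - numBoundaryComponents 4 P : ℝ) : EReal) := by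
    intro a b ha hab hb
    have h4 : ε.1 b ≠ Fin.last 4 := fun h4 => hb (ε.1.injective (h4.trans hε.symm))
    obtain ⟨q, hq⟩ := Fin.exists_castSucc_eq.2 h4
    have hq3 : q ≠ 3 := by
      rintro rfl
      exact hab (ε.1.injective (ha.trans hq))
    have := hm.boundaryRegularGenus_le hPL hq3
    rwa [hq, ← ha, Finset.pair_comm] at this
  obtain ⟨a, ha⟩ := ε.1.surjective 3
  have ha4 : a ≠ 4 := by
    rintro rfl
    exact absurd (ha.symm.trans hε) (by decide)
  have h13 := (hm.rho_eq hχ ε).1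
  obtain rfl | rfl | rfl | rfl : a = 0 ∨ a = 1 ∨ a = 2 ∨ a = 3 := by
    clear ha
    revert a
    decide
  · exact key 0 2 ha (by decide) (by decide)
  · rw [← h13]
    exact key 1 3 ha (by decide) (by decide)
  · rw [Finset.pair_comm]
    exact key 2 0 ha (by decide) (by decide)
  · rw [← h13, Finset.pair_comm]
    exact key 3 1 ha (by decide) (by decide)

end

end ColoredGraph

/-! ### From the cell counts to the three inequalities -/

theorem groupRank_nonneg (G : Type*) [Group G] : 0 ≤ groupRank G := by
  refine le_sInf ?_
  rintro _ ⟨S, -, rfl⟩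
  exact_mod_cast Nat.zero_le S.card

/-- The ranks are finite, so the estimates can be combined in the real numbers. -/
theorem exists_groupRank_eq {G : Type*} [Group G] {r : ℝ} (hr : groupRank G ≤ (r : EReal)) :
    ∃ m : ℝ, groupRank G = (m : EReal) := by
  refine ⟨(groupRank G).toReal, (EReal.coe_toReal ?_ ?_).symm⟩
  · exact ne_top_of_le_ne_top (EReal.coe_ne_top r) hr
  · exact ne_bot_of_le_ne_bot EReal.zero_ne_bot (groupRank_nonneg G)

namespace ColoredGraph

theorem exists_regularGenus_eq_rho {d : ℕ} {V : Type} (Γ : ColoredGraph d V) :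
    ∃ ε : CyclicOrder d, Γ.regularGenus = Γ.rho ε := by
  have : Finite (CyclicOrder d) :=
    inferInstanceAs (Finite {ε : Equiv.Perm (Fin (d + 1)) // ε (Fin.last d) = Fin.last d})
  have : Nonempty (CyclicOrder d) := ⟨⟨Equiv.refl _, rfl⟩⟩
  obtain ⟨ε, hε⟩ := exists_eq_ciInf_of_finite (f := Γ.rho)
  exact ⟨ε, hε.symm⟩

/-- The three inequalities for a single crystallization. The real number `b` is only an upper bound
for the genus of the boundary, which is enough because that genus appears on the smaller side. -/
theorem IsCrystallization.bounds {V : Type} [Finite V] {Γ : ColoredGraph 4 V} {E : Type*}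
    [NormedAddCommGroup E] [NormedSpace ℝ E] [FiniteDimensional ℝ E] {P : Set E}
    (hΓ : Γ.IsCrystallization P) (hP : IsPLManifold 4 P) (hbd : (plBoundary 4 P).Nonempty)
    {χ : ℤ} (hχ : HasEuler (ind P) χ) (x : P) (y : Double 4 P) :
    ∃ m m' b : ℝ, groupRank (FundamentalGroup P x) = m ∧
      groupRank (FundamentalGroup (Double 4 P) y) = m' ∧ boundaryRegularGenus 3 P ≤ (b : EReal) ∧
      2 * χ + 2 * m' - 2 ≤ Γ.regularGenus ∧
      2 * χ + 3 * m + 2 * numBoundaryComponents 4 P - 4 ≤ Γ.regularGenus ∧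
      b + 2 * χ + 2 * m + 2 * numBoundaryComponents 4 P - 4 ≤ Γ.regularGenus := by
  obtain ⟨⟨f, hf⟩, h0 | ⟨-, hconn, hcard⟩⟩ := hΓ
  · exact absurd h0.1 hbd.ne_empty
  have := hconn.1
  obtain ⟨R, hR, hRf⟩ := exists_isRealization f hf
  have h : Γ.IsManifoldRealization R P := by
    refine ⟨hR, hP, fun z => ⟨fun hz => ?_, ?_⟩⟩
    · obtain ⟨u, s, hs⟩ := Γ.exists_charMap (f.symm ⟨z, hz⟩)
      refine ⟨u, s.1, s.2, ?_⟩
      rw [hRf, hs, f.apply_symm_apply]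
    · rintro ⟨u, s, hs, rfl⟩
      rw [hRf u ⟨s, hs⟩]
      exact Subtype.property _
  have hm : h.IsMinimal := h.isMinimal hcard
  have hPL : ∀ u, IsPL (stdSimplex ℝ (Fin 5)) (fun s => R u s.1) := fun u => by
    simpa only [hRf] using hf u
  have hb : ∃ u, Γ.nbr (Fin.last 4) u = u := by
    obtain ⟨z, hz⟩ := hbd
    obtain ⟨u, hu, -⟩ := h.mem_plBoundary_iff.1 hz
    exact ⟨u, hu⟩
  obtain ⟨F⟩ := nonempty_homeomorph_double (n := 4) f fun p => by
    rw [h.mem_plBoundary_iff]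
    constructor
    · rintro ⟨u, hu, s, hs, hs0, hsp⟩
      refine ⟨u, hu, ⟨s, hs⟩, hs0, Subtype.ext ?_⟩
      rw [← hsp, hRf u ⟨s, hs⟩]
    · rintro ⟨u, hu, s, hs0, rfl⟩
      exact ⟨u, hu, s.1, s.2, hs0, hRf u s⟩
  have hdconn := Γ.double_isConnected hconn hb
  obtain ⟨ε, hε⟩ := Γ.exists_regularGenus_eq_rho
  have hε4 : ε.1 4 = 4 := ε.2
  have hlt : ∀ a : Fin 5, a ≠ 4 → ε.1 a ≠ Fin.last 4 :=
    fun a ha h4 => ha (ε.1.injective (h4.trans hε4.symm))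
  have hne : ∀ a b : Fin 5, a ≠ b → ε.1 a ≠ ε.1 b := fun a b hab => ε.1.injective.ne hab
  have hrank : ∀ a b : Fin 5, a ≠ b → _ := fun a b hab =>
    Γ.groupRank_le_of_homeomorph hconn (hne a b hab) f x
  have hrank' : ∀ a b : Fin 5, a ≠ b → _ := fun a b hab =>
    Γ.double.groupRank_le_of_homeomorph hdconn (hne a b hab) F y
  obtain ⟨m, hmeq⟩ := exists_groupRank_eq (hrank 0 2 (by decide))
  obtain ⟨m', hmeq'⟩ := exists_groupRank_eq (hrank' 0 2 (by decide))
  simp only [hmeq, EReal.coe_le_coe_iff] at hrank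
  simp only [hmeq', EReal.coe_le_coe_iff] at hrank'
  have hdcard : ∀ S, (Nat.card (Γ.double.Cell S) : ℝ) =
      2 * Nat.card (Γ.Cell S) - Γ.numCells Γ.IsBoundaryCell S := fun S => by
    rw [eq_sub_iff_add_eq]
    exact_mod_cast Γ.card_double_cell S
  simp only [hdcard] at hrank'
  have hv : ∀ a : Fin 5, a ≠ 4 → (Nat.card (Γ.Cell {ε.1 a}) : ℝ) = numBoundaryComponents 4 P :=
    fun a ha => congrArg Nat.cast (hm.card_vertex _ (hlt a ha))
  have hv' : ∀ a : Fin 5, a ≠ 4 →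
      (Γ.numCells Γ.IsBoundaryCell {ε.1 a} : ℝ) = numBoundaryComponents 4 P :=
    fun a ha => congrArg Nat.cast (hm.numCells_singleton (hlt a ha))
  have hv4 : (Nat.card (Γ.Cell {4}) : ℝ) = 1 := by exact_mod_cast hm.card_last
  have hn4 : ∀ a : Fin 5, (Γ.numCells Γ.IsBoundaryCell {a, 4} : ℝ) = 0 := fun a =>
    Nat.cast_eq_zero.2 (Γ.numCells_boundary_of_last_mem (by simp [Fin.last]))
  have hn4' : (Γ.numCells Γ.IsBoundaryCell {4} : ℝ) = 0 :=
    Nat.cast_eq_zero.2 (Γ.numCells_boundary_of_last_mem (by simp [Fin.last]))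
  have hcomp : ∀ a b : Fin 5, a ≠ b → a ≠ 4 → b ≠ 4 → (numBoundaryComponents 4 P : ℝ) +
      Γ.numCells Γ.IsBoundaryCell {ε.1 a, ε.1 b} ≤ Nat.card (Γ.Cell {ε.1 a, ε.1 b}) + 1 :=
    fun a b hab ha hb => by
      exact_mod_cast hm.numBoundaryComponents_le_card hconn (hne a b hab) (hlt a ha) (hlt b hb)
  obtain ⟨h13, hrho⟩ := hm.rho_eq hχ ε
  have c02 := hcomp 0 2 (by decide) (by decide) (by decide)
  have c13 := hcomp 1 3 (by decide) (by decide) (by decide)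
  have c03 := hcomp 0 3 (by decide) (by decide) (by decide)
  have r02 := hrank 0 2 (by decide)
  have r24 := hrank 2 4 (by decide)
  have r14 := hrank 1 4 (by decide)
  have d02 := hrank' 0 2 (by decide)
  have d13 := hrank' 1 3 (by decide)
  have d24 := hrank' 2 4 (by decide)
  have d14 := hrank' 1 4 (by decide)
  have v0 := hv 0 (by decide)
  have v1 := hv 1 (by decide)
  have v2 := hv 2 (by decide)
  have v3 := hv 3 (by decide)
  have w0 := hv' 0 (by decide)
  have w1 := hv' 1 (by decide)
  have w2 := hv' 2 (by decide)
  have w3 := hv' 3 (by decide)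
  rw [h13] at c13 d13
  rw [hε4] at r24 r14 d24 d14
  have n24 := hn4 (ε.1 2)
  have n14 := hn4 (ε.1 1)
  refine ⟨m, m', _, hmeq, hmeq', hm.boundaryRegularGenus_le_of_cyclicOrder hPL hχ ε, ?_⟩
  rw [hε, hrho]
  -- In the formula for the genus, the first bound uses half the sum of `d02`, `d13`, `d24`, `d14`
  -- together with `c03`. The second uses `r02`, `r24`, `r14`, `c13`, `c03`, and the third `r24`,
  -- `r14`, `c02`, `c13`, `c03` with `b = N(02) - h`.
  refine ⟨?_, ?_, ?_⟩ <;> linarith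

end ColoredGraph

end

/-- The genus is an infimum over crystallizations, so each inequality is checked on every one of
them. Extended real numbers let the infimum be `⊤` when there is none. -/
theorem mainTheorem1 {N : ℕ}
    (K : Geometry.SimplicialComplex ℝ (EuclideanSpace ℝ (Fin N))) (hK : K.faces.Finite)
    (hM : IsPLManifold 4 K.space) (hconn : IsConnected K.space)
    (hbd : (plBoundary 4 K.space).Nonempty)
    (x : K.space) (y : Double 4 K.space)
    (χ h m m' : EReal)
    (hχ : χ = ((K.eulerCharacteristic : ℝ) : EReal))
    (hh : h = (numBoundaryComponents 4 K.space : EReal))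
    (hm : m = groupRank (FundamentalGroup K.space x))
    (hm' : m' = groupRank (FundamentalGroup (Double 4 K.space) y)) :
    2 * χ + 2 * m' - 2 ≤ regularGenus 4 K.space ∧
    2 * χ + 3 * m + 2 * h - 4 ≤ regularGenus 4 K.space ∧
    boundaryRegularGenus 3 K.space + 2 * χ + 2 * m + 2 * h - 4 ≤ regularGenus 4 K.space := by
  have hE := K.hasEuler_space hK
  have h2 : (2 : EReal) = ((2 : ℝ) : EReal) := rfl
  have h3 : (3 : EReal) = ((3 : ℝ) : EReal) := rfl
  have h4 : (4 : EReal) = ((4 : ℝ) : EReal) := rfl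
  subst hχ hh hm hm'
  refine ⟨le_sInf ?_, le_sInf ?_, le_sInf ?_⟩ <;> rintro _ ⟨V, _, Γ, hΓ, rfl⟩ <;>
    obtain ⟨m, m', b, hm, hm', hb, key₁, key₂, key₃⟩ := hΓ.bounds hM hbd hE x y
  · rw [hm', h2]
    exact_mod_cast key₁
  · rw [hm, h2, h3, h4]
    exact_mod_cast key₂
  · rw [hm]
    -- The genus of the boundary is first replaced by its finite upper bound, after which the
    -- inequality can be read in the real numbers.
    refine le_trans (b := (b : EReal) + 2 * ((K.eulerCharacteristic : ℝ) : EReal) + 2 * (m : EReal) +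
      2 * (numBoundaryComponents 4 K.space : EReal) - 4) ?_ ?_
    · exact EReal.sub_le_sub (by gcongr) le_rfl
    · rw [h2, h4]
      exact_mod_cast key₃
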